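/- For every constant $k\in\mathbb N$ there are constants $K\in\mathbb N$, $C>0$ and a single RAM program $P$ such that the following holds for all integers $w\ge 2$, $n\ge 0$, $\sigma\ge 1$ with $n\le 2^{kw}$ and $\sigma\le 2^{kw}$ (that is, $w=\Omega(\lg n)$, and a symbol fits in $O(1)$ machine words). Here $\lg$ is the logarithm to base $2$. Every string $S[1,n]$ over the alphabet $[1,\sigma]$ has a representation in a read-only memory of $w$-bit cells that occupies at most $C\,(n\lg\sigma+w)$ bits, i.e. $O(n\lg\sigma)$ bits besides a constant number of machine words, such that for every symbol $a\in[1,\sigma]$ and every $0\le i\le n$ the program $P$, given $a$ and $i$ and the representation, computes $$rank_a(S,i)=\bigl|\{\,j\in[1,i] : S[j]=a\,\}\bigr|$$ in at most $C\cdot\max\bigl(1,\ \lg\frac{\lg\sigma}{\lg w}\bigr)$ steps, i.e. in time $O\bigl(\lg\frac{\lg\sigma}{\lg w}\bigr)$ (the maximum is read as $1$ when $\sigma=1$). The machine is the unit-cost RAM: in one step it reads a $w$-bit cell of the representation, reads or writes a cell of a working memory (initially zero), compares two integers, or performs an arithmetic operation (addition, subtraction, multiplication, division, remainder), a bitwise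 logical operation or a bit shift, on unsigned integers of $O(w)$ bits, namely $Kw$ bits. The program $P$ depends on $k$ only, not on $w$, $n$, $\sigma$ or $S$. -/

import Mathlib

/-- `stringRank S a i`: the number of occurrences of the symbol `a` among the first `i` symbols of the
string `S = S[1] … S[n]`; the symbol `S[j+1]` is stored at the index `j : Fin n`. -/
def stringRank {n : ℕ} (S : Fin n → ℕ) (a i : ℕ) : ℕ :=
  (Finset.univ.filter fun j : Fin n => j.val < i ∧ S j = a).card

namespace RAM

/-- The unit-cost operations: arithmetic, bitwise logic and bit shifts. -/
inductive Op where
  | add | sub | mul | div | mod | and | or | xor | shl | shr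

/-- Operations act on unsigned `W`-bit integers; `add`, `sub`, `mul` and `shl` are modulo `2 ^ W`. -/
def Op.eval {W : ℕ} : Op → BitVec W → BitVec W → BitVec W
  | .add, x, y => x + y
  | .sub, x, y => x - y
  | .mul, x, y => x * y
  | .div, x, y => x / y
  | .mod, x, y => x % y
  | .and, x, y => x &&& y
  | .or, x, y => x ||| y
  | .xor, x, y => x ^^^ y
  | .shl, x, y => x <<< y.toNat
  | .shr, x, y => x >>> y.toNat

/-- Comparisons of two registers. -/
inductive Test where
  | eq (x y : ℕ)
  | lt (x y : ℕ)

/-- RAM programs. Natural numbers other than the literal of `const` are names of registers.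
The text of a program mentions neither the word length nor the data. -/
inductive Cmd where
  /-- Do nothing. -/
  | skip
  /-- `reg d := v` for a literal `v`. -/
  | const (d v : ℕ)
  /-- `reg d := o (reg x) (reg y)`. -/
  | op (o : Op) (d x y : ℕ)
  /-- `reg d := mem[reg x]`, where `mem` is the read-only memory that holds the representation. -/
  | load (d x : ℕ)
  /-- `reg d := work[reg x]`, where `work` is the working memory. -/
  | get (d x : ℕ)
  /-- `work[reg x] := reg y`. -/
  | put (x y : ℕ)
  | seq (p q : Cmd)
  | ite (b : Test) (p q : Cmd)
  | while (b : Test) (p : Cmd)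

/-- The registers and the working memory of a machine that operates on `W`-bit integers. -/
structure State (W : ℕ) where
  reg : ℕ → BitVec W
  work : ℕ → BitVec W

/-- Assign `v` to register `d`. -/
def State.set {W : ℕ} (s : State W) (d : ℕ) (v : BitVec W) : State W :=
  { s with reg := Function.update s.reg d v }

/-- The truth of a comparison in a state (unsigned comparison). -/
def Test.Holds {W : ℕ} (s : State W) : Test → Prop
  | .eq x y => s.reg x = s.reg y
  | .lt x y => (s.reg x).toNat < (s.reg y).toNat

/-- The start of a query with arguments `a` and `i`: they are in registers 0 and 1, and all other
registers and the working memory are zero. -/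
def State.init (W a i : ℕ) : State W where
  reg := fun k => if k = 0 then BitVec.ofNat W a else if k = 1 then BitVec.ofNat W i else 0
  work := fun _ => 0

/-- `Exec mem p s t s'`: the program `p`, started in state `s` with the read-only memory `mem` of
`w`-bit cells, halts in state `s'` after exactly `t` steps. Every elementary command and every
evaluation of a test is one step. Cells beyond the end of `mem` read as zero. -/
inductive Exec {w W : ℕ} (mem : List (BitVec w)) : Cmd → State W → ℕ → State W → Prop
  | skip (s : State W) : Exec mem .skip s 1 s
  | const (s : State W) (d v : ℕ) :
      Exec mem (.const d v) s 1 (s.set d (BitVec.ofNat W v))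
  | op (s : State W) (o : Op) (d x y : ℕ) :
      Exec mem (.op o d x y) s 1 (s.set d (o.eval (s.reg x) (s.reg y)))
  | load (s : State W) (d x : ℕ) :
      Exec mem (.load d x) s 1 (s.set d ((mem.getD (s.reg x).toNat 0).setWidth W))
  | get (s : State W) (d x : ℕ) :
      Exec mem (.get d x) s 1 (s.set d (s.work (s.reg x).toNat))
  | put (s : State W) (x y : ℕ) :
      Exec mem (.put x y) s 1
        { s with work := Function.update s.work (s.reg x).toNat (s.reg y) }
  | seq {p q : Cmd} {s s₁ s₂ : State W} {t₁ t₂ : ℕ} :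
      Exec mem p s t₁ s₁ → Exec mem q s₁ t₂ s₂ → Exec mem (.seq p q) s (t₁ + t₂) s₂
  | ite_true {b : Test} {p q : Cmd} {s s₁ : State W} {t : ℕ} :
      b.Holds s → Exec mem p s t s₁ → Exec mem (.ite b p q) s (t + 1) s₁
  | ite_false {b : Test} {p q : Cmd} {s s₁ : State W} {t : ℕ} :
      ¬ b.Holds s → Exec mem q s t s₁ → Exec mem (.ite b p q) s (t + 1) s₁
  | while_true {b : Test} {p : Cmd} {s s₁ s₂ : State W} {t₁ t₂ : ℕ} :
      b.Holds s → Exec mem p s t₁ s₁ → Exec mem (.while b p) s₁ t₂ s₂ →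
      Exec mem (.while b p) s (t₁ + t₂ + 1) s₂
  | while_false {b : Test} {p : Cmd} {s : State W} :
      ¬ b.Holds s → Exec mem (.while b p) s 1 s

end RAM

/-! Put `u = ⌊lg σ⌋ + 1` and `l = ⌊lg w⌋`. The memory holds the number `w`, then a table of wide
words of `κ * w` bits with `κ = 128 * (k + 1)`, then a packed bit string. Registers have `8 * κ * w`
bits, so expressions of degree at most 8 in wide quantities cannot overflow (`Ex.exact_of_small`).
If `n = 0` or `σ ≤ 1`, the rank is `i`.

If `16 * u ≤ l`, a whole block of symbols fits into one wide word. The rank is an absolute count at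
a superblock boundary, plus a count at a block boundary relative to the superblock, plus a count
inside the block. The last one compares all symbols of the block with `a` by a single subtraction
with guard bits and adds up the resulting flags by one remainder (`count_le_narrow_fields`).
Everything takes constant time (`exists_small_representation`).

Otherwise the symbol at position `j` becomes the integer key `S[j] * 2 ^ ν + j`, and a rank in the
string is the difference of two ranks among `n` distinct keys (`keyRank_sub_keyRank`). The high bits
of a key select a bucket by direct addressing. Keeping `B = l * (u / l + 2)` low bits leaves only
`O(1 + n / w)` buckets, so the bucket table is affordable, and what remains to be searched has a
length that depends on `σ` but not on `n`. Inside a bucket every `f ^ t`-th key is a sample. The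
samples form a trie with digits of `l` bits and depth `D = u / l + 2`, whose nodes are kept in a
two-level perfect hash table (`card_collisions_le`, `exists_dictionary`). Binary search on the
levels finds, in about `lg D` lookups, the node where the path of the query leaves the trie, and the
rank among the sampled indices is stored there (`exists_trie_dictionary`, `Loaded.trie`). A descent
through `t` levels of a search tree of degree `f`, with one word-parallel comparison per level
(`count_le_fields`), refines it to the exact rank (`Loaded.descent`, `Loaded.query`).

Space: `f ^ t ≥ min (w ^ 2) (n + 1)`, so there are at most `n / w ^ 2` samples; each accounts for at
most `D * w` nodes, hence the dictionary takes `O(n * u)` bits besides `O(w)`. Time: if `(B + 1) ^ 2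
≤ w`, the degree is a fixed power of `w` up to constants and `t` is bounded. If not, `u` is so large
that `lg w` is itself `O(1 + lg (u / l))`, and `t = O(lg w)` is good enough (`large_depths`). -/

namespace RAM

/-! ### Arithmetic expressions and their compilation -/

/-- The operations on natural numbers without overflow. -/
def Op.nat : Op → ℕ → ℕ → ℕ
  | .add, x, y => x + y
  | .sub, x, y => x - y
  | .mul, x, y => x * y
  | .div, x, y => x / y
  | .mod, x, y => x % y
  | .and, x, y => x &&& y
  | .or, x, y => x ||| y
  | .xor, x, y => x ^^^ y
  | .shl, x, y => x * 2 ^ y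
  | .shr, x, y => x / 2 ^ y

/-- The condition under which an operation on `W`-bit integers agrees with `Op.nat`. -/
def Op.Exact (W : ℕ) : Op → ℕ → ℕ → Prop
  | .add, x, y => x + y < 2 ^ W
  | .sub, x, y => y ≤ x
  | .mul, x, y => x * y < 2 ^ W
  | .shl, x, y => x * 2 ^ y < 2 ^ W
  | _, _, _ => True

theorem Op.toNat_eval {W : ℕ} (o : Op) (x y : BitVec W) (h : o.Exact W x.toNat y.toNat) :
    (o.eval x y).toNat = o.nat x.toNat y.toNat := by
  cases o <;> simp only [Op.eval, Op.nat, Op.Exact] at *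
  · rw [BitVec.toNat_add, Nat.mod_eq_of_lt h]
  · rw [BitVec.toNat_sub_of_le (by simpa [BitVec.le_def] using h)]
  · rw [BitVec.toNat_mul, Nat.mod_eq_of_lt h]
  · rw [BitVec.toNat_udiv]
  · rw [BitVec.toNat_umod]
  · rw [BitVec.toNat_and]
  · rw [BitVec.toNat_or]
  · rw [BitVec.toNat_xor]
  · rw [BitVec.toNat_shiftLeft, Nat.shiftLeft_eq, Nat.mod_eq_of_lt h]
  · rw [BitVec.toNat_ushiftRight, Nat.shiftRight_eq_div_pow]

/-- Expressions over the program variables and the read-only memory. -/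
inductive Ex where
  | var (x : ℕ)
  | lit (v : ℕ)
  | bin (o : Op) (e₁ e₂ : Ex)
  | ld (e : Ex)

/-- Registers below `numVars` hold program variables, the others are temporaries. -/
abbrev numVars : ℕ := 64

/-- The bits of `M` from position `o` on, `L` of them. -/
def bits (M o L : ℕ) : ℕ := M / 2 ^ o % 2 ^ L

/-- The value of an expression, without overflow, where the memory of `w`-bit cells is the binary
expansion of `M`. -/
def Ex.val (w M : ℕ) (ρ : ℕ → ℕ) : Ex → ℕ
  | .var x => ρ x
  | .lit v => v
  | .bin o e₁ e₂ => o.nat (e₁.val w M ρ) (e₂.val w M ρ)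
  | .ld e => bits M (w * e.val w M ρ) w

/-- No operation of the expression overflows. -/
def Ex.Exact (w M W : ℕ) (ρ : ℕ → ℕ) : Ex → Prop
  | .var _ => True
  | .lit v => v < 2 ^ W
  | .bin o e₁ e₂ => e₁.Exact w M W ρ ∧ e₂.Exact w M W ρ ∧
      o.Exact W (e₁.val w M ρ) (e₂.val w M ρ)
  | .ld e => e.Exact w M W ρ

/-- All variables of the expression are program variables. -/
def Ex.Closed : Ex → Prop
  | .var x => x < numVars
  | .lit _ => True
  | .bin _ e₁ e₂ => e₁.Closed ∧ e₂.Closed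
  | .ld e => e.Closed

/-- Code that evaluates an expression into register `d`, with temporaries from `d` on. -/
def Ex.code : Ex → ℕ → Cmd
  | .var x, d => .op .or d x x
  | .lit v, d => .const d v
  | .bin o e₁ e₂, d => .seq (e₁.code d) (.seq (e₂.code (d + 1)) (.op o d d (d + 1)))
  | .ld e, d => .seq (e.code d) (.load d d)

/-- The number of steps of `Ex.code`. -/
def Ex.cost : Ex → ℕ
  | .var _ => 1
  | .lit _ => 1
  | .bin _ e₁ e₂ => e₁.cost + (e₂.cost + 1)
  | .ld e => e.cost + 1

/-- `mem` is the binary expansion of `M`. -/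
def MemIs {w : ℕ} (mem : List (BitVec w)) (M : ℕ) : Prop :=
  ∀ i, (mem.getD i 0).toNat = bits M (w * i) w

/-- The program variables of the state `s` have the values `ρ`. -/
def Agrees {W : ℕ} (s : State W) (ρ : ℕ → ℕ) : Prop :=
  ∀ x < numVars, (s.reg x).toNat = ρ x

/-- Registers from `d` on serve as a stack. The second operand is evaluated from `d + 1` on, so it
destroys neither the first operand in `d` nor the variables; the clause on registers below `d`
carries the induction. -/
theorem Ex.exec_code {w W M : ℕ} {mem : List (BitVec w)} (hM : MemIs mem M) (hw : w ≤ W)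
    {ρ : ℕ → ℕ} (e : Ex) (hc : e.Closed) (he : e.Exact w M W ρ) (d : ℕ) (hd : numVars ≤ d)
    (s : State W) (hs : Agrees s ρ) :
    ∃ s', Exec mem (e.code d) s e.cost s' ∧ (s'.reg d).toNat = e.val w M ρ ∧
      ∀ x < d, s'.reg x = s.reg x := by
  induction e generalizing d s with
  | var x =>
    refine ⟨_, Exec.op s .or d x x, ?_, fun y hy => ?_⟩
    · simp [State.set, Op.eval, Ex.val, hs x hc]
    · simp [State.set, hy.ne]
  | lit v =>
    refine ⟨_, Exec.const s d v, ?_, fun y hy => ?_⟩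
    · simpa [State.set, Ex.val] using Nat.mod_eq_of_lt he
    · simp [State.set, hy.ne]
  | bin o e₁ e₂ ih₁ ih₂ =>
    obtain ⟨s₁, h₁, v₁, f₁⟩ := ih₁ hc.1 he.1 d hd s hs
    have hs₁ : Agrees s₁ ρ := fun x hx => by rw [f₁ x (by omega), hs x hx]
    obtain ⟨s₂, h₂, v₂, f₂⟩ := ih₂ hc.2 he.2.1 (d + 1) (by omega) s₁ hs₁
    refine ⟨_, .seq h₁ (.seq h₂ (Exec.op s₂ o d d (d + 1))), ?_, fun y hy => ?_⟩
    · have hd₂ : s₂.reg d = s₁.reg d := f₂ d (by omega)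
      have := Op.toNat_eval o (s₂.reg d) (s₂.reg (d + 1)) (by rw [hd₂, v₁, v₂]; exact he.2.2)
      simpa [State.set, Ex.val, hd₂, v₁, v₂] using this
    · simp [State.set, hy.ne, f₂ y (by omega), f₁ y hy]
  | ld e ih =>
    obtain ⟨s₁, h₁, v₁, f₁⟩ := ih hc he d hd s hs
    refine ⟨_, .seq h₁ (Exec.load s₁ d d), ?_, fun y hy => ?_⟩
    · have h := hM (s₁.reg d).toNat
      have hlt := (mem.getD (s₁.reg d).toNat 0).isLt
      simp only [State.set, Function.update_self, Ex.val, BitVec.toNat_setWidth]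
      rw [Nat.mod_eq_of_lt (hlt.trans_le (Nat.pow_le_pow_right (by norm_num) hw)), h, v₁]
    · simp [State.set, hy.ne, f₁ y hy]

/-! ### Reachability -/

/-- Started with the variables `ρ`, the program halts within `t` steps, with variables in `Q`. -/
def Reach {w : ℕ} (mem : List (BitVec w)) (W : ℕ) (c : Cmd) (ρ : ℕ → ℕ) (t : ℕ)
    (Q : (ℕ → ℕ) → Prop) : Prop :=
  ∀ s : State W, Agrees s ρ → ∃ t' ≤ t, ∃ s' ρ', Exec mem c s t' s' ∧ Agrees s' ρ' ∧ Q ρ'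

section
variable {w W M : ℕ} {mem : List (BitVec w)} {ρ : ℕ → ℕ} {t t₁ t₂ : ℕ} {Q R : (ℕ → ℕ) → Prop}
  {c p q : Cmd}

theorem Reach.mono (h : Reach mem W c ρ t₁ R) (ht : t₁ ≤ t₂) (hQ : ∀ ρ', R ρ' → Q ρ') :
    Reach mem W c ρ t₂ Q := fun s hs => by
  obtain ⟨t', ht', s', ρ', h₁, h₂, h₃⟩ := h s hs
  exact ⟨t', ht'.trans ht, s', ρ', h₁, h₂, hQ _ h₃⟩

theorem Reach.seq (hp : Reach mem W p ρ t₁ R) (hq : ∀ ρ', R ρ' → Reach mem W q ρ' t₂ Q) :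
    Reach mem W (.seq p q) ρ (t₁ + t₂) Q := fun s hs => by
  obtain ⟨t', ht', s', ρ', h₁, h₂, h₃⟩ := hp s hs
  obtain ⟨t'', ht'', s'', ρ'', k₁, k₂, k₃⟩ := hq ρ' h₃ s' h₂
  exact ⟨t' + t'', by omega, s'', ρ'', .seq h₁ k₁, k₂, k₃⟩

theorem Reach.skip (h : Q ρ) : Reach mem W .skip ρ 1 Q := fun s hs =>
  ⟨1, le_rfl, s, ρ, .skip s, hs, h⟩

/-- A comparison of two program variables. -/
def Test.On (ρ : ℕ → ℕ) : Test → Prop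
  | .eq x y => ρ x = ρ y
  | .lt x y => ρ x < ρ y

/-- The test compares program variables. -/
def Test.Closed : Test → Prop
  | .eq x y => x < numVars ∧ y < numVars
  | .lt x y => x < numVars ∧ y < numVars

theorem Test.holds_iff {b : Test} (hb : b.Closed) {s : State W} (hs : Agrees s ρ) :
    b.Holds s ↔ b.On ρ := by
  cases b <;> simp only [Test.Holds, Test.On, Test.Closed] at *
  · rw [← hs _ hb.1, ← hs _ hb.2, BitVec.toNat_inj]
  · rw [← hs _ hb.1, ← hs _ hb.2]

theorem Reach.ite {b : Test} (hb : b.Closed) (hp : b.On ρ → Reach mem W p ρ t Q)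
    (hq : ¬ b.On ρ → Reach mem W q ρ t Q) : Reach mem W (.ite b p q) ρ (t + 1) Q := fun s hs => by
  by_cases h : b.On ρ
  · obtain ⟨t', ht', s', ρ', h₁, h₂⟩ := hp h s hs
    exact ⟨t' + 1, by omega, s', ρ', .ite_true ((Test.holds_iff hb hs).2 h) h₁, h₂⟩
  · obtain ⟨t', ht', s', ρ', h₁, h₂⟩ := hq h s hs
    exact ⟨t' + 1, by omega, s', ρ', .ite_false (fun h' => h ((Test.holds_iff hb hs).1 h')) h₁, h₂⟩

/-- The index of `I` is a budget of iterations: the test can hold only while the budget is positive,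
and each pass lowers it by one. -/
theorem Reach.while {b : Test} (hb : b.Closed) (I : ℕ → (ℕ → ℕ) → Prop)
    (hexit : ∀ n ρ, I n ρ → ¬ b.On ρ → Q ρ)
    (hstep : ∀ n ρ, I n ρ → b.On ρ → ∃ n', n = n' + 1 ∧ Reach mem W p ρ t (I n'))
    (n : ℕ) (h : I n ρ) : Reach mem W (.while b p) ρ (n * (t + 1) + 1) Q := by
  induction n generalizing ρ with
  | zero =>
    intro s hs
    have h' : ¬ b.On ρ := fun hb' => by
      obtain ⟨n', h₁, -⟩ := hstep 0 ρ h hb'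
      omega
    exact ⟨1, by omega, s, ρ, .while_false (fun k => h' ((Test.holds_iff hb hs).1 k)), hs,
      hexit _ _ h h'⟩
  | succ n ih =>
    intro s hs
    by_cases hon : b.On ρ
    · obtain ⟨n', h₁, h₂⟩ := hstep _ ρ h hon
      obtain rfl : n = n' := by omega
      obtain ⟨t', ht', s', ρ', k₁, k₂, k₃⟩ := h₂ s hs
      obtain ⟨t'', ht'', s'', ρ'', l₁, l₂, l₃⟩ := ih k₃ s' k₂
      refine ⟨t' + t'' + 1, ?_, s'', ρ'', .while_true ((Test.holds_iff hb hs).2 hon) k₁ l₁, l₂, l₃⟩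
      rw [Nat.add_mul]
      omega
    · exact ⟨1, by omega, s, ρ, .while_false (fun k => hon ((Test.holds_iff hb hs).1 k)), hs,
        hexit _ _ h hon⟩

/-- Assignment of the value of an expression to a program variable. -/
def assign (x : ℕ) (e : Ex) : Cmd := .seq (e.code numVars) (.op .or x numVars numVars)

theorem Reach.assign_exact (hM : MemIs mem M) (hw : w ≤ W) {x : ℕ} {e : Ex} (hx : x < numVars)
    (hc : e.Closed) (he : e.Exact w M W ρ) (hQ : Q (Function.update ρ x (e.val w M ρ))) :
    Reach mem W (assign x e) ρ (e.cost + 1) Q := fun s hs => by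
  obtain ⟨s₁, h₁, v₁, f₁⟩ := e.exec_code hM hw hc he numVars le_rfl s hs
  refine ⟨_, le_rfl, _, _, .seq h₁ (Exec.op s₁ .or x numVars numVars), fun y hy => ?_, hQ⟩
  by_cases hyx : y = x
  · subst hyx
    simpa [State.set, Op.eval] using v₁
  · simp [State.set, hyx, f₁ y hy, hs y hy]

/-! ### Expressions that cannot overflow -/

/-- A bound for the value of an expression, as an exponent of the bound of its variables. -/
def Ex.deg : Ex → ℕ
  | .var _ => 1
  | .lit _ => 1
  | .bin .add e₁ e₂ => max e₁.deg e₂.deg + 1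
  | .bin .mul e₁ e₂ => e₁.deg + e₂.deg
  | .bin _ e₁ e₂ => max e₁.deg e₂.deg
  | .ld e => e.deg

/-- Syntactic well-formedness: program variables and small literals only, no memory access, and
no operations that do not respect `Ex.deg`. -/
def Ex.Small : Ex → Bool
  | .var x => decide (x < numVars)
  | .lit v => decide (v ≤ 32)
  | .bin .or _ _ => false
  | .bin .xor _ _ => false
  | .bin _ e₁ e₂ => e₁.Small && e₂.Small
  | .ld _ => false

/-- The side conditions of the operations that are not covered by `Ex.deg`. -/
def Ex.Side (β : ℕ) (ρ : ℕ → ℕ) : Ex → Prop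
  | .bin .sub e₁ e₂ => e₁.Side β ρ ∧ e₂.Side β ρ ∧ e₂.val 0 0 ρ ≤ e₁.val 0 0 ρ
  | .bin .shl e₁ e₂ => e₁.Side β ρ ∧ e₂.Side β ρ ∧ e₁.val 0 0 ρ * 2 ^ e₂.val 0 0 ρ < β
  | .bin _ e₁ e₂ => e₁.Side β ρ ∧ e₂.Side β ρ
  | _ => True

theorem Ex.deg_pos (e : Ex) : 1 ≤ e.deg := by
  induction e with
  | var | lit => simp [Ex.deg]
  | bin o => cases o <;> simp only [Ex.deg] <;> omega
  | ld => simpa [Ex.deg]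

theorem Ex.closed_of_small {e : Ex} (h : e.Small = true) : e.Closed := by
  induction e with
  | var x => simpa [Ex.Small, Ex.Closed] using h
  | lit => trivial
  | bin o e₁ e₂ h₁ h₂ => cases o <;> simp_all [Ex.Small, Ex.Closed]
  | ld => simp [Ex.Small] at h

theorem Ex.val_eq_of_small {e : Ex} (h : e.Small = true) (w M : ℕ) (ρ : ℕ → ℕ) :
    e.val w M ρ = e.val 0 0 ρ := by
  induction e with
  | var x => rfl
  | lit => rfl
  | bin o e₁ e₂ h₁ h₂ => cases o <;> simp_all [Ex.Small, Ex.val]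
  | ld => simp [Ex.Small] at h

/-- A sum costs one extra factor `β` and a product adds exponents. A left shift admits no bound by
degree, so `Ex.Side` bounds its result by `β` directly. -/
theorem Ex.val_lt_of_small {e : Ex} (h : e.Small = true) {β : ℕ} (hβ : 32 < β) {ρ : ℕ → ℕ}
    (hρ : ∀ x, ρ x < β) (hs : e.Side β ρ) : e.val 0 0 ρ < β ^ e.deg := by
  have mono : ∀ {m n x : ℕ}, x < β ^ m → m ≤ n → x < β ^ n := fun h h' =>
    h.trans_le (Nat.pow_le_pow_right (by omega) h')
  induction e with
  | var x => simpa [Ex.val, Ex.deg] using hρ x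
  | lit v =>
    have : v ≤ 32 := by simpa [Ex.Small] using h
    simp only [Ex.val, Ex.deg, pow_one]
    omega
  | bin o e₁ e₂ h₁ h₂ =>
    cases o <;> simp only [Ex.Small, Ex.Side, Bool.and_eq_true, Bool.false_eq_true] at h hs <;>
      simp only [Ex.val, Op.nat, Ex.deg]
    · have k₁ := mono (h₁ h.1 hs.1) (le_max_left _ e₂.deg)
      have k₂ := mono (h₂ h.2 hs.2) (le_max_right e₁.deg _)
      rw [pow_succ]
      nlinarith
    · exact (Nat.sub_le _ _).trans_lt (mono (h₁ h.1 hs.1) (le_max_left _ _))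
    · rw [pow_add]
      exact Nat.mul_lt_mul'' (h₁ h.1 hs.1) (h₂ h.2 hs.2)
    · exact (Nat.div_le_self _ _).trans_lt (mono (h₁ h.1 hs.1) (le_max_left _ _))
    · exact (Nat.mod_le _ _).trans_lt (mono (h₁ h.1 hs.1) (le_max_left _ _))
    · exact Nat.and_le_left.trans_lt (mono (h₁ h.1 hs.1) (le_max_left _ _))
    · exact mono (m := 1) (by simpa using hs.2.2) (le_max_of_le_left e₁.deg_pos)
    · exact (Nat.div_le_self _ _).trans_lt (mono (h₁ h.1 hs.1) (le_max_left _ _))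
  | ld => simp [Ex.Small] at h

/-- This reduces the absence of overflow to a syntactic check of shape and degree that is settled by
computation; only subtractions and left shifts leave something to prove. -/
theorem Ex.exact_of_small {e : Ex} (h : e.Small = true) {β W D : ℕ} (hβ : 32 < β)
    (hW : β ^ D = 2 ^ W) (hD : e.deg ≤ D) {ρ : ℕ → ℕ} (hρ : ∀ x, ρ x < β) (hs : e.Side β ρ) (w M : ℕ) :
    e.Exact w M W ρ := by
  have hlt := Ex.val_lt_of_small h hβ hρ hs
  have hlt' : e.val 0 0 ρ < 2 ^ W := hW ▸ hlt.trans_le (Nat.pow_le_pow_right (by omega) hD)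
  induction e with
  | var x => trivial
  | lit v => exact hlt'
  | bin o e₁ e₂ h₁ h₂ =>
    have hd : e₁.deg ≤ D ∧ e₂.deg ≤ D := by
      cases o <;> simp only [Ex.deg] at hD <;> omega
    have hS : (e₁.Small = true ∧ e₂.Small = true) ∧ e₁.Side β ρ ∧ e₂.Side β ρ := by
      cases o <;> simp_all [Ex.Small, Ex.Side]
    obtain ⟨⟨hS₁, hS₂⟩, hs₁, hs₂⟩ := hS
    have mono : ∀ {m x : ℕ}, x < β ^ m → m ≤ D → x < 2 ^ W := fun h h' =>
      hW ▸ h.trans_le (Nat.pow_le_pow_right (by omega) h')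
    have l₁ := Ex.val_lt_of_small hS₁ hβ hρ hs₁
    have l₂ := Ex.val_lt_of_small hS₂ hβ hρ hs₂
    refine ⟨h₁ hS₁ hd.1 hs₁ l₁ (mono l₁ hd.1), h₂ hS₂ hd.2 hs₂ l₂ (mono l₂ hd.2), ?_⟩
    rw [Ex.val_eq_of_small hS₁, Ex.val_eq_of_small hS₂]
    cases o <;> simp only [Op.Exact] <;> first | trivial | exact hlt' | skip
    exact hs.2.2
  | ld => simp [Ex.Small] at h

end

/-! ### Bit fields -/

theorem bits_lt (M o L : ℕ) : bits M o L < 2 ^ L := Nat.mod_lt _ (by positivity)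

theorem bits_add (M o p q : ℕ) : bits M o (p + q) = bits M o p + 2 ^ p * bits M (o + p) q := by
  simp only [bits]
  rw [pow_add, Nat.mod_mul, Nat.div_div_eq_div_mul, pow_add]

theorem bits_bits {M o L p q : ℕ} (h : p + q ≤ L) : bits (bits M o L) p q = bits M (o + p) q := by
  obtain ⟨r, rfl⟩ := Nat.exists_eq_add_of_le h
  rw [show p + q + r = p + (q + r) by ring, bits_add M o p, bits_add M (o + p) q]
  have := bits_lt M o p
  rw [bits, Nat.add_mul_div_left _ _ (by positivity), Nat.div_eq_of_lt this, zero_add,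
    Nat.add_mul_mod_self_left, Nat.mod_eq_of_lt (bits_lt _ _ _)]

theorem bits_append_left {A B l o L : ℕ} (h : o + L ≤ l) :
    bits (A + 2 ^ l * B) o L = bits A o L := by
  obtain ⟨r, rfl⟩ := Nat.exists_eq_add_of_le h
  rw [bits, show 2 ^ (o + L + r) * B = 2 ^ o * (2 ^ L * (2 ^ r * B)) by ring,
    Nat.add_mul_div_left _ _ (by positivity), Nat.add_mul_mod_self_left, bits]

theorem bits_append_right {A B l : ℕ} (hA : A < 2 ^ l) (o L : ℕ) :
    bits (A + 2 ^ l * B) (l + o) L = bits B o L := by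
  rw [bits, pow_add, ← Nat.div_div_eq_div_mul, Nat.add_mul_div_left _ _ (by positivity),
    Nat.div_eq_of_lt hA, zero_add, bits]

theorem bits_zero_of_lt {M L : ℕ} (h : M < 2 ^ L) : bits M 0 L = M := by
  simp [bits, Nat.mod_eq_of_lt h]

/-- The memory cells of the binary expansion of `M`. -/
def cells (w M len : ℕ) : List (BitVec w) :=
  (List.range len).map fun i => BitVec.ofNat w (M / 2 ^ (w * i))

theorem cells_memIs {w M len : ℕ} (h : M < 2 ^ (w * len)) : MemIs (cells w M len) M := by
  intro i
  rcases lt_or_ge i len with hi | hi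
  · simp [cells, hi, bits]
  · have : M / 2 ^ (w * i) = 0 :=
      Nat.div_eq_of_lt (h.trans_le (Nat.pow_le_pow_right (by norm_num) (Nat.mul_le_mul_left w hi)))
    simp [cells, hi, bits, this]

/-! ### Reading bit fields -/

/-- The expression that assembles `q` consecutive cells, beginning with the one that contains bit
number `o`. Variable `2` holds the cell length. -/
def cellsEx (o : Ex) : ℕ → Ex
  | 0 => .lit 0
  | q + 1 => .bin .add (cellsEx o q) (.bin .shl (.ld (.bin .add (.bin .div o (.var 2)) (.lit q)))
      (.bin .mul (.lit q) (.var 2)))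

/-- The expression that reads `L` bits at position `o`, if `L` is at most `κ` times the length of a
cell. -/
def readEx (κ : ℕ) (o L : Ex) : Ex :=
  .bin .mod (.bin .shr (cellsEx o (κ + 1)) (.bin .mod o (.var 2))) (.bin .shl (.lit 1) L)

/-- A machine with the memory contents `M`, for the constant `κ`. -/
structure Machine (κ w M : ℕ) (mem : List (BitVec w)) : Prop where
  memIs : MemIs mem M
  two_le : 2 ≤ w
  sixteen_le : 16 ≤ κ

section
variable {κ w M : ℕ} {mem : List (BitVec w)} {ρ : ℕ → ℕ} {Q : (ℕ → ℕ) → Prop}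

theorem cellsEx_val (hw : ρ 2 = w) (o : Ex) (q : ℕ) :
    (cellsEx o q).val w M ρ = bits M (w * (o.val w M ρ / w)) (w * q) := by
  induction q with
  | zero => simp [cellsEx, Ex.val, bits, Nat.mod_one]
  | succ q ih =>
    simp only [cellsEx, Ex.val, Op.nat, hw, ih, Nat.mul_succ, bits_add]
    rw [mul_comm q w, mul_comm (bits _ _ _), mul_add]

/-- A field of at most `κ * w` bits that starts anywhere inside a cell is covered by `κ + 1`
consecutive cells. These are assembled, shifted by the offset in the first cell and truncated. -/
theorem readEx_val (hκ : 2 ≤ w) (hw : ρ 2 = w) (o L : Ex) (hL : L.val w M ρ ≤ κ * w) :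
    (readEx κ o L).val w M ρ = bits M (o.val w M ρ) (L.val w M ρ) := by
  have hlt : o.val w M ρ % w < w := Nat.mod_lt _ (by omega)
  simp only [readEx, Ex.val, Op.nat, hw, cellsEx_val, one_mul]
  have := bits_bits (M := M) (o := w * (o.val w M ρ / w)) (L := w * (κ + 1))
    (p := o.val w M ρ % w) (q := L.val w M ρ) (by rw [mul_comm w, Nat.add_mul]; omega)
  rw [Nat.div_add_mod] at this
  rw [← this]
  rfl

namespace Machine

theorem thirtytwo_lt (m : Machine κ w M mem) : 32 < 2 ^ (κ * w) := by
  have h₁ := m.two_le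
  have h₂ := m.sixteen_le
  calc 32 < 2 ^ 6 := by norm_num
    _ ≤ _ := Nat.pow_le_pow_right (by norm_num) (by nlinarith)

theorem le_width (m : Machine κ w M mem) : w ≤ 8 * κ * w := by
  have h₂ := m.sixteen_le
  nlinarith

/-- This is the origin of the register length: eight factors, each of the size of a wide word. -/
theorem pow_width (κ w : ℕ) : (2 ^ (κ * w)) ^ 8 = 2 ^ (8 * κ * w) := by
  rw [← pow_mul]
  congr 1
  ring

theorem reach_assign (m : Machine κ w M mem) {x : ℕ} {e : Ex} (hx : x < numVars)
    (hS : e.Small = true) (hD : e.deg ≤ 8)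
    (hρ : ∀ x, ρ x < 2 ^ (κ * w)) (hs : e.Side (2 ^ (κ * w)) ρ)
    (hQ : Q (Function.update ρ x (e.val 0 0 ρ))) :
    Reach mem (8 * κ * w) (assign x e) ρ (e.cost + 1) Q := by
  refine Reach.assign_exact m.memIs m.le_width hx (Ex.closed_of_small hS)
    (Ex.exact_of_small hS m.thirtytwo_lt (pow_width κ w) hD hρ hs w M) ?_
  rwa [Ex.val_eq_of_small hS]

/-- The assembled `κ + 1` cells fit, as `(κ + 1) * w ≤ 8 * κ * w`. The bound on the address has
exponent 7, not 8, to leave room for adding the cell index `q`. -/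
theorem readEx_exact (m : Machine κ w M mem) {o L : Ex} (hw : ρ 2 = w)
    (ho : o.Exact w M (8 * κ * w) ρ) (hL : L.Exact w M (8 * κ * w) ρ) (hL' : L.val w M ρ ≤ κ * w)
    (ho' : o.val w M ρ < (2 ^ (κ * w)) ^ 7) : (readEx κ o L).Exact w M (8 * κ * w) ρ := by
  have hκ := m.sixteen_le
  have hw2 := m.two_le
  have hlt : 8 * κ * w < 2 ^ (8 * κ * w) := Nat.lt_two_pow_self
  have hβ := m.thirtytwo_lt
  have hpow := pow_width κ w
  have key : ∀ q ≤ κ + 1, (cellsEx o q).Exact w M (8 * κ * w) ρ := by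
    intro q hq
    induction q with
    | zero => simp [cellsEx, Ex.Exact]
    | succ q ih =>
      have h₁ : q * w < 2 ^ (8 * κ * w) := by nlinarith
      have h₀ : q < 2 ^ (8 * κ * w) := by nlinarith
      have h₂ := bits_lt M (w * (o.val w M ρ / w)) (w * q)
      have h₃ := bits_lt M (w * (o.val w M ρ / w + q)) w
      have h₄ : w * q + w ≤ 8 * κ * w := by nlinarith
      have h₅ : 2 ^ (w * q) * 2 ^ w ≤ 2 ^ (8 * κ * w) := by
        rw [← pow_add]; exact Nat.pow_le_pow_right (by norm_num) h₄
      have h₆ : bits M (w * (o.val w M ρ / w + q)) w * 2 ^ (q * w) < 2 ^ (8 * κ * w) := by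
        rw [mul_comm q w]
        exact lt_of_lt_of_le (by rw [mul_comm]; exact Nat.mul_lt_mul_of_pos_left h₃ (by positivity))
          h₅
      refine ⟨ih (by omega), ⟨⟨⟨ho, trivial, trivial⟩, h₀, ?_⟩, ⟨h₀, trivial, ?_⟩, ?_⟩, ?_⟩
      · simp only [Op.Exact, Ex.val, Op.nat, hw]
        have : o.val w M ρ / w ≤ o.val w M ρ := Nat.div_le_self _ _
        have h8 : (2 ^ (κ * w)) ^ 8 = (2 ^ (κ * w)) ^ 7 * 2 ^ (κ * w) := by ring
        have hq' : q < (2 ^ (κ * w)) ^ 7 := by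
          have : κ * w < 2 ^ (κ * w) := Nat.lt_two_pow_self
          have : 2 ^ (κ * w) ≤ (2 ^ (κ * w)) ^ 7 := Nat.le_self_pow (by norm_num) _
          nlinarith
        rw [← hpow, h8]
        nlinarith
      · simpa [Op.Exact, Ex.val, hw] using h₁
      · simpa [Op.Exact, Ex.val, hw, Op.nat] using h₆
      -- The part assembled so far plus the shifted next cell is again a bit field of `M`, so its
      -- length bounds it.
      · simp only [Op.Exact, cellsEx_val hw, Ex.val, Op.nat, hw]
        have h₇ := bits_add M (w * (o.val w M ρ / w)) (w * q) w
        rw [show w * (o.val w M ρ / w) + w * q = w * (o.val w M ρ / w + q) by ring,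
          mul_comm (2 ^ _)] at h₇
        rw [mul_comm q w, ← h₇]
        exact (bits_lt _ _ _).trans_le (Nat.pow_le_pow_right (by norm_num) h₄)
  refine ⟨⟨key _ le_rfl, ⟨ho, trivial, trivial⟩, trivial⟩,
    ⟨Nat.one_lt_two_pow (by nlinarith), hL, ?_⟩, trivial⟩
  simp only [Op.Exact, Ex.val, one_mul]
  exact Nat.pow_lt_pow_right (by norm_num) (by nlinarith)

theorem reach_read (m : Machine κ w M mem) {x : ℕ} {o L : Ex} (hx : x < numVars)
    (ho : o.Small = true) (hL : L.Small = true) (hDo : o.deg ≤ 7) (hDL : L.deg ≤ 8) (hρ : ∀ x, ρ x < 2 ^ (κ * w))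
    (hw : ρ 2 = w) (hso : o.Side (2 ^ (κ * w)) ρ) (hsL : L.Side (2 ^ (κ * w)) ρ)
    (hl : L.val 0 0 ρ ≤ κ * w)
    (hQ : Q (Function.update ρ x (bits M (o.val 0 0 ρ) (L.val 0 0 ρ)))) :
    Reach mem (8 * κ * w) (assign x (readEx κ o L)) ρ ((readEx κ o L).cost + 1) Q := by
  have ex {e : Ex} (h : e.Small = true) (hD : e.deg ≤ 8) (hs : e.Side (2 ^ (κ * w)) ρ) :=
    Ex.exact_of_small h m.thirtytwo_lt (pow_width κ w) hD hρ hs w M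
  have hvo := Ex.val_eq_of_small ho w M ρ
  have hvL := Ex.val_eq_of_small hL w M ρ
  have hcell : ∀ q, (cellsEx o q).Closed := fun q => by
    induction q with
    | zero => trivial
    | succ q ih => exact ⟨ih, ⟨⟨Ex.closed_of_small ho, show 2 < 64 by norm_num⟩, trivial⟩, trivial,
        show 2 < 64 by norm_num⟩
  refine Reach.assign_exact m.memIs m.le_width hx
    ⟨⟨hcell _, Ex.closed_of_small ho, show 2 < 64 by norm_num⟩, trivial, Ex.closed_of_small hL⟩
    (m.readEx_exact hw (ex ho (by omega) hso) (ex hL hDL hsL) (by rwa [hvL]) ?_) ?_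
  · rw [hvo]
    exact (Ex.val_lt_of_small ho m.thirtytwo_lt hρ hso).trans_le
      (Nat.pow_le_pow_right (by positivity) hDo)
  · rwa [readEx_val m.two_le hw o L (by rwa [hvL]), hvo, hvL]

end Machine
end

/-! ### Packed arrays -/

/-- The list of `β`-bit numbers `l`, packed into one number. -/
def pack (β : ℕ) : List ℕ → ℕ
  | [] => 0
  | x :: l => x + 2 ^ β * pack β l

theorem pack_append (β : ℕ) (l₁ l₂ : List ℕ) :
    pack β (l₁ ++ l₂) = pack β l₁ + 2 ^ (β * l₁.length) * pack β l₂ := by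
  induction l₁ with
  | nil => simp [pack]
  | cons x l ih =>
    simp only [List.cons_append, pack, ih, List.length_cons, Nat.mul_succ, pow_add]
    ring

theorem pack_lt {β : ℕ} {l : List ℕ} (h : ∀ x ∈ l, x < 2 ^ β) :
    pack β l < 2 ^ (β * l.length) := by
  induction l with
  | nil => simp [pack]
  | cons x l ih =>
    have h₁ := h x (by simp)
    have h₂ := ih fun y hy => h y (by simp [hy])
    simp only [pack, List.length_cons, Nat.mul_succ, pow_add]
    nlinarith

/-- No bound on `j` or `f` is needed: past the end of the list the packed number has only zero bits.
A read near the end may therefore ask for more fields than exist. -/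
theorem bits_pack {β : ℕ} {l : List ℕ} (h : ∀ x ∈ l, x < 2 ^ β) (j f : ℕ) :
    bits (pack β l) (β * j) (β * f) = pack β ((l.drop j).take f) := by
  have h₁ : bits (pack β l) (β * j) (β * f) = bits (pack β (l.drop j)) 0 (β * f) := by
    rcases le_or_gt j l.length with hj | hj
    · conv_lhs => rw [← List.take_append_drop j l, pack_append]
      have : β * j = β * (l.take j).length + 0 := by simp [hj]
      rw [this, bits_append_right (pack_lt fun x hx => h x (List.mem_of_mem_take hx))]
    · rw [List.drop_eq_nil_of_le hj.le, bits, Nat.div_eq_of_lt, pack, bits, Nat.zero_div]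
      exact (pack_lt h).trans_le
        (Nat.pow_le_pow_right (by norm_num) (Nat.mul_le_mul_left _ hj.le))
  have h' : ∀ x ∈ l.drop j, x < 2 ^ β := fun x hx => h x (List.mem_of_mem_drop hx)
  rw [h₁]
  generalize l.drop j = k at h'
  rcases le_or_gt f k.length with hf | hf
  · conv_lhs => rw [← List.take_append_drop f k, pack_append]
    have ht : (k.take f).length = f := by simp [hf]
    have := pack_lt (l := k.take f) fun x hx => h' x (List.mem_of_mem_take hx)
    rw [ht] at this ⊢
    rw [bits_append_left (by omega), bits_zero_of_lt this]
  · rw [List.take_of_length_le hf.le, bits_zero_of_lt]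
    exact (pack_lt h').trans_le (Nat.pow_le_pow_right (by norm_num) (Nat.mul_le_mul_left _ hf.le))

theorem bits_pack_one {β : ℕ} {l : List ℕ} (h : ∀ x ∈ l, x < 2 ^ β) (j : ℕ) :
    bits (pack β l) (β * j) β = l.getD j 0 := by
  have := bits_pack h j 1
  rw [mul_one] at this
  rw [this]
  rcases lt_or_ge j l.length with hj | hj
  · rw [List.drop_eq_getElem_cons hj, List.getD_eq_getElem _ _ hj,
      List.take_succ_cons, List.take_zero, pack, pack, mul_zero, add_zero]
  · simp [List.drop_eq_nil_of_le hj, pack, hj]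

theorem pack_map_range (β r : ℕ) (g : ℕ → ℕ) :
    pack β ((List.range r).map g) = ∑ i ∈ Finset.range r, g i * 2 ^ (β * i) := by
  induction r with
  | zero => simp [pack]
  | succ r ih =>
    rw [List.range_succ, List.map_append, pack_append, ih, Finset.sum_range_succ]
    simp [pack, mul_comm]

theorem pack_append_replicate_zero (β : ℕ) (l : List ℕ) (r : ℕ) :
    pack β (l ++ List.replicate r 0) = pack β l := by
  have : pack β (List.replicate r 0) = 0 := by
    induction r with
    | zero => rfl
    | succ r ih => simp [List.replicate_succ, pack, ih]
  simp [pack_append, this]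

theorem pack_replicate_one_mul (β c : ℕ) (r : ℕ) :
    c * pack β (List.replicate r 1) = pack β (List.replicate r c) := by
  induction r with
  | zero => simp [pack]
  | succ r ih =>
    simp only [List.replicate_succ, pack, ← ih]
    ring

theorem pack_map_mul (β c : ℕ) (l : List ℕ) (g : ℕ → ℕ) :
    pack β (l.map fun x => c * g x) = c * pack β (l.map g) := by
  induction l with
  | nil => simp [pack]
  | cons x l ih =>
    simp only [List.map_cons, pack, ih]
    ring

theorem append_and_append {b A A' C C' : ℕ} (hA : A < 2 ^ b) (hC : C < 2 ^ b) :
    (A + 2 ^ b * A') &&& (C + 2 ^ b * C') = (A &&& C) + 2 ^ b * (A' &&& C') := by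
  rw [add_comm A, add_comm C, add_comm (A &&& C)]
  apply Nat.eq_of_testBit_eq
  intro i
  rw [Nat.testBit_and, Nat.testBit_two_pow_mul_add _ hA, Nat.testBit_two_pow_mul_add _ hC,
    Nat.testBit_two_pow_mul_add _ (Nat.and_lt_two_pow _ hC)]
  split_ifs <;> simp

theorem pack_map_and {α : Type*} {b : ℕ} (l : List α) (g h : α → ℕ) (hg : ∀ x ∈ l, g x < 2 ^ b)
    (hh : ∀ x ∈ l, h x < 2 ^ b) :
    pack b (l.map g) &&& pack b (l.map h) = pack b (l.map fun x => g x &&& h x) := by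
  induction l with
  | nil => simp [pack]
  | cons x l ih =>
    simp only [List.map_cons, pack]
    rw [append_and_append (hg x (by simp)) (hh x (by simp)),
      ih (fun y hy => hg y (by simp [hy])) (fun y hy => hh y (by simp [hy]))]

/-- Casting out: `2 ^ b` is congruent to 1, so a number is congruent to the sum of its digits in
base `2 ^ b`. One remainder thus adds all fields. -/
theorem pack_modEq_sum (b : ℕ) (l : List ℕ) : pack b l ≡ l.sum [MOD 2 ^ b - 1] := by
  induction l with
  | nil => rfl
  | cons x l ih =>
    have h : 2 ^ b ≡ 1 [MOD 2 ^ b - 1] := by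
      have := Nat.ModEq.refl (n := 2 ^ b - 1) 1
      have h2 : 2 ^ b = 1 + (2 ^ b - 1) := by have := Nat.one_le_two_pow (n := b); omega
      conv_lhs => rw [h2]
      simp [Nat.ModEq]
    simpa [pack] using (Nat.ModEq.refl x).add (h.mul ih)

theorem pack_mod_eq_sum {b : ℕ} {l : List ℕ} (h : l.sum < 2 ^ b - 1) :
    pack b l % (2 ^ b - 1) = l.sum := by
  rw [pack_modEq_sum b l, Nat.mod_eq_of_lt h]

/-! ### Parallel comparison -/

theorem sum_map_ite_eq_countP (l : List ℕ) (z : ℕ) :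
    (l.map fun y => if y ≤ z then 1 else 0).sum = l.countP (· ≤ z) := by
  induction l with
  | nil => simp
  | cons x l ih => by_cases h : x ≤ z <;> simp [h, ih, add_comm]

/-- The guard bit `2 ^ B` survives the subtraction exactly if `z` can supply `y` without borrowing
from it. -/
theorem add_sub_and_two_pow {B y z : ℕ} (hy : y < 2 ^ B) (hz : z < 2 ^ B) :
    (z + 2 ^ B - y) &&& 2 ^ B = 2 ^ B * if y ≤ z then 1 else 0 := by
  rw [Nat.and_two_pow, Nat.testBit_eq_decide_div_mod_eq]
  split_ifs with h
  · have : (z + 2 ^ B - y) / 2 ^ B = 1 := by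
      rw [Nat.div_eq_iff (by positivity)]; omega
    simp [this]
  · have : (z + 2 ^ B - y) / 2 ^ B = 0 := Nat.div_eq_of_lt (by omega)
    simp [this]

/-- The comparison flags of the packed fields with `z`, computed by one subtraction. -/
theorem compare_flags {B f v z : ℕ} {l : List ℕ} (hl : ∀ y ∈ l, y < 2 ^ B) (hz : z < 2 ^ B)
    (hf : l.length ≤ f) :
    ((z * pack (B + 1) (List.replicate f 1) + 2 ^ B * pack (B + 1) (List.replicate f 1) -
      pack (B + 1) l) &&& (2 ^ B * pack (B + 1) (List.replicate f 1))) / 2 ^ B % 2 ^ ((B + 1) * v) =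
    pack (B + 1) (((l ++ List.replicate (f - l.length) 0).take v).map
      fun y => if y ≤ z then 1 else 0) := by
  -- The list is padded with zeros to exactly `f` fields. The padding also raises flags, since `0 ≤
  -- z`, which is why only the first `v` flags are kept at the end.
  rw [← pack_append_replicate_zero (B + 1) l (f - l.length)]
  have hk : ∀ y ∈ l ++ List.replicate (f - l.length) 0, y < 2 ^ B := by
    intro y hy
    rcases List.mem_append.1 hy with h | h
    · exact hl y h
    · rw [(List.mem_replicate.1 h).2]; positivity
  have hlen : (l ++ List.replicate (f - l.length) 0).length = f := by simp; omega
  generalize l ++ List.replicate (f - l.length) 0 = k at hk hlen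
  subst hlen
  have h2 : 2 ^ (B + 1) = 2 ^ B + 2 ^ B := by ring
  -- The guard bits stop every borrow inside its own field, so one subtraction of long numbers acts
  -- field by field.
  have hsub : z * pack (B + 1) (List.replicate k.length 1) +
      2 ^ B * pack (B + 1) (List.replicate k.length 1) - pack (B + 1) k =
      pack (B + 1) (k.map fun y => z + 2 ^ B - y) := by
    refine Nat.sub_eq_of_eq_add ?_
    clear hl hf
    induction k with
    | nil => simp [pack]
    | cons x k ih =>
      have ih := ih fun y hy => hk y (by simp [hy])
      have := hk x (by simp)
      simp only [List.length_cons, List.replicate_succ, List.map_cons, pack]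
      obtain ⟨c, hc⟩ : ∃ c, z + 2 ^ B - x = c ∧ z + 2 ^ B = c + x := ⟨_, rfl, by omega⟩
      rw [hc.1]
      nlinarith [Nat.zero_le z]
  have hH : 2 ^ B * pack (B + 1) (List.replicate k.length 1) =
      pack (B + 1) (k.map fun _ => 2 ^ B) := by
    rw [pack_replicate_one_mul, List.map_const']
  rw [hsub, hH, pack_map_and k _ _ (fun y hy => by have := hk y hy; omega)
    (fun y _ => by have := Nat.one_le_two_pow (n := B); omega)]
  rw [List.map_congr_left fun y hy => add_sub_and_two_pow (hk y hy) hz, pack_map_mul,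
    Nat.mul_div_cancel_left _ (by positivity)]
  have := bits_pack (β := B + 1) (l := k.map fun y => if y ≤ z then 1 else 0)
    (by
      simp only [List.mem_map, forall_exists_index, and_imp]
      rintro x y - rfl
      have := Nat.one_lt_two_pow (n := B + 1) (by omega)
      split_ifs <;> omega) 0 v
  simpa [bits, List.map_take] using this

/-- Counting the fields among the first `v` that are at most `z`. -/
theorem count_le_fields {B f v z : ℕ} {l : List ℕ} (hl : ∀ y ∈ l, y < 2 ^ B) (hz : z < 2 ^ B)
    (hf : l.length ≤ f) (hv : v ≤ l.length) (hb : f < 2 ^ (B + 1) - 1) :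
    ((z * pack (B + 1) (List.replicate f 1) + 2 ^ B * pack (B + 1) (List.replicate f 1) -
      pack (B + 1) l) &&& (2 ^ B * pack (B + 1) (List.replicate f 1))) / 2 ^ B % 2 ^ ((B + 1) * v) %
        (2 ^ (B + 1) - 1) = (l.take v).countP (· ≤ z) := by
  rw [compare_flags hl hz hf, List.take_append_of_le_length hv, pack_mod_eq_sum,
    sum_map_ite_eq_countP]
  rw [sum_map_ite_eq_countP]
  exact (List.countP_le_length.trans (by simp; omega)).trans_lt hb

/-- Counting narrow fields: the flags are first spread out by a multiplication. -/
theorem count_le_narrow_fields {B f v z : ℕ} {l : List ℕ} (hl : ∀ y ∈ l, y < 2 ^ B)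
    (hz : z < 2 ^ B) (hf : l.length ≤ f) (hv : v ≤ l.length)
    (hb : f < 2 ^ ((B + 1) * f + (B + 1)) - 1) :
    ((((z * pack (B + 1) (List.replicate f 1) + 2 ^ B * pack (B + 1) (List.replicate f 1) -
      pack (B + 1) l) &&& (2 ^ B * pack (B + 1) (List.replicate f 1))) / 2 ^ B % 2 ^ ((B + 1) * v) *
        pack ((B + 1) * f) (List.replicate f 1)) &&&
        pack ((B + 1) * f) ((List.range f).map fun i => 2 ^ ((B + 1) * i))) %
          (2 ^ ((B + 1) * f + (B + 1)) - 1) = (l.take v).countP (· ≤ z) := by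
  rw [compare_flags hl hz hf, List.take_append_of_le_length hv]
  set b := B + 1 with hbdef
  set es := (l.take v).map fun y => if y ≤ z then 1 else 0 with hes
  have he : ∀ x ∈ es, x ≤ 1 := by
    simp only [hes, List.mem_map, forall_exists_index, and_imp]
    rintro x y - rfl
    split_ifs <;> omega
  have h2 : 1 < 2 ^ b := Nat.one_lt_two_pow (by omega)
  have he' : ∀ x ∈ es, x < 2 ^ b := fun x hx => (he x hx).trans_lt h2
  have hlen : es.length ≤ f := by simp [hes]; omega
  have hF : pack b es < 2 ^ (b * f) := (pack_lt he').trans_le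
    (Nat.pow_le_pow_right (by norm_num) (Nat.mul_le_mul_left _ hlen))
  -- Fields of `b` bits may be too narrow for the count. The multiplication makes `f` copies of the
  -- flag word, and the mask keeps only flag `i` in copy `i`.
  have hget : ∀ i, pack b es &&& 2 ^ (b * i) = es.getD i 0 * 2 ^ (b * i) := by
    intro i
    have h₁ := bits_pack_one he' i
    have h₂ : es.getD i 0 ≤ 1 := by
      rcases lt_or_ge i es.length with hi | hi
      · simpa [hi] using he _ (List.getElem_mem hi)
      · simp [hi]
    have h₃ : pack b es / 2 ^ (b * i) % 2 = es.getD i 0 := by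
      rw [← Nat.mod_mod_of_dvd _ (dvd_pow_self 2 (by omega : b ≠ 0)), ← bits, h₁]
      exact Nat.mod_eq_of_lt (by omega)
    rw [Nat.and_two_pow, Nat.testBit_eq_decide_div_mod_eq, h₃]
    rcases Nat.le_one_iff_eq_zero_or_eq_one.1 h₂ with h | h <;> rw [h] <;> simp
  have hrep : List.replicate f (pack b es) = (List.range f).map fun _ => pack b es := by simp
  have hsum : ((List.range f).map fun i => es.getD i 0).sum = es.sum := by
    have : (List.range f).map (fun i => es.getD i 0) = es ++ List.replicate (f - es.length) 0 := by
      apply List.ext_getElem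
      · simp; omega
      · intro i h₁ h₂
        rcases lt_or_ge i es.length with hi | hi
        · simp [List.getElem_append_left hi, hi]
        · simp [List.getElem_append_right hi, hi]
    rw [this]
    simp
  have hsum' := hsum.trans (sum_map_ite_eq_countP (l.take v) z)
  rw [pack_replicate_one_mul, hrep, pack_map_and _ _ _ (fun _ _ => hF) fun i hi =>
    Nat.pow_lt_pow_right (by norm_num) (Nat.mul_lt_mul_of_pos_left (List.mem_range.1 hi) (by omega))]
  simp only [hget]
  -- Flag `i` of copy `i` stands at bit `b * f * i + b * i = (b * f + b) * i`. The surviving flags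
  -- are therefore the fields of a packed word with wide fields, and the remainder can add them.
  rw [pack_map_range, ← hsum', ← pack_mod_eq_sum (b := b * f + b), pack_map_range]
  · congr 1
    refine Finset.sum_congr rfl fun i _ => ?_
    rw [mul_assoc, ← pow_add, ← add_mul, add_comm b]
  · rw [hsum']
    exact (List.countP_le_length.trans (by simp; omega)).trans_lt hb

/-! ### Concatenation of a sequence of lists -/

/-- The concatenation of `F 0, …, F (m - 1)`. -/
def flat {α : Type*} (F : ℕ → List α) (m : ℕ) : List α := (List.range m).flatMap F

theorem flat_succ {α : Type*} (F : ℕ → List α) (m : ℕ) : flat F (m + 1) = flat F m ++ F m := by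
  simp [flat, List.range_succ]

theorem length_flat {α : Type*} (F : ℕ → List α) (m : ℕ) :
    (flat F m).length = ∑ i ∈ Finset.range m, (F i).length := by
  induction m with
  | zero => simp [flat]
  | succ m ih => rw [flat_succ, List.length_append, ih, Finset.sum_range_succ]

theorem flat_eq_append {α : Type*} (F : ℕ → List α) {m s : ℕ} (hs : s < m) :
    ∃ k, flat F m = flat F s ++ (F s ++ k) := by
  induction m with
  | zero => omega
  | succ m ih =>
    rcases Nat.lt_succ_iff_lt_or_eq.1 hs with h | rfl
    · obtain ⟨k, hk⟩ := ih h
      exact ⟨k ++ F m, by simp [flat_succ, hk]⟩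
    · exact ⟨[], by simp [flat_succ]⟩

theorem getD_flat (F : ℕ → List ℕ) {m s t : ℕ} (hs : s < m) (ht : t < (F s).length) :
    (flat F m).getD ((flat F s).length + t) 0 = (F s).getD t 0 := by
  obtain ⟨k, hk⟩ := flat_eq_append F hs
  rw [hk, List.getD_append_right _ _ _ _ (by omega), Nat.add_sub_cancel_left,
    List.getD_append _ _ _ _ ht]

theorem mem_flat {α : Type*} {F : ℕ → List α} {m : ℕ} {x : α} (h : x ∈ flat F m) :
    ∃ s < m, x ∈ F s := by
  simpa [flat] using h

theorem length_flat_le {α : Type*} (F : ℕ → List α) {s m : ℕ} (h : s ≤ m) :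
    (flat F s).length ≤ (flat F m).length := by
  rw [length_flat, length_flat]
  exact Finset.sum_le_sum_of_subset (Finset.range_mono h)

/-! ### Multiplicative hashing -/

/-- Multiplicative hashing to `r`-bit numbers. -/
def mulHash (θ r a x : ℕ) : ℕ := a * x % 2 ^ θ / 2 ^ (θ - r)

theorem mulHash_lt {θ r : ℕ} (hr : r ≤ θ) (a x : ℕ) : mulHash θ r a x < 2 ^ r := by
  rw [mulHash, Nat.div_lt_iff_lt_mul (by positivity), ← pow_add, Nat.add_sub_cancel' hr]
  exact Nat.mod_lt _ (by positivity)

/-- Multiplicative hashing is universal. -/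
theorem card_collisions_le {θ r U x y : ℕ} (hxy : x < y) (hy : y < 2 ^ U) (hr : r + U ≤ θ) :
    ((Finset.range (2 ^ θ)).filter fun a => mulHash θ r a x = mulHash θ r a y).card ≤
      2 * 2 ^ (θ - r) := by
  -- The difference of the keys is split into a power of two and an odd number; the odd part is
  -- invertible modulo every power of two.
  obtain ⟨s, o, ho, hz⟩ := Nat.exists_eq_two_pow_mul_odd (n := y - x) (by omega)
  have hs : s < U := by
    have : 2 ^ s ≤ y - x := by rw [hz]; exact Nat.le_mul_of_pos_right _ ho.pos
    exact (Nat.pow_lt_pow_iff_right (by norm_num)).1 ((this.trans (Nat.sub_le _ _)).trans_lt hy)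
  obtain ⟨T, hT⟩ : ∃ T, T = 2 ^ (θ - r - s) := ⟨_, rfl⟩
  have hTs : 2 ^ (θ - r) = 2 ^ s * T := by rw [hT, ← pow_add]; congr 1; omega
  have hθ : 2 ^ θ = 2 ^ s * 2 ^ (θ - s) := by rw [← pow_add]; congr 1; omega
  set N := 2 ^ (θ - s) with hN
  have hTN : T ≤ N := by rw [hT, hN]; exact Nat.pow_le_pow_right (by norm_num) (by omega)
  -- Equal hash values mean that the two products modulo `2 ^ θ` differ by less than `2 ^ (θ - r)`.
  -- So `a` times the difference is close to zero modulo `2 ^ θ`, from above or from below; then `2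
  -- ^ s` is cancelled.
  have key : ∀ a, mulHash θ r a x = mulHash θ r a y →
      a * o % N < T ∨ N - T ≤ a * o % N := by
    intro a h
    have hay : a * y = a * x + 2 ^ s * (a * o) := by
      have : y = x + 2 ^ s * o := by omega
      rw [this]; ring
    have hmod : 2 ^ s * (a * o) % 2 ^ θ = 2 ^ s * (a * o % N) := by
      rw [hθ, Nat.mul_mod_mul_left]
    set c := a * o % N with hc
    have hcN : c < N := Nat.mod_lt _ (by positivity)
    have h₁ : a * y % 2 ^ θ = (a * x % 2 ^ θ + 2 ^ s * c) % 2 ^ θ := by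
      rw [hay, Nat.add_mod, hmod]
    set p := a * x % 2 ^ θ with hp
    set q := a * y % 2 ^ θ with hq
    have hpθ : p < 2 ^ θ := Nat.mod_lt _ (by positivity)
    have hcθ : 2 ^ s * c < 2 ^ θ := by
      rw [hθ]; exact Nat.mul_lt_mul_of_pos_left hcN (by positivity)
    unfold mulHash at h
    rw [← hp, ← hq, hTs] at h
    have hpos : 0 < 2 ^ s * T := by rw [← hTs]; positivity
    have e₁ := Nat.div_add_mod p (2 ^ s * T)
    have e₂ := Nat.div_add_mod q (2 ^ s * T)
    have l₁ := Nat.mod_lt p hpos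
    have l₂ := Nat.mod_lt q hpos
    rw [← h] at e₂
    by_contra! hcon
    have g₁ : 2 ^ s * T ≤ 2 ^ s * c := Nat.mul_le_mul_left _ hcon.1
    have g₂ : 2 ^ s * c + 2 ^ s * T < 2 ^ θ := by
      rw [← mul_add, hθ]
      exact Nat.mul_lt_mul_of_pos_left (by omega) (by positivity)
    rcases lt_or_ge (p + 2 ^ s * c) (2 ^ θ) with hlt | hge
    · rw [Nat.mod_eq_of_lt hlt] at h₁
      omega
    · rw [Nat.mod_eq_sub_mod hge, Nat.mod_eq_of_lt (by omega)] at h₁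
      omega
  have hcard : (Finset.range T ∪ Finset.Ico (N - T) N).card ≤ 2 * T := by
    refine (Finset.card_union_le _ _).trans ?_
    simp
    omega
  calc _ ≤ ((Finset.range T ∪ Finset.Ico (N - T) N) ×ˢ Finset.range (2 ^ s)).card := by
        -- As `o` is invertible modulo `N`, the pair determines `a` modulo `N` and its quotient,
        -- hence `a`. The first component has at most `2 * T` admissible values and the second `2 ^
        -- s`.
        apply Finset.card_le_card_of_injOn fun a => (a * o % N, a / N)
        · intro a ha
          simp only [Finset.coe_filter, Finset.mem_range, Set.mem_ofPred_eq] at ha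
          have h₁ : a * o % N < N := Nat.mod_lt _ (by positivity)
          have h₂ : a / N < 2 ^ s := by
            rw [Nat.div_lt_iff_lt_mul (by positivity), ← hθ]; exact ha.1
          simp only [Finset.coe_product, Set.mem_prod, Finset.mem_coe, Finset.mem_union,
            Finset.mem_range, Finset.mem_Ico]
          exact ⟨(key a ha.2).imp id fun h => ⟨h, h₁⟩, h₂⟩
        · intro a _ a' _ h
          simp only [Prod.mk.injEq] at h
          have hco : Nat.Coprime N o := Nat.Coprime.pow_left _ (Nat.coprime_two_left.2 ho)
          have h₁ : a ≡ a' [MOD N] := Nat.ModEq.cancel_right_of_coprime hco h.1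
          rw [← Nat.div_add_mod a N, ← Nat.div_add_mod a' N, h.2, h₁]
    _ ≤ 2 * T * 2 ^ s := by
        rw [Finset.card_product, Finset.card_range]
        exact Nat.mul_le_mul_right _ hcard
    _ = 2 * 2 ^ (θ - r) := by rw [hTs]; ring

/-- The pairs of distinct elements of `A` with the same hash value. -/
def collisions (A : Finset ℕ) (h : ℕ → ℕ) : Finset (ℕ × ℕ) :=
  A.offDiag.filter fun p => h p.1 = h p.2

/-- Averaging over all multipliers: each of the at most `|A| ^ 2` ordered pairs collides for at most
`2 * 2 ^ (θ - r)` of the `2 ^ θ` multipliers. -/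
theorem exists_few_collisions {θ r U : ℕ} (A : Finset ℕ) (hA : ∀ x ∈ A, x < 2 ^ U)
    (hr : r + U ≤ θ) :
    ∃ a < 2 ^ θ, 2 ^ r * (collisions A (mulHash θ r a)).card ≤ 2 * A.card ^ 2 := by
  have hsum : ∑ a ∈ Finset.range (2 ^ θ), 2 ^ r * (collisions A (mulHash θ r a)).card ≤
      ∑ _a ∈ Finset.range (2 ^ θ), 2 * A.card ^ 2 := by
    have h₁ : ∀ a, (collisions A (mulHash θ r a)).card =
        ∑ p ∈ A.offDiag, if mulHash θ r a p.1 = mulHash θ r a p.2 then 1 else 0 := by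
      intro a
      rw [collisions, Finset.card_filter]
    simp only [h₁]
    rw [← Finset.mul_sum, Finset.sum_comm]
    have h₂ : ∀ p ∈ A.offDiag, (∑ a ∈ Finset.range (2 ^ θ),
        if mulHash θ r a p.1 = mulHash θ r a p.2 then 1 else 0) ≤ 2 * 2 ^ (θ - r) := by
      intro p hp
      rw [← Finset.card_filter]
      obtain ⟨h₁, h₂, h₃⟩ := Finset.mem_offDiag.1 hp
      rcases lt_or_gt_of_ne h₃ with h | h
      · exact card_collisions_le h (hA _ h₂) hr
      · simp only [eq_comm (a := mulHash θ r _ p.1)]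
        exact card_collisions_le h (hA _ h₁) hr
    have h₃ := Finset.sum_le_card_nsmul _ _ _ h₂
    have h₄ : A.offDiag.card ≤ A.card ^ 2 := by rw [Finset.offDiag_card, sq]; omega
    have h₅ : 2 ^ θ = 2 ^ r * 2 ^ (θ - r) := by rw [← pow_add]; congr 1; omega
    rw [Finset.sum_const, Finset.card_range, smul_eq_mul] at *
    calc _ ≤ 2 ^ r * (A.offDiag.card * (2 * 2 ^ (θ - r))) := Nat.mul_le_mul_left _ h₃
      _ ≤ 2 ^ r * (A.card ^ 2 * (2 * 2 ^ (θ - r))) := by gcongr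
      _ = _ := by rw [h₅]; ring
  obtain ⟨a, ha, h⟩ := Finset.exists_le_of_sum_le (by simp) hsum
  exact ⟨a, Finset.mem_range.1 ha, h⟩

/-- Both sides count ordered pairs with the same hash value; the diagonal contributes `A.card`. -/
theorem sum_card_fiber_sq (A : Finset ℕ) (h : ℕ → ℕ) (m : ℕ) (hm : ∀ x ∈ A, h x < m) :
    ∑ s ∈ Finset.range m, (A.filter fun x => h x = s).card ^ 2 = A.card + (collisions A h).card := by
  have h₁ : ∀ s ∈ Finset.range m, (A.filter fun x => h x = s).card ^ 2 =
      (((A ×ˢ A).filter fun p => h p.1 = h p.2).filter fun p => h p.1 = s).card := by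
    intro s _
    rw [sq, ← Finset.card_product]
    congr 1
    ext p
    simp only [Finset.mem_product, Finset.mem_filter]
    constructor
    · rintro ⟨⟨a, b⟩, c, d⟩; exact ⟨⟨⟨a, c⟩, by rw [b, d]⟩, b⟩
    · rintro ⟨⟨⟨a, c⟩, b⟩, d⟩; exact ⟨⟨a, d⟩, c, by rw [← b, d]⟩
  rw [Finset.sum_congr rfl h₁, ← Finset.card_eq_sum_card_fiberwise]
  · have : (A ×ˢ A).filter (fun p => h p.1 = h p.2) = A.diag ∪ collisions A h := by
      ext ⟨x, y⟩
      simp only [Finset.mem_filter, Finset.mem_product, Finset.mem_union, Finset.mem_diag,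
        collisions, Finset.mem_offDiag]
      constructor
      · rintro ⟨⟨a, b⟩, c⟩
        by_cases e : x = y
        · exact Or.inl ⟨a, e⟩
        · exact Or.inr ⟨⟨a, b, e⟩, c⟩
      · rintro (⟨a, rfl⟩ | ⟨⟨a, b, -⟩, c⟩)
        · exact ⟨⟨a, a⟩, rfl⟩
        · exact ⟨⟨a, b⟩, c⟩
    rw [this, Finset.card_union_of_disjoint, Finset.diag_card]
    rw [Finset.disjoint_left]
    rintro ⟨x, y⟩ h₁ h₂
    simp only [collisions, Finset.mem_filter, Finset.mem_offDiag, Finset.mem_diag] at h₁ h₂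
    exact h₂.1.2.2 h₁.2
  · intro p hp
    simp only [Finset.coe_filter, Finset.mem_product, Set.mem_ofPred_eq] at hp
    simpa using hm _ hp.1.1

/-! ### Static dictionaries by two-level perfect hashing -/

/-- The position of the key slot of `x` in the table `T`: the first level gives the multiplier, the
offset and the shift of the second level. -/
def dictSlot (T : List ℕ) (θ A s₁ x : ℕ) : ℕ :=
  T.getD (3 * (A * x % 2 ^ θ / 2 ^ s₁) + 1) 0 +
    2 * (T.getD (3 * (A * x % 2 ^ θ / 2 ^ s₁)) 0 * x % 2 ^ θ /
      2 ^ T.getD (3 * (A * x % 2 ^ θ / 2 ^ s₁) + 2) 0)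

/-- The value of the key `x` in the table `T`, zero if there is none. -/
def dictLookup (T : List ℕ) (θ A s₁ x : ℕ) : ℕ :=
  if T.getD (dictSlot T θ A s₁ x) 0 = x then T.getD (dictSlot T θ A s₁ x + 1) 0 else 0

/-- The range has more than `2 * A.card ^ 2` values, so the average bound leaves fewer than one
collision. -/
theorem exists_injective_hash {θ U : ℕ} (A : Finset ℕ) (hA : ∀ x ∈ A, x < 2 ^ U)
    (hr : Nat.size (2 * A.card ^ 2) + U ≤ θ) :
    ∃ a < 2 ^ θ, ∀ x ∈ A, ∀ y ∈ A,
      mulHash θ (Nat.size (2 * A.card ^ 2)) a x = mulHash θ (Nat.size (2 * A.card ^ 2)) a y →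
        x = y := by
  obtain ⟨a, ha, h⟩ := exists_few_collisions A hA hr
  refine ⟨a, ha, fun x hx y hy hxy => ?_⟩
  have hlt := Nat.lt_size_self (2 * A.card ^ 2)
  have : collisions A (mulHash θ (Nat.size (2 * A.card ^ 2)) a) = ∅ := by
    rw [← Finset.card_eq_zero]
    by_contra hne
    have : 1 ≤ (collisions A (mulHash θ (Nat.size (2 * A.card ^ 2)) a)).card := by omega
    nlinarith
  by_contra hne
  have hmem : (x, y) ∈ collisions A (mulHash θ (Nat.size (2 * A.card ^ 2)) a) := by
    simp [collisions, hx, hy, hne, hxy]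
  rw [this] at hmem
  simp at hmem

theorem two_pow_size_le (m : ℕ) : 2 ^ Nat.size m ≤ 2 * m + 1 := by
  rcases Nat.eq_zero_or_pos m with rfl | hm
  · simp
  · have h : Nat.size m - 1 < Nat.size m := by
      have := Nat.size_pos.2 hm; omega
    have h₁ := Nat.lt_size.1 h
    have h₂ : 2 ^ Nat.size m = 2 * 2 ^ (Nat.size m - 1) := by
      rw [← pow_succ']; congr 1; omega
    omega

/-- The first level hashes into `2 ^ r` buckets with `|A| ≤ 2 ^ r ≤ 2 |A| + 1`. It has at most `2
|A|` collisions, so the squares of the bucket sizes sum to at most `3 |A|`, and a quadratic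
collision-free table for each bucket is affordable. The table begins with three entries per bucket
(multiplier, offset, shift), followed by the key-value pairs. Second-level hashes have at most `2 *
U + 2` bits, which explains the bound on `θ`. Keys are positive because zero marks an empty slot. -/
theorem exists_dictionary {θ U : ℕ} (A : Finset ℕ) (val : ℕ → ℕ)
    (hA : ∀ x ∈ A, 0 < x ∧ x < 2 ^ U) (hθ : 3 * U + 2 ≤ θ) :
    ∃ (a s : ℕ) (T : List ℕ), a < 2 ^ θ ∧ s ≤ θ ∧ T.length ≤ 34 * A.card + 5 ∧
      (∀ e ∈ T, e < 2 ^ θ ∨ e ≤ T.length ∨ ∃ x ∈ A, e = val x) ∧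
      ∀ x, 0 < x → 3 * (a * x % 2 ^ θ / 2 ^ s) + 2 < T.length ∧ dictSlot T θ a s x + 1 < T.length ∧
        dictLookup T θ a s x = if x ∈ A then val x else 0 := by
  classical
  have hAU : A.card ≤ 2 ^ U := by
    have : A ⊆ Finset.range (2 ^ U) := fun x hx => Finset.mem_range.2 (hA x hx).2
    simpa using Finset.card_le_card this
  have hθ2 : θ < 2 ^ θ := Nat.lt_two_pow_self
  set r := Nat.size A.card with hr
  have hrU : r ≤ U + 1 := by
    rw [hr, Nat.size_le, pow_succ]
    have := Nat.one_le_two_pow (n := U)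
    omega
  have hAr : A.card ≤ 2 ^ r := (Nat.lt_size_self _).le
  have hrA : 2 ^ r ≤ 2 * A.card + 1 := two_pow_size_le A.card
  obtain ⟨a, ha, hcoll⟩ := exists_few_collisions A (fun x hx => (hA x hx).2)
    (show r + U ≤ θ by omega)
  have hcoll' : (collisions A (mulHash θ r a)).card ≤ 2 * A.card := by
    rcases Nat.eq_zero_or_pos A.card with h0 | hpos
    · rw [h0] at hcoll
      have : 0 < 2 ^ r := by positivity
      nlinarith
    · have : A.card * (collisions A (mulHash θ r a)).card ≤ A.card * (2 * A.card) := by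
        calc _ ≤ 2 ^ r * (collisions A (mulHash θ r a)).card := Nat.mul_le_mul_right _ hAr
          _ ≤ _ := by rw [sq] at hcoll; linarith
      exact Nat.le_of_mul_le_mul_left this hpos
  set Af : ℕ → Finset ℕ := fun j => A.filter fun x => mulHash θ r a x = j with hAf
  set r₂ : ℕ → ℕ := fun j => Nat.size (2 * (Af j).card ^ 2) with hr₂
  have hsq : ∑ j ∈ Finset.range (2 ^ r), (Af j).card ^ 2 ≤ 3 * A.card := by
    have : ∑ j ∈ Finset.range (2 ^ r), (Af j).card ^ 2 = _ :=
      sum_card_fiber_sq A (mulHash θ r a) (2 ^ r) fun x _ => mulHash_lt (by omega) a x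
    omega
  have hr₂U : ∀ j, r₂ j ≤ 2 * U + 2 := by
    intro j
    have h₁ : (Af j).card ≤ 2 ^ U := (Finset.card_filter_le _ _).trans hAU
    simp only [hr₂]
    rw [Nat.size_le]
    have h₂ : (Af j).card ^ 2 ≤ (2 ^ U) ^ 2 := Nat.pow_le_pow_left h₁ 2
    have h₃ : 2 ^ (2 * U + 2) = 4 * (2 ^ U) ^ 2 := by ring
    have h₄ : 0 < (2 ^ U) ^ 2 := by positivity
    omega
  have hinj : ∀ j, ∃ b < 2 ^ θ, ∀ x ∈ Af j, ∀ y ∈ Af j,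
      mulHash θ (r₂ j) b x = mulHash θ (r₂ j) b y → x = y := fun j =>
    exists_injective_hash (Af j) (fun x hx => (hA x (Finset.mem_filter.1 hx).1).2) (U := U) (by
      have := hr₂U j
      simp only [hr₂] at this
      omega)
  choose b hb hbinj using hinj
  set key : ℕ → ℕ → ℕ := fun j t =>
    if h : ∃ x ∈ Af j, mulHash θ (r₂ j) (b j) x = t then h.choose else 0 with hkey
  have key_spec : ∀ j, ∀ x ∈ Af j, key j (mulHash θ (r₂ j) (b j) x) = x := by
    intro j x hx
    have h : ∃ y ∈ Af j, mulHash θ (r₂ j) (b j) y = mulHash θ (r₂ j) (b j) x := ⟨x, hx, rfl⟩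
    simp only [hkey, dif_pos h]
    exact hbinj j _ h.choose_spec.1 _ hx h.choose_spec.2
  have key_mem : ∀ j t, key j t ≠ 0 → key j t ∈ A := by
    intro j t h
    simp only [hkey] at h ⊢
    split_ifs at h ⊢ with h'
    · exact (Finset.mem_filter.1 h'.choose_spec.1).1
    · exact absurd rfl h
  set F : ℕ → List ℕ := fun j => (List.range (2 * 2 ^ r₂ j)).map fun i =>
    if i % 2 = 0 then key j (i / 2) else if key j (i / 2) = 0 then 0 else val (key j (i / 2)) with hF
  have hFlen : ∀ j, (F j).length = 2 * 2 ^ r₂ j := fun j => by simp [hF]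
  set T₁ : List ℕ := (List.range (3 * 2 ^ r)).map fun i =>
    if i % 3 = 0 then b (i / 3) else if i % 3 = 1 then 3 * 2 ^ r + (flat F (i / 3)).length
      else θ - r₂ (i / 3) with hT₁
  have hT₁len : T₁.length = 3 * 2 ^ r := by simp [hT₁]
  have hflat : (flat F (2 ^ r)).length ≤ 24 * A.card + 2 * 2 ^ r := by
    rw [length_flat]
    calc _ ≤ ∑ j ∈ Finset.range (2 ^ r), (8 * (Af j).card ^ 2 + 2) := by
          refine Finset.sum_le_sum fun j _ => ?_
          have := two_pow_size_le (2 * (Af j).card ^ 2)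
          rw [hFlen]
          simp only [hr₂]
          omega
      _ ≤ _ := by
          rw [Finset.sum_add_distrib, ← Finset.mul_sum]
          simp only [Finset.sum_const, Finset.card_range, smul_eq_mul]
          omega
  have hlen : (T₁ ++ flat F (2 ^ r)).length = 3 * 2 ^ r + (flat F (2 ^ r)).length := by
    rw [List.length_append, hT₁len]
  -- The length is at most `3 * 2 ^ r + 24 |A| + 2 * 2 ^ r`, and `2 ^ r ≤ 2 |A| + 1`.
  refine ⟨a, θ - r, T₁ ++ flat F (2 ^ r), ha, by omega, by omega, ?_, ?_⟩
  · intro e he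
    rw [hlen]
    rcases List.mem_append.1 he with h | h
    · simp only [hT₁, List.mem_map, List.mem_range] at h
      obtain ⟨i, hi, rfl⟩ := h
      split_ifs
      · exact Or.inl (hb _)
      · have := length_flat_le F (show i / 3 ≤ 2 ^ r by omega)
        exact Or.inr (Or.inl (by omega))
      · exact Or.inl (by omega)
    · obtain ⟨j, -, h⟩ := mem_flat h
      simp only [hF, List.mem_map, List.mem_range] at h
      obtain ⟨i, hi, rfl⟩ := h
      split_ifs with h₁ h₂
      · left
        by_cases h0 : key j (i / 2) = 0
        · rw [h0]; positivity
        · exact (hA _ (key_mem _ _ h0)).2.trans_le (Nat.pow_le_pow_right (by norm_num) (by omega))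
      · exact Or.inl (by positivity)
      · exact Or.inr (Or.inr ⟨_, key_mem _ _ h₂, rfl⟩)
  · intro x hx
    have hs : a * x % 2 ^ θ / 2 ^ (θ - r) < 2 ^ r := mulHash_lt (by omega) a x
    set j := a * x % 2 ^ θ / 2 ^ (θ - r) with hj
    have hg : ∀ c < 3, (T₁ ++ flat F (2 ^ r)).getD (3 * j + c) 0 =
        if c = 0 then b j else if c = 1 then 3 * 2 ^ r + (flat F j).length else θ - r₂ j := by
      intro c hc
      have h₁ : 3 * j + c < 3 * 2 ^ r := by omega
      rw [List.getD_append _ _ _ _ (by omega), List.getD_eq_getElem _ _ (by omega)]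
      simp only [hT₁, List.getElem_map, List.getElem_range]
      rw [show (3 * j + c) % 3 = c by omega, show (3 * j + c) / 3 = j by omega]
    have hg0 := hg 0 (by norm_num)
    have hg1 := hg 1 (by norm_num)
    have hg2 := hg 2 (by norm_num)
    simp only [add_zero, if_true, if_false, one_ne_zero, OfNat.ofNat_ne_zero,
      OfNat.ofNat_ne_one] at hg0 hg1 hg2
    have ht : mulHash θ (r₂ j) (b j) x < 2 ^ r₂ j := mulHash_lt (by have := hr₂U j; omega) _ x
    have hslot : dictSlot (T₁ ++ flat F (2 ^ r)) θ a (θ - r) x =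
        3 * 2 ^ r + ((flat F j).length + 2 * mulHash θ (r₂ j) (b j) x) := by
      unfold dictSlot
      rw [← hj, hg0, hg1, hg2, mulHash, add_assoc]
    obtain ⟨t, ht'⟩ : ∃ t, t = mulHash θ (r₂ j) (b j) x := ⟨_, rfl⟩
    rw [← ht'] at ht hslot
    have hget : ∀ c < 2, (T₁ ++ flat F (2 ^ r)).getD
        (dictSlot (T₁ ++ flat F (2 ^ r)) θ a (θ - r) x + c) 0 =
        if c = 0 then key j t else if key j t = 0 then 0 else val (key j t) := by
      intro c hc
      have hbd : 2 * t + c < 2 * 2 ^ r₂ j := by omega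
      rw [hslot, List.getD_append_right _ _ _ _ (by omega), hT₁len,
        show 3 * 2 ^ r + ((flat F j).length + 2 * t) + c - 3 * 2 ^ r =
          (flat F j).length + (2 * t + c) by omega, getD_flat F hs (by rw [hFlen]; exact hbd),
        List.getD_eq_getElem _ _ (by rw [hFlen]; exact hbd)]
      simp only [hF, List.getElem_map, List.getElem_range]
      rw [show (2 * t + c) % 2 = c by omega, show (2 * t + c) / 2 = t by omega]
    have k0 := hget 0 (by norm_num)
    have k1 := hget 1 (by norm_num)
    simp only [add_zero, if_true, if_false, one_ne_zero] at k0 k1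
    refine ⟨by omega, ?_, ?_⟩
    · have := length_flat_le F (show j + 1 ≤ 2 ^ r by omega)
      rw [flat_succ, List.length_append, hFlen] at this
      omega
    unfold dictLookup
    rw [k0, k1]
    by_cases hxA : x ∈ A
    · have : key j t = x := ht' ▸ key_spec j x (Finset.mem_filter.2 ⟨hxA, rfl⟩)
      rw [if_pos this, this, if_neg hx.ne', if_pos hxA]
    · rw [if_neg, if_neg hxA]
      intro h
      exact hxA (h ▸ key_mem _ _ (by omega))

/-! ### Loop-free programs -/

/-- A bound for the number of steps of a loop-free program. -/
def Cmd.time : Cmd → ℕ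
  | .seq p q => p.time + q.time
  | .ite _ p q => max p.time q.time + 1
  | _ => 1

theorem Ex.time_code (e : Ex) (d : ℕ) : (e.code d).time = e.cost := by
  induction e generalizing d with
  | var => rfl
  | lit => rfl
  | bin o e₁ e₂ h₁ h₂ => simp [Ex.code, Cmd.time, Ex.cost, h₁, h₂]
  | ld e h => simp [Ex.code, Cmd.time, Ex.cost, h]

theorem time_assign (x : ℕ) (e : Ex) : (assign x e).time = e.cost + 1 := by
  simp [assign, Cmd.time, Ex.time_code]

/-- `Reach` with the time bound `Cmd.time`. -/
def Runs {w : ℕ} (mem : List (BitVec w)) (W : ℕ) (c : Cmd) (ρ : ℕ → ℕ) (Q : (ℕ → ℕ) → Prop) :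
    Prop :=
  Reach mem W c ρ c.time Q

-- Operator notation and evaluation rules for expressions

local prefix:max "♯" => Ex.var
local prefix:max "♭" => Ex.lit

instance : Add Ex := ⟨.bin .add⟩
instance : Sub Ex := ⟨.bin .sub⟩
instance : Mul Ex := ⟨.bin .mul⟩
instance : Div Ex := ⟨.bin .div⟩
instance : Mod Ex := ⟨.bin .mod⟩
instance : AndOp Ex := ⟨.bin .and⟩
instance : ShiftLeft Ex := ⟨.bin .shl⟩
instance : ShiftRight Ex := ⟨.bin .shr⟩

section
variable {w M β : ℕ} {ρ : ℕ → ℕ} (a b : Ex)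

@[simp] theorem Ex.val_var (x : ℕ) : (Ex.var x).val w M ρ = ρ x := rfl
@[simp] theorem Ex.val_lit (n : ℕ) : (Ex.lit n).val w M ρ = n := rfl
@[simp] theorem Ex.val_add : (a + b).val w M ρ = a.val w M ρ + b.val w M ρ := rfl
@[simp] theorem Ex.val_sub : (a - b).val w M ρ = a.val w M ρ - b.val w M ρ := rfl
@[simp] theorem Ex.val_mul : (a * b).val w M ρ = a.val w M ρ * b.val w M ρ := rfl
@[simp] theorem Ex.val_div : (a / b).val w M ρ = a.val w M ρ / b.val w M ρ := rfl
@[simp] theorem Ex.val_mod : (a % b).val w M ρ = a.val w M ρ % b.val w M ρ := rfl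
@[simp] theorem Ex.val_and : (a &&& b).val w M ρ = a.val w M ρ &&& b.val w M ρ := rfl
@[simp] theorem Ex.val_shl : (a <<< b).val w M ρ = a.val w M ρ * 2 ^ b.val w M ρ := rfl
@[simp] theorem Ex.val_shr : (a >>> b).val w M ρ = a.val w M ρ / 2 ^ b.val w M ρ := rfl

@[simp] theorem Ex.side_var (x : ℕ) : (Ex.var x).Side β ρ := trivial
@[simp] theorem Ex.side_lit (n : ℕ) : (Ex.lit n).Side β ρ := trivial
@[simp] theorem Ex.side_add : (a + b).Side β ρ ↔ a.Side β ρ ∧ b.Side β ρ := Iff.rfl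
@[simp] theorem Ex.side_sub : (a - b).Side β ρ ↔
    a.Side β ρ ∧ b.Side β ρ ∧ b.val 0 0 ρ ≤ a.val 0 0 ρ := Iff.rfl
@[simp] theorem Ex.side_mul : (a * b).Side β ρ ↔ a.Side β ρ ∧ b.Side β ρ := Iff.rfl
@[simp] theorem Ex.side_div : (a / b).Side β ρ ↔ a.Side β ρ ∧ b.Side β ρ := Iff.rfl
@[simp] theorem Ex.side_mod : (a % b).Side β ρ ↔ a.Side β ρ ∧ b.Side β ρ := Iff.rfl
@[simp] theorem Ex.side_and : (a &&& b).Side β ρ ↔ a.Side β ρ ∧ b.Side β ρ := Iff.rfl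
@[simp] theorem Ex.side_shl : (a <<< b).Side β ρ ↔
    a.Side β ρ ∧ b.Side β ρ ∧ a.val 0 0 ρ * 2 ^ b.val 0 0 ρ < β := Iff.rfl
@[simp] theorem Ex.side_shr : (a >>> b).Side β ρ ↔ a.Side β ρ ∧ b.Side β ρ := Iff.rfl
end

/-- All variables are below the bound. -/
def Bdd (κ w : ℕ) (ρ : ℕ → ℕ) : Prop := ∀ x, ρ x < 2 ^ (κ * w)

theorem Bdd.update {κ w : ℕ} {ρ : ℕ → ℕ} (h : Bdd κ w ρ) {x v : ℕ} (hv : v < 2 ^ (κ * w)) :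
    Bdd κ w (Function.update ρ x v) := fun y => by
  by_cases hy : y = x
  · subst hy; simpa
  · simpa [hy] using h y

/-- The memory contents: the cell length, the wide words `V` of `κ * w` bits, the bit string `N`. -/
def image (κ w : ℕ) (V : List ℕ) (N : ℕ) : ℕ :=
  w + 2 ^ w * (pack (κ * w) V + 2 ^ (κ * w * V.length) * N)

/-- A machine whose memory holds the wide words `V` and the bit string `N`. -/
structure Loaded (κ w : ℕ) (V : List ℕ) (N : ℕ) (mem : List (BitVec w)) : Prop where
  machine : Machine κ w (image κ w V N) mem
  lt : ∀ x ∈ V, x < 2 ^ (κ * w)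

/-- The expression for the wide word number `e`; variable `3` holds the length of wide words. -/
def wideEx (κ : ℕ) (e : Ex) : Ex := readEx κ (♯2 + ♯3 * e) (♯3)

section
variable {κ w N : ℕ} {V : List ℕ} {mem : List (BitVec w)} {ρ : ℕ → ℕ} {Q R : (ℕ → ℕ) → Prop}
  {p q : Cmd}

theorem bits_image_wide (hV : ∀ x ∈ V, x < 2 ^ (κ * w)) {i : ℕ} (hi : i < V.length) :
    bits (image κ w V N) (w + κ * w * i) (κ * w) = V.getD i 0 := by
  rw [image, bits_append_right Nat.lt_two_pow_self, bits_append_left, bits_pack_one hV]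
  calc κ * w * i + κ * w = κ * w * (i + 1) := by ring
    _ ≤ _ := Nat.mul_le_mul_left _ hi

theorem bits_image_narrow (hV : ∀ x ∈ V, x < 2 ^ (κ * w)) (o L : ℕ) :
    bits (image κ w V N) (w + κ * w * V.length + o) L = bits N o L := by
  rw [image, add_assoc, bits_append_right Nat.lt_two_pow_self, bits_append_right (pack_lt hV)]

theorem Runs.mono {c : Cmd} (h : Runs mem (8 * κ * w) c ρ R) (hQ : ∀ ρ', R ρ' → Q ρ') :
    Runs mem (8 * κ * w) c ρ Q := Reach.mono h le_rfl hQ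

theorem Runs.seq (hp : Runs mem (8 * κ * w) p ρ R) (hq : ∀ ρ', R ρ' → Runs mem (8 * κ * w) q ρ' Q) :
    Runs mem (8 * κ * w) (.seq p q) ρ Q := Reach.seq hp hq

theorem Runs.ite {b : Test} (hb : b.Closed) (hp : b.On ρ → Runs mem (8 * κ * w) p ρ Q)
    (hq : ¬ b.On ρ → Runs mem (8 * κ * w) q ρ Q) : Runs mem (8 * κ * w) (.ite b p q) ρ Q :=
  Reach.ite hb (fun h => Reach.mono (hp h) (le_max_left _ _) fun _ h => h)
    (fun h => Reach.mono (hq h) (le_max_right _ _) fun _ h => h)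

namespace Loaded

theorem assign (l : Loaded κ w V N mem) {x : ℕ} {e : Ex} (v : ℕ) (hx : x < numVars)
    (hS : e.Small = true) (hD : e.deg ≤ 8) (hρ : Bdd κ w ρ) (hs : e.Side (2 ^ (κ * w)) ρ)
    (hv : e.val 0 0 ρ = v) (hQ : Q (Function.update ρ x v)) :
    Runs mem (8 * κ * w) (assign x e) ρ Q := by
  rw [Runs, time_assign]
  exact l.machine.reach_assign hx hS hD hρ hs (hv ▸ hQ)

theorem wide (l : Loaded κ w V N mem) {x : ℕ} {e : Ex} (i : ℕ) (hx : x < numVars)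
    (hS : e.Small = true) (hD : e.deg ≤ 5) (hρ : Bdd κ w ρ) (hs : e.Side (2 ^ (κ * w)) ρ)
    (h2 : ρ 2 = w) (h3 : ρ 3 = κ * w)
    (hv : e.val 0 0 ρ = i) (hi : i < V.length) (hQ : Q (Function.update ρ x (V.getD i 0))) :
    Runs mem (8 * κ * w) (RAM.assign x (wideEx κ e)) ρ Q := by
  rw [Runs, time_assign]
  refine l.machine.reach_read hx ?_ rfl ?_ (by decide) hρ h2 ⟨trivial, trivial, hs⟩ trivial
    (by simp [h3]) ?_
  · show (true && (true && e.Small)) = true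
    simp [hS]
  · show max 1 (1 + e.deg) + 1 ≤ 7
    omega
  · simpa [h2, h3, hv, bits_image_wide l.lt hi] using hQ

theorem narrow (l : Loaded κ w V N mem) {x : ℕ} {e L : Ex} (o : ℕ) (hx : x < numVars)
    (hS : e.Small = true) (hD : e.deg ≤ 7) (hL : L.Small = true) (hDL : L.deg ≤ 8)
    (hρ : Bdd κ w ρ) (hs : e.Side (2 ^ (κ * w)) ρ) (hsL : L.Side (2 ^ (κ * w)) ρ)
    (h2 : ρ 2 = w) (hl : L.val 0 0 ρ ≤ κ * w)
    (hv : e.val 0 0 ρ = w + κ * w * V.length + o)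
    (hQ : Q (Function.update ρ x (bits N o (L.val 0 0 ρ)))) :
    Runs mem (8 * κ * w) (RAM.assign x (readEx κ e L)) ρ Q := by
  rw [Runs, time_assign]
  refine l.machine.reach_read hx hS hL hD hDL hρ h2 hs hsL hl ?_
  rwa [hv, bits_image_narrow l.lt]

end Loaded

/-! ### Dictionary lookup -/

/-- Look up variable `46` in the dictionary with base `20`, modulus `16`, multiplier `17` and shift
`18`; the result goes to variable `53`. -/
def lookupCode (κ : ℕ) : Cmd :=
  .seq (assign 47 ((♯17 * ♯46 % ♯16) >>> ♯18)) <|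
  .seq (assign 48 (wideEx κ (♯20 + ♭3 * ♯47))) <|
  .seq (assign 49 (wideEx κ (♯20 + ♭3 * ♯47 + ♭1))) <|
  .seq (assign 50 (wideEx κ (♯20 + ♭3 * ♯47 + ♭2))) <|
  .seq (assign 51 (♯20 + (♯49 + ♭2 * ((♯48 * ♯46 % ♯16) >>> ♯50)))) <|
  .seq (assign 52 (wideEx κ (♯51))) <|
  .ite (.eq 52 46) (assign 53 (wideEx κ (♯51 + ♭1))) (assign 53 ♭0)

/-- The part `T` of the wide words that begins at index `base`. -/
def SubtableAt (V : List ℕ) (base : ℕ) (T : List ℕ) : Prop :=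
  ∃ V₁ V₂, V = V₁ ++ (T ++ V₂) ∧ V₁.length = base

theorem SubtableAt.lt {base : ℕ} {T : List ℕ} (h : SubtableAt V base T) {i : ℕ}
    (hi : i < T.length) : base + i < V.length := by
  obtain ⟨V₁, V₂, rfl, rfl⟩ := h
  simp; omega

theorem SubtableAt.getD {base : ℕ} {T : List ℕ} (h : SubtableAt V base T) {i : ℕ}
    (hi : i < T.length) : V.getD (base + i) 0 = T.getD i 0 := by
  obtain ⟨V₁, V₂, rfl, rfl⟩ := h
  rw [List.getD_append_right _ _ _ _ (by omega), Nat.add_sub_cancel_left,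
    List.getD_append _ _ _ _ hi]

theorem getD_lt_of_forall {B : ℕ} (hB : 0 < B) {l : List ℕ} (h : ∀ x ∈ l, x < B) (i : ℕ) :
    l.getD i 0 < B := by
  rcases lt_or_ge i l.length with hi | hi
  · rw [List.getD_eq_getElem _ _ hi]; exact h _ (List.getElem_mem hi)
  · simpa [hi] using hB

/-- The two range hypotheses keep every access inside `T`, also for keys that are absent. The clause
on unchanged variables lets callers keep their state. -/
theorem Loaded.lookup (l : Loaded κ w V N mem) (hlen : V.length < 2 ^ (κ * w)) (hρ : Bdd κ w ρ)
    {T : List ℕ} {θ A s₁ x : ℕ}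
    (h2 : ρ 2 = w) (h3 : ρ 3 = κ * w) (h16 : ρ 16 = 2 ^ θ) (h17 : ρ 17 = A) (h18 : ρ 18 = s₁)
    (hT : SubtableAt V (ρ 20) T) (hx : ρ 46 = x)
    (hi : 3 * (A * x % 2 ^ θ / 2 ^ s₁) + 2 < T.length) (hj : dictSlot T θ A s₁ x + 1 < T.length) :
    Runs mem (8 * κ * w) (lookupCode κ) ρ fun ρ' => Bdd κ w ρ' ∧
      ρ' 53 = dictLookup T θ A s₁ x ∧ ∀ y, y < 47 ∨ 53 < y → ρ' y = ρ y := by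
  have hβ : 0 < 2 ^ (κ * w) := by positivity
  have hV := getD_lt_of_forall hβ l.lt
  have h16' : 2 ^ θ < 2 ^ (κ * w) := h16 ▸ hρ 16
  set s := A * x % 2 ^ θ / 2 ^ s₁ with hs
  have hsβ : s < 2 ^ (κ * w) :=
    ((Nat.div_le_self _ _).trans_lt (Nat.mod_lt _ (by positivity))).trans h16'
  have b₁ := hρ.update (x := 47) hsβ
  refine Runs.seq (l.assign s (by decide) rfl (by decide) hρ (by simp)
    (by simp [h16, h17, h18, hx, hs]) rfl) ?_
  rintro _ rfl
  refine Runs.seq (l.wide (ρ 20 + 3 * s) (by decide) rfl (by decide) b₁ (by simp)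
    (by simp [h2]) (by simp [h3]) (by simp) (hT.lt (by omega)) rfl) ?_
  rintro _ rfl
  have b₂ := b₁.update (x := 48) (hV (ρ 20 + 3 * s))
  rw [hT.getD (by omega)] at b₂ ⊢
  refine Runs.seq (l.wide (ρ 20 + (3 * s + 1)) (by decide) rfl (by decide) b₂ (by simp)
    (by simp [h2]) (by simp [h3]) (by simp [add_assoc]) (hT.lt (by omega)) rfl) ?_
  rintro _ rfl
  have b₃ := b₂.update (x := 49) (hV (ρ 20 + (3 * s + 1)))
  rw [hT.getD (by omega)] at b₃ ⊢
  refine Runs.seq (l.wide (ρ 20 + (3 * s + 2)) (by decide) rfl (by decide) b₃ (by simp)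
    (by simp [h2]) (by simp [h3]) (by simp [add_assoc]) (hT.lt (by omega)) rfl) ?_
  rintro _ rfl
  have b₄ := b₃.update (x := 50) (hV (ρ 20 + (3 * s + 2)))
  rw [hT.getD (by omega)] at b₄ ⊢
  set slot := dictSlot T θ A s₁ x with hslot
  have hlt := hT.lt (i := slot) (by omega)
  refine Runs.seq (l.assign (ρ 20 + slot) (by decide) rfl (by decide) b₄ (by simp)
    (by simp [h16, hx, hslot, dictSlot, hs]) rfl) ?_
  rintro _ rfl
  have b₅ := b₄.update (x := 51) (hlt.trans hlen)
  refine Runs.seq (l.wide (ρ 20 + slot) (by decide) rfl (by decide) b₅ (by simp)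
    (by simp [h2]) (by simp [h3]) (by simp) hlt rfl) ?_
  rintro _ rfl
  have b₆ := b₅.update (x := 52) (hV (ρ 20 + slot))
  rw [hT.getD (by omega)] at b₆ ⊢
  refine Runs.ite ⟨by decide, by decide⟩ (fun ht => ?_) (fun ht => ?_)
  · have ht' : T.getD slot 0 = x := by simpa [Test.On, hx] using ht
    refine l.wide (ρ 20 + (slot + 1)) (by decide) rfl (by decide) b₆ (by simp)
      (by simp [h2]) (by simp [h3]) (by simp [add_assoc]) (hT.lt hj) ⟨b₆.update (hV _), ?_, ?_⟩
    · rw [hT.getD hj, Function.update_self, dictLookup, if_pos ht']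
    · intro y hy
      have h : ∀ c, 47 ≤ c → c ≤ 53 → y ≠ c := fun c _ _ => by omega
      simp [h]
  · have ht' : T.getD slot 0 ≠ x := by simpa [Test.On, hx] using ht
    refine l.assign 0 (by decide) rfl (by decide) b₆ trivial rfl ⟨b₆.update hβ, ?_, ?_⟩
    · rw [Function.update_self, dictLookup, if_neg ht']
    · intro y hy
      have h : ∀ c, 47 ≤ c → c ≤ 53 → y ≠ c := fun c _ _ => by omega
      simp [h]

end

/-! ### Search in a packed multiway tree -/

/-- Every `g`-th element of `l`. -/
def every (g : ℕ) (l : List ℕ) : List ℕ :=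
  (List.range ((l.length + g - 1) / g)).map fun i => l.getD (i * g) 0

/-- The levels `t - 1, …, 0` of the search tree of degree `f` of the list `l`: level `i` consists of
every `f ^ i`-th element. -/
def treeLevels (f : ℕ) (l : List ℕ) : ℕ → List ℕ
  | 0 => []
  | t + 1 => every (f ^ t) l ++ treeLevels f l t

theorem countP_eq_of_prefix {k : List ℕ} {z e : ℕ} (he : e ≤ k.length)
    (h : ∀ i < k.length, k.getD i 0 ≤ z ↔ i < e) : k.countP (· ≤ z) = e := by
  rw [← List.take_append_drop e k, List.countP_append]
  have h₁ : (k.take e).countP (· ≤ z) = (k.take e).length := by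
    rw [List.countP_eq_length]
    intro x hx
    obtain ⟨i, hi, rfl⟩ := List.getElem_of_mem hx
    have hi' : i < e ∧ i < k.length := by simpa using hi
    have := (h i hi'.2).2 hi'.1
    rw [List.getD_eq_getElem _ _ hi'.2] at this
    simpa using this
  have h₂ : (k.drop e).countP (· ≤ z) = 0 := by
    rw [List.countP_eq_zero]
    intro x hx
    obtain ⟨i, hi, rfl⟩ := List.getElem_of_mem hx
    have hi' : e + i < k.length := by simp at hi; omega
    have := (h (e + i) hi').not.2 (by omega)
    rw [List.getD_eq_getElem _ _ hi'] at this
    simpa using this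
  rw [h₁, h₂]
  simp [he]

/-- The quotient is a rounded-up division: the number of multiples of `g` below `cnt`. So if the
first `cnt` elements of a list are at most `z`, it is the rank of `z` among every `g`-th element. -/
theorem lt_ceil_div_iff {g cnt i : ℕ} (hg : 0 < g) : i < (cnt + g - 1) / g ↔ i * g < cnt := by
  rw [Nat.lt_div_iff_mul_lt hg]
  omega

theorem ceil_div_pos {g cnt : ℕ} (hg : 0 < g) (h : 0 < cnt) : 0 < (cnt + g - 1) / g := by
  rw [lt_ceil_div_iff hg]; omega

theorem ceil_div_mono {g a b : ℕ} (h : a ≤ b) : (a + g - 1) / g ≤ (b + g - 1) / g :=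
  Nat.div_le_div_right (by omega)

theorem ceil_div_le_self {g a : ℕ} (hg : 0 < g) : (a + g - 1) / g ≤ a := by
  by_contra! h
  have := (lt_ceil_div_iff hg).1 h
  nlinarith

/-- With `pred_ceil_div_mul_lt` this localizes the search: if the rank is `c` on the coarse level,
the rank `e` on the next finer level satisfies `(c - 1) * f < e ≤ c * f`, so a single group of `f`
elements decides. -/
theorem ceil_div_le_mul {f g cnt : ℕ} (hf : 0 < f) (hg : 0 < g) :
    (cnt + g - 1) / g ≤ (cnt + g * f - 1) / (g * f) * f := by
  by_contra! h
  rw [lt_ceil_div_iff hg] at h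
  have h' : ¬ (cnt + g * f - 1) / (g * f) < (cnt + g * f - 1) / (g * f) := lt_irrefl _
  rw [lt_ceil_div_iff (by positivity)] at h'
  apply h'
  calc _ = (cnt + g * f - 1) / (g * f) * f * g := by ring
    _ < _ := h

theorem pred_ceil_div_mul_lt {f g cnt : ℕ} (hf : 0 < f) (hg : 0 < g) (hc : 0 < cnt) :
    ((cnt + g * f - 1) / (g * f) - 1) * f < (cnt + g - 1) / g := by
  have h := ceil_div_pos (g := g * f) (by positivity) hc
  have : (cnt + g * f - 1) / (g * f) - 1 < (cnt + g * f - 1) / (g * f) := by omega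
  rw [lt_ceil_div_iff (by positivity)] at this
  rw [lt_ceil_div_iff hg]
  calc _ = ((cnt + g * f - 1) / (g * f) - 1) * (g * f) := by ring
    _ < _ := this

/-- The `f` fields read from position `j` may run over into the next level; `v` cuts these off. The
first `j` elements of the level are already known to be at most `z`, hence the difference. -/
theorem count_every {l : List ℕ} {g z cnt j v f : ℕ} {rest : List ℕ} (hg : 0 < g)
    (hcnt : ∀ i < l.length, l.getD i 0 ≤ z ↔ i < cnt) (hm : cnt ≤ l.length)
    (hv : v = min f ((l.length + g - 1) / g - j))
    (hj : j ≤ (cnt + g - 1) / g) (hjv : (cnt + g - 1) / g ≤ j + f) :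
    ((((every g l ++ rest).drop j).take f).take v).countP (· ≤ z) = (cnt + g - 1) / g - j := by
  have hlen : (every g l).length = (l.length + g - 1) / g := by simp [every]
  have hle := ceil_div_mono (g := g) hm
  have e₁ : (((every g l ++ rest).drop j).take f).take v = ((every g l).drop j).take v := by
    rw [List.take_take, min_eq_left (by omega), List.drop_append_of_le_length (by omega),
      List.take_append_of_le_length (by simp; omega)]
  rw [e₁]
  have hl2 : (((every g l).drop j).take v).length = v := by simp; omega
  apply countP_eq_of_prefix
  · omega
  · intro i hi
    rw [hl2] at hi
    have hi' : j + i < (l.length + g - 1) / g := by omega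
    have : (((every g l).drop j).take v).getD i 0 = l.getD ((j + i) * g) 0 := by
      rw [List.getD_eq_getElem _ _ (by omega)]
      simp only [List.getElem_take, List.getElem_drop, every, List.getElem_map, List.getElem_range]
    rw [this, hcnt _ ((lt_ceil_div_iff hg).1 hi'), ← lt_ceil_div_iff hg]
    omega

/-- It guarantees that the word-parallel subtraction does not go below zero as a whole. -/
theorem pack_le_mul_replicate {b c f : ℕ} {l : List ℕ} (h : ∀ y ∈ l, y ≤ c) (hf : l.length ≤ f) :
    pack b l ≤ c * pack b (List.replicate f 1) := by
  induction l generalizing f with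
  | nil => simp [pack]
  | cons x l ih =>
    obtain ⟨f, rfl⟩ : ∃ f', f = f' + 1 := ⟨f - 1, by simp at hf; omega⟩
    have h₁ := ih (f := f) (fun y hy => h y (by simp [hy])) (by simp at hf; omega)
    have h₂ := h x (by simp)
    simp only [List.replicate_succ, pack]
    calc x + 2 ^ b * pack b l ≤ c + 2 ^ b * (c * pack b (List.replicate f 1)) := by gcongr
      _ = _ := by ring

/-- One level of the descent. -/
def descentBody (κ : ℕ) : Cmd :=
  .seq (assign 38 (♯38 / ♯7)) <|
  .seq (assign 42 ((♯35 + ♯38 - ♭1) / ♯38)) <|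
  .seq (assign 39 ((♯37 - ♭1) * ♯7)) <|
  .seq (assign 40 (♯42 - ♯39)) <|
  .seq (.ite (.lt 7 40) (assign 40 ♯7) .skip) <|
  .seq (assign 41 (readEx κ (♯21 + ♯6 * (♯36 + ♯39)) (♯6 * ♯7))) <|
  .seq (assign 37 (♯39 +
    (((♯34 * ♯9 + ♯10 - ♯41) &&& ♯10) >>> ♯5) % (♭1 <<< (♯6 * ♯40)) % ♯11)) <|
  assign 36 (♯36 + ♯42)

/-- Descent in a search tree. -/
def descentCode (κ : ℕ) : Cmd := .while (.lt 23 38) (descentBody κ)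

/-- The constants of the search trees: fields of `B + 1` bits, degree `f`. -/
structure TreeConsts (κ w : ℕ) (V : List ℕ) (B f : ℕ) (ρ : ℕ → ℕ) : Prop where
  c2 : ρ 2 = w
  c3 : ρ 3 = κ * w
  c5 : ρ 5 = B
  c6 : ρ 6 = B + 1
  c7 : ρ 7 = f
  c9 : ρ 9 = pack (B + 1) (List.replicate f 1)
  c10 : ρ 10 = 2 ^ B * pack (B + 1) (List.replicate f 1)
  c11 : ρ 11 = 2 ^ (B + 1) - 1
  c21 : ρ 21 = w + κ * w * V.length
  c23 : ρ 23 = 1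

theorem TreeConsts.congr {κ w : ℕ} {V : List ℕ} {B f : ℕ} {ρ ρ' : ℕ → ℕ}
    (h : TreeConsts κ w V B f ρ) (h' : ∀ y < 32, ρ' y = ρ y) : TreeConsts κ w V B f ρ' := by
  constructor <;> rw [h' _ (by norm_num)]
  exacts [h.c2, h.c3, h.c5, h.c6, h.c7, h.c9, h.c10, h.c11, h.c21, h.c23]

section
variable {κ w : ℕ} {V : List ℕ} {mem : List (BitVec w)} {ρ : ℕ → ℕ}

theorem every_lt {B g : ℕ} {l : List ℕ} (h : ∀ y ∈ l, y < 2 ^ B) : ∀ y ∈ every g l, y < 2 ^ B := by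
  intro y hy
  simp only [every, List.mem_map] at hy
  obtain ⟨i, -, rfl⟩ := hy
  exact getD_lt_of_forall (by positivity) h _

theorem Loaded.descentBody {B f t z cnt p : ℕ} {keys l rest : List ℕ}
    (L : Loaded κ w V (pack (B + 1) keys) mem) (hρ : Bdd κ w ρ) (hc : TreeConsts κ w V B f ρ)
    (hkeys : ∀ y ∈ keys, y < 2 ^ B) (hf : 2 ≤ f) (hfb : f < 2 ^ (B + 1) - 1)
    (hbf : (B + 1) * f < κ * w) (hlen : keys.length < 2 ^ (κ * w))
    (hz : ρ 34 = z) (hzB : z < 2 ^ B) (hm : ρ 35 = l.length) (hp : ρ 36 = p)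
    (h37 : ρ 37 = (cnt + f ^ (t + 1) - 1) / f ^ (t + 1)) (h38 : ρ 38 = f ^ (t + 1))
    (hcnt : ∀ i < l.length, l.getD i 0 ≤ z ↔ i < cnt) (hcm : cnt ≤ l.length) (hcpos : 0 < cnt)
    (hdrop : keys.drop p = treeLevels f l (t + 1) ++ rest) :
    Runs mem (8 * κ * w) (descentBody κ) ρ fun ρ' => Bdd κ w ρ' ∧ ρ' 37 = (cnt + f ^ t - 1) / f ^ t ∧
      ρ' 38 = f ^ t ∧ keys.drop (ρ' 36) = treeLevels f l t ++ rest ∧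
      ∀ y, y < 36 ∨ 42 < y → ρ' y = ρ y := by
  obtain ⟨G, hG⟩ : ∃ G, G = f ^ t := ⟨_, rfl⟩
  have hGpos : 0 < G := by rw [hG]; positivity
  rw [pow_succ, ← hG] at h37 h38
  rw [← hG]
  obtain ⟨len, hlen'⟩ : ∃ len, len = (l.length + G - 1) / G := ⟨_, rfl⟩
  obtain ⟨c, hcdef⟩ : ∃ c, c = (cnt + G * f - 1) / (G * f) := ⟨_, rfl⟩
  obtain ⟨e, hedef⟩ : ∃ e, e = (cnt + G - 1) / G := ⟨_, rfl⟩
  -- Positivity of `cnt` makes `c - 1` an honest index: that of the last coarse element not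
  -- exceeding `z`.
  have hcp : 0 < c := hcdef ▸ ceil_div_pos (by positivity) hcpos
  have hj₁ : (c - 1) * f < e := by
    rw [hcdef, hedef]; exact pred_ceil_div_mul_lt (by omega) hGpos hcpos
  have hj₂ : e ≤ (c - 1) * f + f := by
    have : e ≤ c * f := by rw [hcdef, hedef]; exact ceil_div_le_mul (by omega) hGpos
    calc e ≤ c * f := this
      _ = _ := by rw [← Nat.succ_mul]; congr 1; omega
  have he : e ≤ len := by rw [hedef, hlen']; exact ceil_div_mono hcm
  have hlm : len ≤ l.length := hlen' ▸ ceil_div_le_self hGpos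
  have hlβ : l.length < 2 ^ (κ * w) := hm ▸ hρ 35
  have hGβ : G < 2 ^ (κ * w) := by
    have := hρ 38
    rw [h38] at this
    nlinarith
  rw [← hcdef] at h37
  obtain ⟨j, hjdef⟩ : ∃ j, j = (c - 1) * f := ⟨_, rfl⟩
  rw [← hjdef] at hj₁ hj₂
  obtain ⟨v, hv⟩ : ∃ v, v = min f (len - j) := ⟨_, rfl⟩
  have hlevel : (every G l).length = len := by simp [every, hlen']
  have hdrop' : keys.drop p = every G l ++ (treeLevels f l t ++ rest) := by
    rw [hdrop, treeLevels, ← hG, List.append_assoc]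
  have hplen : p + len ≤ keys.length := by
    have := congrArg List.length hdrop'
    simp only [List.length_drop, List.length_append, hlevel] at this
    omega
  have hfβ : f < 2 ^ (κ * w) := hc.c7 ▸ hρ 7
  refine Runs.seq (L.assign G (by decide) rfl (by decide) hρ (by simp)
    (by simp [h38, hc.c7, Nat.mul_div_cancel G (by omega : 0 < f)]) rfl) ?_
  rintro _ rfl
  have b₁ := hρ.update (x := 38) hGβ
  refine Runs.seq (L.assign len (by decide) rfl (by decide) b₁ (by simp; omega)
    (by simp [hm, hlen']) rfl) ?_
  rintro _ rfl
  have b₂ := b₁.update (x := 42) (hlm.trans_lt hlβ)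
  refine Runs.seq (L.assign j (by decide) rfl (by decide) b₂ (by simp [h37]; omega)
    (by simp [h37, hc.c7, hjdef]) rfl) ?_
  rintro _ rfl
  have b₃ := b₂.update (x := 39) (v := j) (by omega)
  refine Runs.seq (L.assign (len - j) (by decide) rfl (by decide) b₃ (by simp; omega)
    (by simp) rfl) ?_
  rintro _ rfl
  have b₄ := b₃.update (x := 40) (v := len - j) (by omega)
  refine Runs.seq (R := fun ρ' => ρ' = Function.update (Function.update (Function.update
    (Function.update ρ 38 G) 42 len) 39 j) 40 v) (Runs.ite ⟨by decide, by decide⟩ (fun ht => ?_)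
      fun ht => ?_) ?_
  · refine L.assign f (by decide) rfl (by decide) b₄ (by simp) (by simp [hc.c7]) ?_
    have : f < len - j := by simpa [Test.On, hc.c7] using ht
    rw [Function.update_idem, hv, min_eq_left this.le]
  · refine Reach.skip ?_
    have : ¬ f < len - j := by simpa [Test.On, hc.c7] using ht
    rw [hv, min_eq_right (by omega)]
  rintro _ rfl
  have b₅ := b₃.update (x := 40) (v := v) (by omega)
  refine Runs.seq (L.narrow ((B + 1) * (p + j)) (by decide) rfl (by decide) rfl (by decide) b₅
    (by simp) (by simp) (by simp [hc.c2]) (by simp [hc.c6, hc.c7, hbf.le])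
    (by simp [hc.c21, hc.c6, hp]) rfl) ?_
  rintro _ rfl
  have hkeys' : ∀ y ∈ keys, y < 2 ^ (B + 1) := fun y hy => (hkeys y hy).trans
    (Nat.pow_lt_pow_right (by norm_num) (by omega))
  have hY : bits (pack (B + 1) keys) ((B + 1) * (p + j)) ((B + 1) * f) =
      pack (B + 1) (((every G l ++ (treeLevels f l t ++ rest)).drop j).take f) := by
    rw [bits_pack hkeys', ← List.drop_drop, hdrop']
  have hval : (♯6 * ♯7).val 0 0 (Function.update (Function.update (Function.update
    (Function.update ρ 38 G) 42 len) 39 j) 40 v) = (B + 1) * f := by simp [hc.c6, hc.c7]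
  rw [hval]
  set Yl := ((every G l ++ (treeLevels f l t ++ rest)).drop j).take f with hYl
  have hYlt : ∀ y ∈ Yl, y < 2 ^ B := by
    intro y hy
    rw [hYl, ← hdrop'] at hy
    exact hkeys y (List.mem_of_mem_drop (List.mem_of_mem_drop (List.mem_of_mem_take hy)))
  have hYf : Yl.length ≤ f := by simp [hYl]
  have hYv : v ≤ Yl.length := by
    simp only [hYl, List.length_take, List.length_drop, List.length_append, hlevel]
    omega
  rw [hY]
  have hYb : pack (B + 1) Yl < 2 ^ (κ * w) := by
    rw [← hY]
    exact (bits_lt _ _ _).trans (Nat.pow_lt_pow_right (by norm_num) hbf)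
  have b₆ := b₅.update (x := 41) hYb
  have hcount := count_le_fields hYlt hzB hYf hYv hfb
  rw [count_every hGpos hcnt hcm (by rw [hv, hlen']) (by omega) (by omega), ← hedef] at hcount
  have hYle : pack (B + 1) Yl ≤ z * pack (B + 1) (List.replicate f 1) +
      2 ^ B * pack (B + 1) (List.replicate f 1) := by
    have := pack_le_mul_replicate (b := B + 1) (fun y hy => (hYlt y hy).le) hYf
    omega
  refine Runs.seq (L.assign e (by decide) rfl (by decide) b₆ ?_ ?_ rfl) ?_
  · simp only [Ex.side_add, Ex.side_mod, Ex.side_shr, Ex.side_and, Ex.side_sub, Ex.side_mul,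
      Ex.side_shl, Ex.side_var, Ex.side_lit, true_and, and_true, Ex.val_var, Ex.val_add,
      Ex.val_mul, Ex.val_lit, Function.update_self]
    simp only [ne_eq, Nat.reduceEqDiff, not_false_eq_true,
      Function.update_of_ne, Function.update_self, hz, hc.c9, hc.c10, hc.c6, one_mul]
    refine ⟨hYle, Nat.pow_lt_pow_right (by norm_num) (lt_of_le_of_lt ?_ hbf)⟩
    exact Nat.mul_le_mul_left _ (by omega)
  · simp [hz, hc.c9, hc.c10, hc.c6, hc.c5, hc.c11, hcount]
    omega
  rintro _ rfl
  have b₇ := b₆.update (x := 37) (v := e) (by omega)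
  refine L.assign (p + len) (by decide) rfl (by decide) b₇ (by simp) (by simp [hp])
    ⟨b₇.update (by omega), by simp [hedef], by simp, ?_, ?_⟩
  · rw [Function.update_self, ← List.drop_drop, hdrop', ← hlevel, List.drop_left]
  · intro y hy
    have h : ∀ c, 36 ≤ c → c ≤ 42 → y ≠ c := fun c _ _ => by omega
    simp [h]

/-- The budget of the loop is the number of levels left, and variable `38` is `f` to that power.
When it reaches 1 the rounded-up quotient is `cnt` itself. -/
theorem Loaded.descent {B f t z cnt p : ℕ} {keys l rest : List ℕ}
    (L : Loaded κ w V (pack (B + 1) keys) mem) (hρ : Bdd κ w ρ) (hc : TreeConsts κ w V B f ρ)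
    (hkeys : ∀ y ∈ keys, y < 2 ^ B) (hf : 2 ≤ f) (hfb : f < 2 ^ (B + 1) - 1)
    (hbf : (B + 1) * f < κ * w) (hlen : keys.length < 2 ^ (κ * w))
    (hz : ρ 34 = z) (hzB : z < 2 ^ B) (hm : ρ 35 = l.length) (hp : ρ 36 = p)
    (h37 : ρ 37 = (cnt + f ^ t - 1) / f ^ t) (h38 : ρ 38 = f ^ t)
    (hcnt : ∀ i < l.length, l.getD i 0 ≤ z ↔ i < cnt) (hcm : cnt ≤ l.length) (hcpos : 0 < cnt)
    (hdrop : keys.drop p = treeLevels f l t ++ rest) :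
    Reach mem (8 * κ * w) (descentCode κ) ρ (t * ((RAM.descentBody κ).time + 1) + 1) fun ρ' =>
      Bdd κ w ρ' ∧ ρ' 37 = cnt ∧ ∀ y, y < 36 ∨ 42 < y → ρ' y = ρ y := by
  refine Reach.while (b := .lt 23 38) ⟨by decide, by decide⟩ (fun t ρ' => Bdd κ w ρ' ∧
    ρ' 37 = (cnt + f ^ t - 1) / f ^ t ∧ ρ' 38 = f ^ t ∧
    keys.drop (ρ' 36) = treeLevels f l t ++ rest ∧ ∀ y, y < 36 ∨ 42 < y → ρ' y = ρ y)
    ?_ ?_ t ⟨hρ, h37, h38, hp ▸ hdrop, fun _ _ => rfl⟩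
  · rintro n ρ' ⟨h₁, h₂, h₃, -, h₅⟩ hn
    have : ¬ 1 < f ^ n := by
      simpa [Test.On, h₃, h₅ 23 (by norm_num), hc.c23] using hn
    have h1 : f ^ n = 1 := le_antisymm (by omega) (Nat.one_le_pow _ _ (by omega))
    exact ⟨h₁, by simpa [h1] using h₂, h₅⟩
  · rintro n ρ' ⟨h₁, h₂, h₃, h₄, h₅⟩ hn
    have hn' : 1 < f ^ n := by
      simpa [Test.On, h₃, h₅ 23 (by norm_num), hc.c23] using hn
    obtain ⟨n, rfl⟩ : ∃ n', n = n' + 1 := ⟨n - 1, by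
      rcases n with _ | n
      · simp at hn'
      · simp⟩
    refine ⟨n, rfl, ?_⟩
    have hc' : TreeConsts κ w V B f ρ' := hc.congr fun y hy => h₅ y (by omega)
    refine Runs.mono (L.descentBody h₁ hc' hkeys hf hfb hbf hlen ((h₅ 34 (by norm_num)).trans hz)
      hzB ((h₅ 35 (by norm_num)).trans hm) rfl h₂ h₃ hcnt hcm hcpos h₄) ?_
    rintro ρ'' ⟨k₁, k₂, k₃, k₄, k₅⟩
    exact ⟨k₁, k₂, k₃, k₄, fun y hy => (k₅ y hy).trans (h₅ y hy)⟩

end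

/-! ### Tries -/

/-- The node of the trie at depth `j` on the path of `z`: the first digits of `z`, preceded by a
one. The trie has depth `D`, its digits have `d` bits, and the keys have `X` bits. -/
def node (X d D j z : ℕ) : ℕ := (2 ^ X + z) / 2 ^ (d * (D - j))

/-- Some element of `Q` passes through the node of `z` at depth `j`. -/
def Internal (X d D : ℕ) (Q : Finset ℕ) (j z : ℕ) : Prop := ∃ q ∈ Q, node X d D j q = node X d D j z

section
variable {X d D j z : ℕ}

theorem node_div {i : ℕ} (hi : i ≤ j) (hj : j ≤ D) :
    node X d D j z / 2 ^ (d * (j - i)) = node X d D i z := by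
  rw [node, node, Nat.div_div_eq_div_mul, ← pow_add, ← mul_add]
  congr 3
  omega

theorem node_mono {z' : ℕ} (h : z ≤ z') : node X d D j z ≤ node X d D j z' :=
  Nat.div_le_div_right (by omega)

theorem node_pos (hX : d * D ≤ X) : 0 < node X d D j z := by
  refine Nat.div_pos ?_ (by positivity)
  have : 2 ^ (d * (D - j)) ≤ 2 ^ X :=
    Nat.pow_le_pow_right (by norm_num) ((Nat.mul_le_mul_left d (Nat.sub_le _ _)).trans hX)
  omega

theorem node_lt (hz : z < 2 ^ X) : node X d D j z < 2 ^ (X + 1) :=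
  (Nat.div_le_self _ _).trans_lt (by rw [pow_succ]; omega)

/-- The leading one makes the binary length of a node reveal its depth, so one dictionary can serve
all levels. -/
theorem node_level {j' z' : ℕ} (hd : 0 < d) (hX : d * D ≤ X) (hj : j ≤ D) (hj' : j' ≤ D)
    (hz : z < 2 ^ X) (hz' : z' < 2 ^ X) (h : node X d D j z = node X d D j' z') : j = j' := by
  have key : ∀ {j z}, j ≤ D → z < 2 ^ X → Nat.log 2 (node X d D j z) = X - d * (D - j) := by
    intro j z hj hz
    have hle : d * (D - j) ≤ X := (Nat.mul_le_mul_left d (Nat.sub_le _ _)).trans hX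
    have hp : 2 ^ X = 2 ^ (X - d * (D - j)) * 2 ^ (d * (D - j)) := by
      rw [← pow_add]; congr 1; omega
    rw [Nat.log_eq_iff (Or.inr ⟨by norm_num, (node_pos hX).ne'⟩)]
    constructor
    · rw [node, Nat.le_div_iff_mul_le (by positivity)]
      omega
    · rw [node, Nat.div_lt_iff_lt_mul (by positivity), pow_succ]
      nlinarith
  have h₁ := key hj hz
  have h₂ := key hj' hz'
  rw [h] at h₁
  have h₃ : ∀ i, d * (D - i) ≤ d * D := fun i => Nat.mul_le_mul_left d (Nat.sub_le _ _)
  have h₄ : d * (D - j) = d * (D - j') := by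
    have := h₃ j
    have := h₃ j'
    omega
  have := Nat.eq_of_mul_eq_mul_left hd h₄
  omega

theorem Internal.of_le {Q : Finset ℕ} {i : ℕ} (h : Internal X d D Q j z) (hi : i ≤ j)
    (hj : j ≤ D) : Internal X d D Q i z := by
  obtain ⟨q, hq, h⟩ := h
  exact ⟨q, hq, by rw [← node_div hi hj, ← node_div hi hj, h]⟩

theorem bucket_eq_of_node_eq {z' : ℕ} (hX : d * D ≤ X) (hj : j ≤ D)
    (h : node X d D j z = node X d D j z') : z / 2 ^ (d * D) = z' / 2 ^ (d * D) := by
  have h₁ := node_div (X := X) (d := d) (z := z) (Nat.zero_le j) hj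
  rw [h, node_div (Nat.zero_le j) hj, node, node, Nat.sub_zero] at h₁
  obtain ⟨r, rfl⟩ := Nat.exists_eq_add_of_le hX
  rw [pow_add, Nat.mul_add_div (by positivity), Nat.mul_add_div (by positivity)] at h₁
  omega

theorem node_zero_eq {z' : ℕ} (hX : d * D ≤ X) (h : z / 2 ^ (d * D) = z' / 2 ^ (d * D)) :
    node X d D 0 z = node X d D 0 z' := by
  obtain ⟨r, rfl⟩ := Nat.exists_eq_add_of_le hX
  rw [node, node, Nat.sub_zero, pow_add, Nat.mul_add_div (by positivity),
    Nat.mul_add_div (by positivity), h]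

/-- A dictionary for the trie of `Q`: it tells internal nodes from others and gives the value of
the function `c` at the nodes where the search ends. -/
theorem exists_trie_dictionary (Q : Finset ℕ) (c : ℕ → ℕ) (hd : 0 < d) (hX : d * D ≤ X)
    (hQ : ∀ q ∈ Q, q < 2 ^ X) (hc : ∀ z, 0 < c z)
    (hsep : ∀ z z', z < z' → z' < 2 ^ X → z / 2 ^ (d * D) = z' / 2 ^ (d * D) → c z ≠ c z' →
      ∃ q ∈ Q, z < q ∧ q ≤ z') :
    ∃ (A : Finset ℕ) (val : ℕ → ℕ), A.card ≤ Q.card * D * 2 ^ d ∧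
      (∀ x ∈ A, 0 < x ∧ x < 2 ^ (X + 1)) ∧
      (∀ x ∈ A, val x ≤ 1 ∨ ∃ z, val x = 1 + c z) ∧
      (∀ z < 2 ^ X, ∀ j, 0 < j → j < D →
        ((if node X d D j z ∈ A then val (node X d D j z) else 0) = 1 ↔ Internal X d D Q j z)) ∧
      (∀ z < 2 ^ X, ∀ j, j + 1 ≤ D → Internal X d D Q j z →
        (j + 1 = D ∨ ¬ Internal X d D Q (j + 1) z) →
        (if node X d D (j + 1) z ∈ A then val (node X d D (j + 1) z) else 0) = 1 + c z) := by
  classical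
  -- All children of the nodes on sample paths, `2 ^ d` for each. Wherever a path leaves the trie,
  -- its first outside node is among them.
  set A := (Q ×ˢ Finset.range D ×ˢ Finset.range (2 ^ d)).image
    fun p => node X d D p.2.1 p.1 * 2 ^ d + p.2.2 with hA
  -- The value 1 is reserved for internal nodes. Elsewhere the value is `1 + c`, which is at least 2
  -- because `c` is positive, so the two kinds cannot be confused.
  set val : ℕ → ℕ := fun x =>
    if ∃ j, 0 < j ∧ j < D ∧ ∃ q ∈ Q, node X d D j q = x then 1
    else if h : ∃ z, z < 2 ^ X ∧ ∃ j, 0 < j ∧ j ≤ D ∧ node X d D j z = x then 1 + c h.choose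
    else 0 with hval
  have hmem : ∀ z j, j + 1 ≤ D → Internal X d D Q j z → node X d D (j + 1) z ∈ A := by
    rintro z j hj ⟨q, hq, h⟩
    rw [hA, Finset.mem_image]
    refine ⟨(q, j, node X d D (j + 1) z % 2 ^ d), ?_, ?_⟩
    · simp only [Finset.mem_product, Finset.mem_range]
      exact ⟨hq, by omega, Nat.mod_lt _ (by positivity)⟩
    · have := node_div (X := X) (d := d) (z := z) (Nat.le_succ j) hj
      rw [show j.succ - j = 1 by omega, mul_one] at this
      simp only [h, ← this]
      rw [mul_comm]
      exact Nat.div_add_mod _ _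
  have hinternal : ∀ z < 2 ^ X, ∀ j, 0 < j → j ≤ D →
      ((∃ j', 0 < j' ∧ j' < D ∧ ∃ q ∈ Q, node X d D j' q = node X d D j z) ↔
        j < D ∧ Internal X d D Q j z) := by
    intro z hz j hj hjD
    constructor
    · rintro ⟨j', -, hj', q, hq, h⟩
      obtain rfl := node_level hd hX hj'.le hjD (hQ q hq) hz h
      exact ⟨hj', q, hq, h⟩
    · rintro ⟨hj', q, hq, h⟩
      exact ⟨j, hj, hj', q, hq, h⟩
  refine ⟨A, val, ?_, ?_, ?_, ?_, ?_⟩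
  · refine Finset.card_image_le.trans ?_
    simp [mul_assoc]
  · intro x hx
    rw [hA, Finset.mem_image] at hx
    obtain ⟨⟨q, j, e⟩, h, rfl⟩ := hx
    simp only [Finset.mem_product, Finset.mem_range] at h
    obtain ⟨hq, hj, he⟩ := h
    refine ⟨Nat.add_pos_left (Nat.mul_pos (node_pos hX) (by positivity)) _, ?_⟩
    have hs : d * (D - j) = d * (D - j - 1) + d := by
      obtain ⟨m, hm⟩ : ∃ m, D - j = m + 1 := ⟨D - j - 1, by omega⟩
      rw [hm, Nat.add_sub_cancel]; ring
    have h₁ : node X d D j q * 2 ^ d ≤ 2 ^ X + q := by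
      rw [node, hs, pow_add, ← Nat.div_div_eq_div_mul]
      exact (Nat.div_mul_le_self _ _).trans (Nat.div_le_self _ _)
    -- The parent shifted by `d` bits is a multiple of `2 ^ d` below a larger such multiple, so
    -- appending a digit does not cross that bound.
    have h₂ : 2 ^ d ∣ 2 ^ (X + 1) := pow_dvd_pow 2 (by nlinarith)
    have h₃ : node X d D j q * 2 ^ d < 2 ^ (X + 1) := by
      have := hQ q hq
      rw [pow_succ]
      omega
    obtain ⟨m, hm⟩ := h₂
    rw [hm, mul_comm] at h₃
    have h₄ : node X d D j q < m := Nat.lt_of_mul_lt_mul_left h₃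
    rw [hm]
    calc node X d D j q * 2 ^ d + e < node X d D j q * 2 ^ d + 2 ^ d := by
          simpa using he
      _ = 2 ^ d * (node X d D j q + 1) := by ring
      _ ≤ _ := Nat.mul_le_mul_left _ h₄
  · intro x _
    simp only [hval]
    split_ifs with h₁ h₂
    · exact Or.inl le_rfl
    · exact Or.inr ⟨_, rfl⟩
    · exact Or.inl (by norm_num)
  · intro z hz j hj hjD
    have hi := hinternal z hz j hj hjD.le
    by_cases h : Internal X d D Q j z
    · have hA' : node X d D j z ∈ A := by
        obtain ⟨i, rfl⟩ : ∃ i, j = i + 1 := ⟨j - 1, by omega⟩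
        exact hmem z i hjD.le (h.of_le (Nat.le_succ _) hjD.le)
      simp only [h, hA', if_true, hval, if_pos (hi.2 ⟨hjD, h⟩)]
    · simp only [h, iff_false]
      split_ifs with h₁
      · have h₂ : ∃ z', z' < 2 ^ X ∧ ∃ j', 0 < j' ∧ j' ≤ D ∧ node X d D j' z' = node X d D j z :=
          ⟨z, hz, j, hj, hjD.le, rfl⟩
        simp only [hval]
        rw [if_neg (fun h' => h (hi.1 h').2), dif_pos h₂]
        have := hc h₂.choose
        omega
      · norm_num
  · intro z hz j hjD hin hout
    have hi := hinternal z hz (j + 1) (by omega) hjD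
    rw [if_pos (hmem z j hjD hin)]
    have h₂ : ∃ z', z' < 2 ^ X ∧ ∃ j', 0 < j' ∧ j' ≤ D ∧
        node X d D j' z' = node X d D (j + 1) z := ⟨z, hz, j + 1, by omega, hjD, rfl⟩
    simp only [hval]
    rw [if_neg, dif_pos h₂]
    · obtain ⟨hz', j', hj', hj'D, h⟩ := h₂.choose_spec
      generalize h₂.choose = z' at hz' h
      obtain rfl := node_level hd hX hj'D hjD hz' hz h
      congr 1
      by_contra hne
      -- The value does not depend on the chosen representative: if `c` changed between two keys
      -- below the same node, an element of `Q` between them would pass through the node, by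
      -- monotonicity. At depth `D` the node determines the key.
      have main : ∀ y y', y < y' → y' < 2 ^ X →
          node X d D (j + 1) y = node X d D (j + 1) y' → c y ≠ c y' →
          (j + 1 = D ∨ ¬ Internal X d D Q (j + 1) y) → False := by
        intro y y' hlt hy' hyy hcy hor
        obtain ⟨q, hq, h₁, h₂⟩ := hsep y y' hlt hy' (bucket_eq_of_node_eq hX hjD hyy) hcy
        rcases hor with hor | hor
        · rw [hor, node, node, Nat.sub_self, mul_zero, pow_zero, Nat.div_one, Nat.div_one] at hyy
          omega
        · refine hor ⟨q, hq, le_antisymm ?_ (node_mono h₁.le)⟩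
          rw [hyy]
          exact node_mono h₂
      have hinternal' : Internal X d D Q (j + 1) z' ↔ Internal X d D Q (j + 1) z := by
        simp only [Internal, h]
      rcases lt_trichotomy z' z with hlt | rfl | hlt
      · exact main z' z hlt hz h hne (by rwa [hinternal'])
      · exact hne rfl
      · exact main z z' hlt hz' h.symm (Ne.symm hne) hout
    · intro h
      have := hi.1 h
      rcases hout with h' | h'
      · omega
      · exact h' this.2

end

/-! ### Binary search on the levels of a trie -/

/-- One step of the binary search. -/
def trieBody (κ : ℕ) : Cmd :=
  .seq (assign 45 ((♯43 + ♯44) / ♭2)) <|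
  .seq (assign 46 ((♯14 + ♯32) >>> (♯12 * (♯13 - ♯45)))) <|
  .seq (lookupCode κ) <|
  .seq (.ite (.eq 53 23) (assign 43 ♯45) (assign 44 ♯45)) <|
  assign 45 (♯43 + ♭1)

/-- The start of the binary search. -/
def trieStart : Cmd :=
  .seq (assign 43 ♭0) <|
  .seq (assign 44 ♯13) <|
  assign 45 (♯43 + ♭1)

/-- The lookup of the node where the path of the key leaves the trie. -/
def trieFinish (κ : ℕ) : Cmd :=
  .seq (assign 46 ((♯14 + ♯32) >>> (♯12 * (♯13 - ♯44)))) <|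
  .seq (lookupCode κ) <|
  assign 37 (♯53 - ♭1)

/-- The search in the trie for the key in variable `32`. -/
def trieCode (κ : ℕ) : Cmd :=
  .seq trieStart <| .seq (.while (.lt 45 44) (trieBody κ)) (trieFinish κ)

/-- The constants of the trie, and the dictionary of its nodes. -/
structure TrieConsts (κ w : ℕ) (V T : List ℕ) (X d D θ A s : ℕ) (ρ : ℕ → ℕ) : Prop where
  c2 : ρ 2 = w
  c3 : ρ 3 = κ * w
  c12 : ρ 12 = d
  c13 : ρ 13 = D
  c14 : ρ 14 = 2 ^ X
  c16 : ρ 16 = 2 ^ θ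
  c17 : ρ 17 = A
  c18 : ρ 18 = s
  c20 : SubtableAt V (ρ 20) T
  c23 : ρ 23 = 1

theorem TrieConsts.congr {κ w : ℕ} {V T : List ℕ} {X d D θ A s : ℕ} {ρ ρ' : ℕ → ℕ}
    (h : TrieConsts κ w V T X d D θ A s ρ) (h' : ∀ y < 32, ρ' y = ρ y) :
    TrieConsts κ w V T X d D θ A s ρ' := by
  constructor <;> rw [h' _ (by norm_num)]
  exacts [h.c2, h.c3, h.c12, h.c13, h.c14, h.c16, h.c17, h.c18, h.c20, h.c23]

/-- The dictionary `T` serves the trie of `Q` with the values `c`. -/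
structure TrieDict (T : List ℕ) (X d D θ A s : ℕ) (Q : Finset ℕ) (c : ℕ → ℕ) : Prop where
  range : ∀ x, 0 < x → 3 * (A * x % 2 ^ θ / 2 ^ s) + 2 < T.length ∧
    dictSlot T θ A s x + 1 < T.length
  internal : ∀ z < 2 ^ X, ∀ j, 0 < j → j < D →
    (dictLookup T θ A s (node X d D j z) = 1 ↔ Internal X d D Q j z)
  leave : ∀ z < 2 ^ X, ∀ j, j + 1 ≤ D → Internal X d D Q j z →
    (j + 1 = D ∨ ¬ Internal X d D Q (j + 1) z) →
      dictLookup T θ A s (node X d D (j + 1) z) = 1 + c z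

section
variable {κ w N : ℕ} {V : List ℕ} {mem : List (BitVec w)} {ρ : ℕ → ℕ}

/-- Binary search between a depth where the path of `z` is internal and one where it is not, or the
full depth. Once the two are adjacent, the lower node is where the path leaves, and the dictionary
stores `1 + c z` there. The root is internal by hypothesis, so depth zero is never looked up. -/
theorem Loaded.trie (L : Loaded κ w V N mem) (hlen : V.length < 2 ^ (κ * w)) (hρ : Bdd κ w ρ)
    {T : List ℕ} {X d D θ A s z n : ℕ} {Q : Finset ℕ} {c : ℕ → ℕ}
    (hc : TrieConsts κ w V T X d D θ A s ρ) (hT : TrieDict T X d D θ A s Q c)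
    (hX : d * D ≤ X) (hXβ : 2 ^ (X + 1) ≤ 2 ^ (κ * w)) (hD : 0 < D) (hDn : D ≤ 2 ^ n)
    (hz : ρ 32 = z) (hzX : z < 2 ^ X) (hroot : Internal X d D Q 0 z) (hcz : c z < 2 ^ (κ * w)) :
    Reach mem (8 * κ * w) (trieCode κ) ρ
      (trieStart.time + ((n * ((trieBody κ).time + 1) + 1) + (trieFinish κ).time)) fun ρ' =>
        Bdd κ w ρ' ∧ ρ' 37 = c z ∧ ∀ y, y < 37 ∨ (37 < y ∧ y < 43) ∨ 53 < y → ρ' y = ρ y := by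
  have hβ : 32 < 2 ^ (κ * w) := L.machine.thirtytwo_lt
  have hDβ : D < 2 ^ (κ * w) := hc.c13 ▸ hρ 13
  have hnode : ∀ j, node X d D j z < 2 ^ (κ * w) := fun j => (node_lt hzX).trans_le hXβ
  have step₁ : Runs mem (8 * κ * w) trieStart ρ fun ρ' => ρ' = Function.update (Function.update
      (Function.update ρ 43 0) 44 D) 45 1 := by
    have b₁ := hρ.update (x := 43) (v := 0) (by positivity)
    have b₂ := b₁.update (x := 44) hDβ
    refine Runs.seq (L.assign 0 (by decide) rfl (by decide) hρ (by simp) rfl rfl) ?_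
    rintro _ rfl
    refine Runs.seq (L.assign D (by decide) rfl (by decide) b₁ (by simp) (by simp [hc.c13]) rfl) ?_
    rintro _ rfl
    exact L.assign 1 (by decide) rfl (by decide) b₂ (by simp) (by simp) rfl
  refine Reach.seq step₁ ?_
  rintro _ rfl
  -- The budget `n` bounds the gap by `2 ^ n`. At budget zero the ends are adjacent, as variable
  -- `43` stays below variable `44`.
  set I : ℕ → (ℕ → ℕ) → Prop := fun n ρ' => Bdd κ w ρ' ∧ ρ' 43 < ρ' 44 ∧ ρ' 44 ≤ D ∧
    ρ' 45 = ρ' 43 + 1 ∧ ρ' 44 - ρ' 43 ≤ 2 ^ n ∧ Internal X d D Q (ρ' 43) z ∧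
    (ρ' 44 = D ∨ ¬ Internal X d D Q (ρ' 44) z) ∧ ∀ y, y < 43 ∨ 53 < y → ρ' y = ρ y with hI
  refine Reach.seq (R := fun ρ' => I 0 ρ') (Reach.while (b := .lt 45 44)
    ⟨by decide, by decide⟩ I ?_ ?_ n ?_) ?_
  · rintro m ρ' ⟨h₁, h₂, h₃, h₄, h₅, h₆⟩ hn
    have : ¬ ρ' 43 + 1 < ρ' 44 := by simpa [Test.On, h₄] using hn
    exact ⟨h₁, h₂, h₃, h₄, by simp; omega, h₆⟩
  · rintro m ρ' ⟨h₁, h₂, h₃, h₄, h₅, h₆, h₇, h₈⟩ hn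
    have hlt : ρ' 43 + 1 < ρ' 44 := by simpa [Test.On, h₄] using hn
    obtain ⟨m, rfl⟩ : ∃ m', m = m' + 1 := ⟨m - 1, by
      rcases m with _ | m
      · simp at h₅; omega
      · simp⟩
    refine ⟨m, rfl, ?_⟩
    have hc' : TrieConsts κ w V T X d D θ A s ρ' := hc.congr fun y hy => h₈ y (by omega)
    obtain ⟨mid, hmid⟩ : ∃ mid, mid = (ρ' 43 + ρ' 44) / 2 := ⟨_, rfl⟩
    have b₁ := h₁.update (x := 45) (v := mid) (by omega)
    have b₂ := b₁.update (x := 46) (hnode mid)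
    refine Runs.seq (L.assign mid (by decide) rfl (by decide) h₁ (by simp) (by simp [hmid]) rfl) ?_
    rintro _ rfl
    refine Runs.seq (L.assign (node X d D mid z) (by decide) rfl (by decide) b₁
      (by simp [hc'.c13]; omega)
      (by simp [hc'.c14, hc'.c12, hc'.c13, h₈ 32 (by norm_num), hz, node]) rfl) ?_
    rintro _ rfl
    have hr := hT.range (node X d D mid z) (node_pos hX)
    refine Runs.seq (L.lookup hlen b₂ (x := node X d D mid z) (by simp [hc'.c2])
      (by simp [hc'.c3]) (by simpa using hc'.c16) (by simpa using hc'.c17) (by simpa using hc'.c18)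
      (by simpa using hc'.c20) (by simp) hr.1 hr.2) ?_
    rintro ρ₁ ⟨k₁, k₂, k₃⟩
    have e43 : ρ₁ 43 = ρ' 43 := by simp [k₃ 43]
    have e44 : ρ₁ 44 = ρ' 44 := by simp [k₃ 44]
    have e45 : ρ₁ 45 = mid := by simp [k₃ 45]
    have e23 : ρ₁ 23 = 1 := by simp [k₃ 23, hc'.c23]
    have ey : ∀ y, y < 43 ∨ 53 < y → ρ₁ y = ρ y := by
      intro y hy
      rw [k₃ y (by omega), Function.update_of_ne (by omega), Function.update_of_ne (by omega),
        h₈ y hy]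
    have hiff := hT.internal z hzX mid (by omega) (by omega)
    rw [← k₂] at hiff
    have hw : 2 ^ (m + 1) = 2 * 2 ^ m := by ring
    refine Runs.seq (R := fun ρ₂ => ρ₂ = Function.update ρ₁ 43 mid ∧ Internal X d D Q mid z ∨
      ρ₂ = Function.update ρ₁ 44 mid ∧ ¬ Internal X d D Q mid z)
      (Runs.ite ⟨by decide, by decide⟩ (fun ht => ?_) fun ht => ?_) ?_
    · have : ρ₁ 53 = 1 := by simpa [Test.On, e23] using ht
      exact L.assign mid (by decide) rfl (by decide) k₁ (by simp) (by simp [e45])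
        (Or.inl ⟨rfl, hiff.1 this⟩)
    · have : ¬ ρ₁ 53 = 1 := by simpa [Test.On, e23] using ht
      exact L.assign mid (by decide) rfl (by decide) k₁ (by simp) (by simp [e45])
        (Or.inr ⟨rfl, fun h => this (hiff.2 h)⟩)
    rintro ρ₂ (⟨rfl, hin⟩ | ⟨rfl, hin⟩)
    · have b₃ := k₁.update (x := 43) (v := mid) (by omega)
      refine L.assign (mid + 1) (by decide) rfl (by decide) b₃ (by simp) (by simp)
        ⟨b₃.update (by omega), ?_, ?_, ?_, ?_, ?_, ?_, ?_⟩
      · simp [e44]; omega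
      · simp [e44]; omega
      · simp
      · simp [e44]; omega
      · simpa using hin
      · simpa [e44] using h₇
      · intro y hy
        rw [Function.update_of_ne (by omega), Function.update_of_ne (by omega), ey y hy]
    · have b₃ := k₁.update (x := 44) (v := mid) (by omega)
      refine L.assign (ρ' 43 + 1) (by decide) rfl (by decide) b₃ (by simp) (by simp [e43])
        ⟨b₃.update (by omega), ?_, ?_, ?_, ?_, ?_, ?_, ?_⟩
      · simp [e43]; omega
      · simp; omega
      · simp [e43]
      · simp [e43]; omega
      · simpa [e43] using h₆
      · simp [hin]
      · intro y hy
        rw [Function.update_of_ne (by omega), Function.update_of_ne (by omega), ey y hy]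
  · refine ⟨((hρ.update (by positivity)).update hDβ).update (by omega), ?_, ?_, ?_, ?_, ?_, ?_, ?_⟩
    · simpa using hD
    · simp
    · simp
    · simpa using hDn
    · simpa using hroot
    · simp
    · intro y hy
      rw [Function.update_of_ne (by omega), Function.update_of_ne (by omega),
        Function.update_of_ne (by omega)]
  · rintro ρ' ⟨h₁, h₂, h₃, h₄, h₅, h₆, h₇, h₈⟩
    have hc' : TrieConsts κ w V T X d D θ A s ρ' := hc.congr fun y hy => h₈ y (by omega)
    have h44 : ρ' 44 = ρ' 43 + 1 := by simp at h₅; omega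
    obtain ⟨hi, hhi⟩ : ∃ hi, hi = ρ' 44 := ⟨_, rfl⟩
    have b₁ := h₁.update (x := 46) (hnode hi)
    refine Runs.seq (L.assign (node X d D hi z) (by decide) rfl (by decide) h₁
      (by simpa [hc'.c13] using h₃)
      (by simp [hc'.c14, hc'.c12, hc'.c13, h₈ 32 (by norm_num), hz, node, hhi]) rfl) ?_
    rintro _ rfl
    have hr := hT.range (node X d D hi z) (node_pos hX)
    refine Runs.seq (L.lookup hlen b₁ (x := node X d D hi z) (by simp [hc'.c2])
      (by simp [hc'.c3]) (by simpa using hc'.c16) (by simpa using hc'.c17) (by simpa using hc'.c18)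
      (by simpa using hc'.c20) (by simp) hr.1 hr.2) ?_
    rintro ρ₁ ⟨k₁, k₂, k₃⟩
    have hleave := hT.leave z hzX (ρ' 43) (by omega) h₆ (by rwa [← h44])
    rw [← h44, ← hhi, ← k₂] at hleave
    refine L.assign (c z) (by decide) rfl (by decide) k₁ (by simp [hleave]) (by simp [hleave])
      ⟨k₁.update hcz, by simp, fun y hy => ?_⟩
    rw [Function.update_of_ne (by omega), k₃ y (by omega), Function.update_of_ne (by omega),
      h₈ y (by omega)]

end

/-! ### Rank queries on a set of keys in buckets -/

/-- The search trees of the first `m` buckets. -/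
def bucketKeys (f t : ℕ) (l : ℕ → List ℕ) (m : ℕ) : List ℕ := flat (fun h => treeLevels f (l h) t) m

/-- For each bucket, the number `R h`, the number of its keys, and the place of its search tree. -/
def bucketTable (f t : ℕ) (R : ℕ → ℕ) (l : ℕ → List ℕ) (m : ℕ) : List ℕ :=
  flat (fun h => [R h, (l h).length, (bucketKeys f t l h).length]) m

/-- Every `g`-th key of each bucket, except for the first one. -/
def samples (B g : ℕ) (l : ℕ → List ℕ) (m : ℕ) : Finset ℕ :=
  (Finset.range m).biUnion fun h =>
    (Finset.Icc 1 (((l h).length - 1) / g)).image fun i => h * 2 ^ B + (l h).getD (i * g) 0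

/-- The number of keys up to `z` in the bucket of `z`. -/
def countAt (B : ℕ) (l : ℕ → List ℕ) (z : ℕ) : ℕ := (l (z / 2 ^ B)).countP (· ≤ z % 2 ^ B)

/-- Each bucket is a sorted list of `B`-bit numbers that begins with zero. -/
structure Buckets (B : ℕ) (l : ℕ → List ℕ) : Prop where
  sorted : ∀ h, (l h).Pairwise (· ≤ ·)
  head : ∀ h, ∃ k, l h = 0 :: k
  lt : ∀ h, ∀ y ∈ l h, y < 2 ^ B

theorem getD_le_iff_lt_countP {l : List ℕ} (h : l.Pairwise (· ≤ ·)) (z : ℕ) :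
    ∀ i < l.length, l.getD i 0 ≤ z ↔ i < l.countP (· ≤ z) := by
  induction l with
  | nil => simp
  | cons x l ih =>
    rw [List.pairwise_cons] at h
    intro i hi
    by_cases hx : x ≤ z
    · rw [List.countP_cons_of_pos (by simpa using hx)]
      rcases i with _ | i
      · simpa using hx
      · simpa using ih h.2 i (by simpa using hi)
    · have h0 : (x :: l).countP (· ≤ z) = 0 := by
        rw [List.countP_eq_zero]
        intro y hy
        rcases List.mem_cons.1 hy with rfl | hy
        · simpa using hx
        · have := h.1 y hy
          simp; omega
      rw [h0, List.getD_eq_getElem _ _ hi]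
      simp only [not_lt_zero, iff_false]
      rcases i with _ | i
      · simpa using hx
      · have := h.1 _ (List.getElem_mem (by simpa using hi : i < l.length))
        simp only [List.getElem_cons_succ]
        omega

section
variable {B f t m g : ℕ} {l : ℕ → List ℕ} {R : ℕ → ℕ}

theorem Buckets.countAt_pos (hl : Buckets B l) (z : ℕ) : 0 < countAt B l z := by
  obtain ⟨k, hk⟩ := hl.head (z / 2 ^ B)
  rw [countAt, hk, List.countP_cons_of_pos (by simp)]
  omega

theorem countAt_le (z : ℕ) : countAt B l z ≤ (l (z / 2 ^ B)).length := List.countP_le_length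

/-- Let `i` be the smaller of the two quotients. Then index `i * g` is not below the count of `z`
but is below the count of `z'`, so the element there lies above `z` and not above `z'`. It is a
sample because `i` is positive. -/
theorem Buckets.separated (hl : Buckets B l) (hg : 0 < g) {z z' : ℕ} (hzz : z < z')
    (hm : z' / 2 ^ B < m) (hB : z / 2 ^ B = z' / 2 ^ B)
    (hne : (countAt B l z + g - 1) / g ≠ (countAt B l z' + g - 1) / g) :
    ∃ q ∈ samples B g l m, z < q ∧ q ≤ z' := by
  have e₁ := Nat.div_add_mod z (2 ^ B)
  have e₂ := Nat.div_add_mod z' (2 ^ B)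
  rw [hB] at e₁
  set h := z' / 2 ^ B with hh
  have hmono : countAt B l z ≤ countAt B l z' := by
    rw [countAt, countAt, hB, ← hh]
    refine List.countP_mono_left fun x _ hx => ?_
    simp only [decide_eq_true_eq] at hx ⊢
    omega
  obtain ⟨i, hi⟩ : ∃ i, i = (countAt B l z + g - 1) / g := ⟨_, rfl⟩
  have hi1 : 0 < i := hi ▸ ceil_div_pos hg (hl.countAt_pos z)
  have hlt : i < (countAt B l z' + g - 1) / g := by
    have := ceil_div_mono (g := g) hmono
    omega
  have hge : ¬ i < (countAt B l z + g - 1) / g := by omega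
  rw [lt_ceil_div_iff hg] at hlt hge
  have hlen : i * g < (l h).length := hlt.trans_le (countAt_le z')
  have k₁ := (getD_le_iff_lt_countP (hl.sorted h) (z' % 2 ^ B) _ hlen).2 hlt
  have k₂ := (getD_le_iff_lt_countP (hl.sorted h) (z % 2 ^ B) _ hlen).not.2
    (by rw [countAt, hB] at hge; exact hge)
  refine ⟨h * 2 ^ B + (l h).getD (i * g) 0, ?_, ?_, ?_⟩
  · simp only [samples, Finset.mem_biUnion, Finset.mem_range, Finset.mem_image, Finset.mem_Icc]
    exact ⟨h, hm, i, ⟨hi1, (Nat.le_div_iff_mul_le hg).2 (by omega)⟩, rfl⟩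
  · rw [mul_comm]; omega
  · rw [mul_comm]; omega

theorem Buckets.samples_lt (hl : Buckets B l) {q : ℕ} (hq : q ∈ samples B g l m) :
    q < m * 2 ^ B := by
  simp only [samples, Finset.mem_biUnion, Finset.mem_range, Finset.mem_image] at hq
  obtain ⟨h, hm, i, -, rfl⟩ := hq
  have := getD_lt_of_forall (by positivity) (hl.lt h) (i * g)
  nlinarith

/-- A bucket with more than `g` elements has a sample at index `g`, which is what the search in the
trie needs to start. -/
theorem Buckets.internal_root (hl : Buckets B l) {X d D z : ℕ} (hB : B = d * D) (hX : B ≤ X)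
    (hg : 0 < g) (hm : z / 2 ^ B < m) (hlen : g < (l (z / 2 ^ B)).length) :
    Internal X d D (samples B g l m) 0 z := by
  set h := z / 2 ^ B with hh
  refine ⟨h * 2 ^ B + (l h).getD (1 * g) 0, ?_, ?_⟩
  · simp only [samples, Finset.mem_biUnion, Finset.mem_range, Finset.mem_image, Finset.mem_Icc]
    exact ⟨h, hm, 1, ⟨le_rfl, (Nat.le_div_iff_mul_le hg).2 (by omega)⟩, rfl⟩
  · apply node_zero_eq (hB ▸ hX)
    rw [← hB, mul_comm, Nat.mul_add_div (by positivity),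
      Nat.div_eq_of_lt (getD_lt_of_forall (by positivity) (hl.lt h) _), add_zero]

/-- Index zero is not sampled, so a bucket with `p` elements after its first one yields at most `p /
g` samples. -/
theorem card_samples_mul_le :
    (samples B g l m).card * g ≤ ∑ h ∈ Finset.range m, ((l h).length - 1) := by
  have h₁ : (samples B g l m).card ≤ ∑ h ∈ Finset.range m, ((l h).length - 1) / g := by
    refine Finset.card_biUnion_le.trans (Finset.sum_le_sum fun h _ => ?_)
    refine Finset.card_image_le.trans ?_
    simp
  calc _ ≤ (∑ h ∈ Finset.range m, ((l h).length - 1) / g) * g := Nat.mul_le_mul_right _ h₁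
    _ ≤ _ := by
      rw [Finset.sum_mul]
      exact Finset.sum_le_sum fun h _ => Nat.div_mul_le_self _ _

theorem treeLevels_lt (hl : ∀ y ∈ l m, y < 2 ^ B) (t : ℕ) :
    ∀ y ∈ treeLevels f (l m) t, y < 2 ^ B := by
  induction t with
  | zero => simp [treeLevels]
  | succ t ih =>
    intro y hy
    rcases List.mem_append.1 hy with h | h
    · exact every_lt hl y h
    · exact ih y h

theorem Buckets.keys_lt (hl : Buckets B l) : ∀ y ∈ bucketKeys f t l m, y < 2 ^ B := by
  intro y hy
  obtain ⟨h, -, hy⟩ := mem_flat hy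
  exact treeLevels_lt (hl.lt h) t y hy

theorem length_bucketTable : (bucketTable f t R l m).length = 3 * m := by
  rw [bucketTable, length_flat]
  simp [mul_comm]

theorem getD_bucketTable {h c : ℕ} (hm : h < m) (hc : c < 3) :
    (bucketTable f t R l m).getD (3 * h + c) 0 =
      [R h, (l h).length, (bucketKeys f t l h).length].getD c 0 := by
  have := getD_flat (fun h => [R h, (l h).length, (bucketKeys f t l h).length]) hm (t := c)
    (by simpa using hc)
  rwa [show (flat (fun h => [R h, (l h).length, (bucketKeys f t l h).length]) h).length = 3 * h from
    length_bucketTable] at this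

theorem drop_bucketKeys {h : ℕ} (hm : h < m) :
    ∃ rest, (bucketKeys f t l m).drop (bucketKeys f t l h).length = treeLevels f (l h) t ++ rest := by
  obtain ⟨k, hk⟩ := flat_eq_append (fun h => treeLevels f (l h) t) hm
  exact ⟨k, by rw [bucketKeys, bucketKeys, hk, List.drop_left]⟩

end

/-- The start of a query: the bucket of the key. -/
def queryStart (κ : ℕ) : Cmd :=
  .seq (assign 34 (♯32 % ♯22)) <|
  .seq (assign 33 (wideEx κ (♯19 + ♭3 * (♯32 >>> ♯5)))) <|
  .seq (assign 35 (wideEx κ (♯19 + (♭3 * (♯32 >>> ♯5) + ♭1)))) <|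
  .seq (assign 36 (wideEx κ (♯19 + (♭3 * (♯32 >>> ♯5) + ♭2)))) <|
  .seq (assign 37 ♭1) <|
  assign 38 ♯8

/-- The number of keys up to the one in variable `32`, into variable `37`. -/
def queryCode (κ : ℕ) : Cmd :=
  .seq (queryStart κ) <|
  .seq (.ite (.lt 8 35) (trieCode κ) .skip) <|
  .seq (descentCode κ) <|
  assign 37 (♯33 + ♯37)

/-- The number of steps of a query, for a trie of depth at most `2 ^ n` and search trees of depth
`t`. -/
def queryTime (κ n t : ℕ) : ℕ :=
  (queryStart κ).time +
    ((trieStart.time + ((n * ((trieBody κ).time + 1) + 1) + (trieFinish κ).time) + 1) +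
      ((t * ((descentBody κ).time + 1) + 1) + (assign 37 (♯33 + ♯37)).time))

section
variable {κ w : ℕ} {V : List ℕ} {mem : List (BitVec w)} {ρ : ℕ → ℕ}

/-- The constants of the query program. -/
structure QueryConsts (κ w : ℕ) (V T : List ℕ) (f t : ℕ) (R : ℕ → ℕ) (l : ℕ → List ℕ)
    (X B d D θ A s : ℕ) (ρ : ℕ → ℕ) : Prop where
  tree : TreeConsts κ w V B f ρ
  trie : TrieConsts κ w V T X d D θ A s ρ
  c8 : ρ 8 = f ^ t
  c19 : SubtableAt V (ρ 19) (bucketTable f t R l (2 ^ (X - B)))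
  c22 : ρ 22 = 2 ^ B

theorem QueryConsts.congr {T : List ℕ} {f t : ℕ} {R : ℕ → ℕ} {l : ℕ → List ℕ}
    {X B d D θ A s : ℕ} {ρ' : ℕ → ℕ} (h : QueryConsts κ w V T f t R l X B d D θ A s ρ)
    (h' : ∀ y < 32, ρ' y = ρ y) : QueryConsts κ w V T f t R l X B d D θ A s ρ' := by
  refine ⟨h.tree.congr h', h.trie.congr h', ?_, ?_, ?_⟩ <;> rw [h' _ (by norm_num)]
  exacts [h.c8, h.c19, h.c22]

/-- The trie delivers the rank among every `f ^ t`-th key of the bucket, which is exactly the state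
in which a descent of `t` levels begins. -/
theorem Loaded.query {T : List ℕ} {f t X B d D θ A s z n : ℕ} {R : ℕ → ℕ} {l : ℕ → List ℕ}
    (L : Loaded κ w V (pack (B + 1) (bucketKeys f t l (2 ^ (X - B)))) mem)
    (hV : V.length < 2 ^ (κ * w)) (hρ : Bdd κ w ρ)
    (hc : QueryConsts κ w V T f t R l X B d D θ A s ρ) (hl : Buckets (B) l)
    (hT : TrieDict T X d D θ A s (samples (B) (f ^ t) l (2 ^ (X - B)))
      fun z => (countAt (B) l z + f ^ t - 1) / f ^ t)
    (hB : B = d * D) (hX : B ≤ X) (hXβ : 2 ^ (X + 1) ≤ 2 ^ (κ * w)) (hD : 0 < D) (hDn : D ≤ 2 ^ n)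
    (hf : 2 ≤ f) (hfb : f < 2 ^ (B + 1) - 1) (hbf : (B + 1) * f < κ * w)
    (hlen : (bucketKeys f t l (2 ^ (X - B))).length < 2 ^ (κ * w))
    (hz : ρ 32 = z) (hzX : z < 2 ^ X)
    (hR : R (z / 2 ^ (B)) + countAt (B) l z < 2 ^ (κ * w)) :
    Reach mem (8 * κ * w) (queryCode κ) ρ (queryTime κ n t) fun ρ' => Bdd κ w ρ' ∧
      ρ' 37 = R (z / 2 ^ (B)) + countAt (B) l z ∧ ∀ y, y < 33 ∨ 53 < y → ρ' y = ρ y := by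
  have hβ : 32 < 2 ^ (κ * w) := L.machine.thirtytwo_lt
  have hVlt := getD_lt_of_forall (by omega) L.lt
  obtain ⟨h, hh⟩ : ∃ h, h = z / 2 ^ B := ⟨_, rfl⟩
  have hm : h < 2 ^ (X - B) := by
    rw [hh, Nat.div_lt_iff_lt_mul (by positivity), ← pow_add, Nat.sub_add_cancel hX]
    exact hzX
  have hg : 0 < f ^ t := by positivity
  have hlen3 : ∀ c < 3, 3 * h + c < (bucketTable f t R l (2 ^ (X - B))).length := fun c hc => by
    rw [length_bucketTable]; omega
  have hzl : z % 2 ^ B < 2 ^ B := Nat.mod_lt _ (by positivity)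
  have hget : ∀ c < 3, V.getD (ρ 19 + (3 * h + c)) 0 =
      [R h, (l h).length, (bucketKeys f t l h).length].getD c 0 := fun c hc3 => by
    rw [hc.c19.getD (hlen3 c hc3), getD_bucketTable hm hc3]
  have hget0 := hget 0 (by norm_num)
  have hget1 := hget 1 (by norm_num)
  have hget2 := hget 2 (by norm_num)
  have hlt19 : ∀ c < 3, ρ 19 + (3 * h + c) < V.length := fun c hc3 => by
    exact hc.c19.lt (hlen3 c hc3)
  have hR0 := hVlt (ρ 19 + (3 * h + 0))
  have hR1 := hVlt (ρ 19 + (3 * h + 1))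
  have hR2 := hVlt (ρ 19 + (3 * h + 2))
  rw [hget0] at hR0
  rw [hget1] at hR1
  rw [hget2] at hR2
  simp only [List.getD_cons_zero, List.getD_cons_succ] at hget0 hget1 hget2 hR0 hR1 hR2
  have c5 := hc.tree.c5
  have c22 := hc.c22
  set ρ₁ := Function.update (Function.update (Function.update (Function.update (Function.update
    (Function.update ρ 34 (z % 2 ^ B)) 33 (R h)) 35 (l h).length) 36 (bucketKeys f t l h).length)
    37 1) 38 (f ^ t) with hρ₁
  have b₁ := hρ.update (x := 34) (v := z % 2 ^ B) ((Nat.mod_le _ _).trans_lt (hz ▸ hρ 32))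
  have b₂ := b₁.update (x := 33) hR0
  have b₃ := b₂.update (x := 35) hR1
  have b₄ := b₃.update (x := 36) hR2
  have b₅ := b₄.update (x := 37) (v := 1) (by omega)
  have b₆ : Bdd κ w ρ₁ := b₅.update (x := 38) (hc.c8 ▸ hρ 8)
  have step₁ : Runs mem (8 * κ * w) (queryStart κ) ρ fun ρ' => ρ' = ρ₁ := by
    refine Runs.seq (L.assign (z % 2 ^ B) (by decide) rfl (by decide) hρ (by simp)
      (by simp [hz, c22]) rfl) ?_
    rintro _ rfl
    refine Runs.seq (L.wide (ρ 19 + (3 * h + 0)) (by decide) rfl (by decide) b₁ (by simp)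
      (by simp [hc.tree.c2]) (by simp [hc.tree.c3]) (by simp [hz, c5, hh])
      (hlt19 0 (by norm_num)) rfl) ?_
    rintro _ rfl
    rw [hget0]
    refine Runs.seq (L.wide (ρ 19 + (3 * h + 1)) (by decide) rfl (by decide) b₂ (by simp)
      (by simp [hc.tree.c2]) (by simp [hc.tree.c3]) (by simp [hz, c5, hh])
      (hlt19 1 (by norm_num)) rfl) ?_
    rintro _ rfl
    rw [hget1]
    refine Runs.seq (L.wide (ρ 19 + (3 * h + 2)) (by decide) rfl (by decide) b₃ (by simp)
      (by simp [hc.tree.c2]) (by simp [hc.tree.c3]) (by simp [hz, c5, hh])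
      (hlt19 2 (by norm_num)) rfl) ?_
    rintro _ rfl
    rw [hget2]
    refine Runs.seq (L.assign 1 (by decide) rfl (by decide) b₄ (by simp) (by simp) rfl) ?_
    rintro _ rfl
    exact L.assign (f ^ t) (by decide) rfl (by decide) b₅ (by simp) (by simp [hc.c8]) rfl
  have hc₁ : QueryConsts κ w V T f t R l X B d D θ A s ρ₁ := hc.congr fun y hy => by
    have hy' : ∀ c, 32 ≤ c → y ≠ c := fun c _ => by omega
    simp [hρ₁, hy']
  refine Reach.seq step₁ ?_
  rintro _ rfl
  have hcnt_le : countAt B l z ≤ (l h).length := hh ▸ countAt_le z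
  refine Reach.seq (R := fun ρ' => Bdd κ w ρ' ∧ ρ' 37 = (countAt B l z + f ^ t - 1) / f ^ t ∧
    ∀ y, y < 37 ∨ (37 < y ∧ y < 43) ∨ 53 < y → ρ' y = ρ₁ y)
    (Reach.ite ⟨by decide, by decide⟩ (fun ht => ?_) fun ht => ?_) ?_
  · have hlt : f ^ t < (l h).length := by
      simpa [Test.On, hc₁.c8, hρ₁, hc.c8] using ht
    refine L.trie (z := z) hV b₆ hc₁.trie hT (hB ▸ hX) hXβ hD hDn (by simp [hρ₁, hz]) hzX
      (hl.internal_root hB hX hg (hh ▸ hm) (hh ▸ hlt)) ?_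
    exact (ceil_div_le_self hg).trans_lt (by omega)
  · have hle : (l h).length ≤ f ^ t := by
      simpa [Test.On, hc₁.c8, hρ₁, hc.c8] using ht
    refine Reach.mono (Reach.skip ⟨b₆, ?_, fun _ _ => rfl⟩) (by omega) fun _ h => h
    have hpos := hl.countAt_pos z
    -- A bucket of at most `f ^ t` elements needs no trie: its count is between 1 and `f ^ t`, and
    -- variable `37` was set to 1 beforehand.
    have : (countAt B l z + f ^ t - 1) / f ^ t = 1 := by
      rw [Nat.div_eq_iff hg]; omega
    simp [hρ₁, this]
  rintro ρ₂ ⟨k₁, k₂, k₃⟩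
  have hc₂ : QueryConsts κ w V T f t R l X B d D θ A s ρ₂ := hc₁.congr fun y hy => k₃ y (by omega)
  obtain ⟨rest, hrest⟩ := drop_bucketKeys (f := f) (t := t) (l := l) hm
  refine Reach.seq (L.descent (z := z % 2 ^ B) (cnt := countAt B l z) (l := l h) k₁ hc₂.tree hl.keys_lt
    hf hfb hbf hlen (by simp [k₃ 34, hρ₁]) hzl (by simp [k₃ 35, hρ₁]) (by simp [k₃ 36, hρ₁]) k₂
    (by simp [k₃ 38, hρ₁]) ?_ hcnt_le (hl.countAt_pos z) hrest) ?_
  · rw [countAt, ← hh]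
    exact getD_le_iff_lt_countP (hl.sorted h) _
  rintro ρ₃ ⟨m₁, m₂, m₃⟩
  have e33 : ρ₃ 33 = R h := by simp [m₃ 33, k₃ 33, hρ₁]
  refine L.assign (R h + countAt B l z) (by decide) rfl (by decide) m₁ (by simp)
    (by simp [e33, m₂]) ⟨m₁.update (by rw [hh]; exact hR), by simp [hh], fun y hy => ?_⟩
  have hy' : ∀ c, 33 ≤ c → c ≤ 53 → y ≠ c := fun c _ _ => by omega
  rw [Function.update_of_ne (hy' 37 (by norm_num) (by norm_num)), m₃ y (by omega), k₃ y (by omega)]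
  simp [hρ₁, hy']

end

/-! ### Distribution of keys to buckets -/

section
variable {n : ℕ} (B : ℕ) (key : Fin n → ℕ)

/-- The number of keys up to `z`. -/
def keyRank (z : ℕ) : ℕ := (Finset.univ.filter fun j => key j ≤ z).card

/-- The low parts of the keys in bucket number `h`, in increasing order, preceded by zero. -/
def bucketList (h : ℕ) : List ℕ :=
  0 :: ((Finset.univ.filter fun j => key j / 2 ^ B = h).image fun j => key j % 2 ^ B).sort (· ≤ ·)

/-- The number of keys in the buckets before bucket number `h`. -/
def keysBefore (h : ℕ) : ℕ := (Finset.univ.filter fun j => key j / 2 ^ B < h).card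

variable {B key}

theorem buckets_bucketList : Buckets B (bucketList B key) := by
  refine ⟨fun h => ?_, fun h => ⟨_, rfl⟩, fun h y hy => ?_⟩
  · rw [bucketList, List.pairwise_cons]
    exact ⟨fun _ _ => Nat.zero_le _, Finset.pairwise_sort _ _⟩
  · rcases List.mem_cons.1 hy with rfl | hy
    · positivity
    · simp only [Finset.mem_sort, Finset.mem_image] at hy
      obtain ⟨j, -, rfl⟩ := hy
      exact Nat.mod_lt _ (by positivity)

/-- Within one bucket the low part determines the key, so passing to a set of low parts loses no
key. -/
theorem card_image_low (hkey : Function.Injective key) (h : ℕ) (p : ℕ → Prop) [DecidablePred p] :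
    (((Finset.univ.filter fun j => key j / 2 ^ B = h).image fun j => key j % 2 ^ B).filter p).card =
      (Finset.univ.filter fun j => key j / 2 ^ B = h ∧ p (key j % 2 ^ B)).card := by
  rw [Finset.filter_image, Finset.filter_filter, Finset.card_image_of_injOn]
  intro i hi j hj hij
  simp only [Finset.coe_filter, Finset.mem_univ, true_and, Set.mem_ofPred_eq] at hi hj
  apply hkey
  rw [← Nat.div_add_mod (key i) (2 ^ B), ← Nat.div_add_mod (key j) (2 ^ B), hi.1, hj.1]
  simp only at hij
  rw [hij]

theorem countP_sort (s : Finset ℕ) (z : ℕ) :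
    (s.sort (· ≤ ·)).countP (· ≤ z) = (s.filter (· ≤ z)).card := by
  rw [← Multiset.coe_countP, Finset.sort_eq, Multiset.countP_eq_card_filter]
  rfl

theorem length_bucketList (hkey : Function.Injective key) (h : ℕ) :
    (bucketList B key h).length = 1 + (Finset.univ.filter fun j => key j / 2 ^ B = h).card := by
  have := card_image_low (B := B) hkey h fun _ => True
  simp only [Finset.filter_true, and_true] at this
  rw [bucketList, List.length_cons, Finset.length_sort, this, add_comm]

/-- Keys are compared lexicographically by bucket and low part. The extra 1 is the zero at the head
of the bucket; it cancels when two ranks are subtracted. -/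
theorem keysBefore_add_countAt (hkey : Function.Injective key) (z : ℕ) :
    keysBefore B key (z / 2 ^ B) + countAt B (bucketList B key) z = 1 + keyRank key z := by
  have hiff : ∀ x, x ≤ z ↔ x / 2 ^ B < z / 2 ^ B ∨ x / 2 ^ B = z / 2 ^ B ∧ x % 2 ^ B ≤ z % 2 ^ B := by
    intro x
    have e₁ := Nat.div_add_mod x (2 ^ B)
    have e₂ := Nat.div_add_mod z (2 ^ B)
    have l₁ : x % 2 ^ B < 2 ^ B := Nat.mod_lt _ (by positivity)
    have l₂ : z % 2 ^ B < 2 ^ B := Nat.mod_lt _ (by positivity)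
    constructor
    · intro h
      rcases (Nat.div_le_div_right (c := 2 ^ B) h).lt_or_eq with h' | h'
      · exact Or.inl h'
      · rw [h'] at e₁
        exact Or.inr ⟨h', by omega⟩
    · rintro (h | ⟨h, h'⟩)
      · by_contra! hlt
        have := Nat.div_le_div_right (c := 2 ^ B) hlt.le
        omega
      · rw [h] at e₁
        omega
  rw [countAt, bucketList, List.countP_cons_of_pos (by simp), countP_sort, card_image_low hkey,
    keysBefore, keyRank]
  simp only [hiff]
  rw [Finset.filter_or, Finset.card_union_of_disjoint]
  · omega
  · rw [Finset.disjoint_filter]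
    intro j _ h₁ h₂
    omega

theorem keyRank_le (z : ℕ) : keyRank key z ≤ n := by
  simpa [keyRank] using Finset.card_filter_le (Finset.univ : Finset (Fin n)) fun j => key j ≤ z

theorem keysBefore_le (h : ℕ) : keysBefore B key h ≤ n := by
  simpa [keysBefore] using
    Finset.card_filter_le (Finset.univ : Finset (Fin n)) fun j => key j / 2 ^ B < h

theorem length_bucketList_le (hkey : Function.Injective key) (h : ℕ) :
    (bucketList B key h).length ≤ 1 + n := by
  rw [length_bucketList hkey]
  simpa using Finset.card_filter_le (Finset.univ : Finset (Fin n)) fun j => key j / 2 ^ B = h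

theorem sum_length_bucketList_le (hkey : Function.Injective key) (m : ℕ) :
    ∑ h ∈ Finset.range m, ((bucketList B key h).length - 1) ≤ n := by
  have : ∀ h ∈ Finset.range m, (bucketList B key h).length - 1 =
      (Finset.univ.filter fun j => key j / 2 ^ B = h).card := fun h _ => by
    rw [length_bucketList hkey]; omega
  rw [Finset.sum_congr rfl this, ← Finset.card_biUnion]
  · exact (Finset.card_le_univ _).trans (by simp)
  · intro i _ j _ hij
    rw [Function.onFun, Finset.disjoint_filter]
    omega

end

/-- A geometric series with ratio at most one half, plus one element per level for rounding up. -/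
theorem length_treeLevels_le {f : ℕ} (hf : 2 ≤ f) (l : List ℕ) (t : ℕ) :
    (treeLevels f l t).length ≤ 2 * l.length + t := by
  have h : (treeLevels f l t).length ≤ (∑ i ∈ Finset.range t, l.length / 2 ^ i) + t := by
    induction t with
    | zero => simp [treeLevels]
    | succ t ih =>
      have hp : 0 < f ^ t := by positivity
      have h₁ : (l.length + f ^ t - 1) / f ^ t ≤ l.length / 2 ^ t + 1 := by
        calc (l.length + f ^ t - 1) / f ^ t ≤ (l.length + f ^ t) / f ^ t :=
              Nat.div_le_div_right (by omega)
          _ = l.length / f ^ t + 1 := Nat.add_div_right _ hp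
          _ ≤ _ := by
              gcongr
      rw [Finset.sum_range_succ, treeLevels, List.length_append]
      simp only [every, List.length_map, List.length_range]
      omega
  have := Nat.geom_sum_le (b := 2) le_rfl l.length t
  omega

theorem length_bucketKeys_le {n f B t m : ℕ} {key : Fin n → ℕ} (hf : 2 ≤ f)
    (hkey : Function.Injective key) :
    (bucketKeys f t (bucketList B key) m).length ≤ 2 * n + (2 + t) * m := by
  rw [bucketKeys, length_flat]
  calc _ ≤ ∑ h ∈ Finset.range m, (2 * ((bucketList B key h).length - 1) + (2 + t)) := by
        refine Finset.sum_le_sum fun h _ => (length_treeLevels_le hf _ t).trans ?_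
        omega
    _ ≤ _ := by
        rw [Finset.sum_add_distrib, ← Finset.mul_sum]
        have := sum_length_bucketList_le (B := B) hkey m
        simp only [Finset.sum_const, Finset.card_range, smul_eq_mul]
        nlinarith

/-! ### Ranks in strings as ranks of keys -/

/-- The key of a position: the symbol, followed by the position. -/
def symbolKey {n : ℕ} (ν : ℕ) (S : Fin n → ℕ) (j : Fin n) : ℕ := S j * 2 ^ ν + (j + 1)

section
variable {n ν : ℕ} {S : Fin n → ℕ}

theorem symbolKey_injective (hν : n < 2 ^ ν) : Function.Injective (symbolKey ν S) := by
  intro i j h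
  have h₁ : (symbolKey ν S i) % 2 ^ ν = (symbolKey ν S j) % 2 ^ ν := by rw [h]
  rw [symbolKey, symbolKey, mul_comm, Nat.mul_add_mod, mul_comm, Nat.mul_add_mod,
    Nat.mod_eq_of_lt (by omega), Nat.mod_eq_of_lt (by omega)] at h₁
  omega

/-- The keys above `a * 2 ^ ν` and up to `a * 2 ^ ν + i` are the occurrences of `a` at the first `i`
positions. Positions are counted from 1 in the keys, so `a * 2 ^ ν` precedes every key of `a`. -/
theorem keyRank_sub_keyRank (hν : n < 2 ^ ν) {a i : ℕ} (hi : i ≤ n) :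
    keyRank (symbolKey ν S) (a * 2 ^ ν + i) - keyRank (symbolKey ν S) (a * 2 ^ ν) =
      stringRank S a i := by
  have hsub : (Finset.univ.filter fun j => symbolKey ν S j ≤ a * 2 ^ ν) ⊆
      Finset.univ.filter fun j => symbolKey ν S j ≤ a * 2 ^ ν + i := by
    intro j hj
    simp only [Finset.mem_filter, Finset.mem_univ, true_and] at hj ⊢
    omega
  rw [keyRank, keyRank, ← Finset.card_sdiff_of_subset hsub, stringRank]
  congr 1
  ext j
  simp only [Finset.mem_sdiff, Finset.mem_filter, Finset.mem_univ, true_and, not_le]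
  rw [symbolKey]
  have hj := j.isLt
  constructor
  · rintro ⟨h₁, h₂⟩
    have h₃ : S j = a := by
      rcases lt_trichotomy (S j) a with h | h | h
      · have : (S j + 1) * 2 ^ ν ≤ a * 2 ^ ν := Nat.mul_le_mul_right _ h
        nlinarith
      · exact h
      · have : (a + 1) * 2 ^ ν ≤ S j * 2 ^ ν := Nat.mul_le_mul_right _ h
        nlinarith
    rw [h₃] at h₁
    exact ⟨by omega, h₃⟩
  · rintro ⟨h₁, h₂⟩
    rw [h₂]
    omega

end

/-! ### The program for large alphabets -/

/-- The rank of the symbol in variable `0` at the position in variable `1`, as a difference of two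
ranks of keys. -/
def largeCode (κ : ℕ) : Cmd :=
  .seq (assign 32 ((♯0 <<< ♯15) + ♯1)) <|
  .seq (queryCode κ) <|
  .seq (.seq (assign 54 ♯37) (assign 32 (♯0 <<< ♯15))) <|
  .seq (queryCode κ) <|
  assign 0 (♯54 - ♯37)

/-- The number of steps of `largeCode`. -/
def largeTime (κ n t : ℕ) : ℕ :=
  (assign 32 ((♯0 <<< ♯15) + ♯1)).time + (queryTime κ n t +
    ((Cmd.seq (assign 54 ♯37) (assign 32 (♯0 <<< ♯15))).time + (queryTime κ n t +
      (assign 0 (♯54 - ♯37)).time)))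

section
variable {κ w : ℕ} {V : List ℕ} {mem : List (BitVec w)} {ρ : ℕ → ℕ}

theorem Loaded.large {T : List ℕ} {N f t X B d D θ A s n ν a i : ℕ} {key : Fin N → ℕ}
    (L : Loaded κ w V (pack (B + 1) (bucketKeys f t (bucketList B key) (2 ^ (X - B)))) mem)
    (hV : V.length < 2 ^ (κ * w)) (hρ : Bdd κ w ρ)
    (hc : QueryConsts κ w V T f t (keysBefore B key) (bucketList B key) X B d D θ A s ρ)
    (hkey : Function.Injective key)
    (hT : TrieDict T X d D θ A s (samples B (f ^ t) (bucketList B key) (2 ^ (X - B)))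
      fun z => (countAt B (bucketList B key) z + f ^ t - 1) / f ^ t)
    (hB : B = d * D) (hX : B ≤ X) (hXβ : 2 ^ (X + 1) ≤ 2 ^ (κ * w)) (hD : 0 < D) (hDn : D ≤ 2 ^ n)
    (hf : 2 ≤ f) (hfb : f < 2 ^ (B + 1) - 1) (hbf : (B + 1) * f < κ * w)
    (hlen : (bucketKeys f t (bucketList B key) (2 ^ (X - B))).length < 2 ^ (κ * w))
    (hN : 1 + N < 2 ^ (κ * w)) (h0 : ρ 0 = a) (h1 : ρ 1 = i) (h15 : ρ 15 = ν)
    (hz : a * 2 ^ ν + i < 2 ^ X) :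
    Reach mem (8 * κ * w) (largeCode κ) ρ (largeTime κ n t) fun ρ' =>
      ρ' 0 = keyRank key (a * 2 ^ ν + i) - keyRank key (a * 2 ^ ν) := by
  have hXβ' : 2 ^ X < 2 ^ (κ * w) :=
    lt_of_lt_of_le (Nat.pow_lt_pow_right (by norm_num) (by omega)) hXβ
  have hR : ∀ z, keysBefore B key (z / 2 ^ B) + countAt B (bucketList B key) z < 2 ^ (κ * w) :=
    fun z => by
      have := keyRank_le (key := key) z
      rw [keysBefore_add_countAt hkey]
      omega
  refine Reach.seq (L.assign (a * 2 ^ ν + i) (by decide) rfl (by decide) hρ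
    (by simp [h0, h15]; omega) (by simp [h0, h1, h15]) rfl) ?_
  rintro _ rfl
  have b₁ := hρ.update (x := 32) (hz.trans hXβ')
  refine Reach.seq (L.query (z := a * 2 ^ ν + i) (n := n) hV b₁ (hc.congr fun y hy => by
    rw [Function.update_of_ne (by omega)]) buckets_bucketList hT hB hX hXβ hD hDn hf hfb hbf hlen
    (by simp) hz (hR _)) ?_
  rintro ρ₁ ⟨k₁, k₂, k₃⟩
  rw [keysBefore_add_countAt hkey] at k₂
  have hkl := keyRank_le (key := key) (a * 2 ^ ν + i)
  have e0 : ρ₁ 0 = a := by simp [k₃ 0, h0]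
  have e15 : ρ₁ 15 = ν := by simp [k₃ 15, h15]
  have b₂ := k₁.update (x := 54) (v := 1 + keyRank key (a * 2 ^ ν + i)) (by omega)
  have b₃ := b₂.update (x := 32) (v := a * 2 ^ ν) (by omega)
  refine Reach.seq (R := fun ρ' => ρ' = Function.update (Function.update ρ₁ 54
    (1 + keyRank key (a * 2 ^ ν + i))) 32 (a * 2 ^ ν)) (Reach.seq (L.assign _ (by decide) rfl
      (by decide) k₁ (by simp) (by simp [k₂]; rfl) rfl) ?_) ?_
  · rintro _ rfl
    refine L.assign (a * 2 ^ ν) (by decide) rfl (by decide) b₂ (by simp [e0, e15]; omega)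
      (by simp [e0, e15]) rfl
  rintro _ rfl
  refine Reach.seq (L.query (z := a * 2 ^ ν) (n := n) hV b₃ (hc.congr fun y hy => by
    rw [Function.update_of_ne (by omega), Function.update_of_ne (by omega), k₃ y (by omega),
      Function.update_of_ne (by omega)]) buckets_bucketList hT hB hX hXβ hD hDn hf hfb hbf hlen
    (by simp) (by omega) (hR _)) ?_
  rintro ρ₂ ⟨m₁, m₂, m₃⟩
  rw [keysBefore_add_countAt hkey] at m₂
  have e54 : ρ₂ 54 = 1 + keyRank key (a * 2 ^ ν + i) := by simp [m₃ 54]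
  have hle : keyRank key (a * 2 ^ ν) ≤ keyRank key (a * 2 ^ ν + i) := by
    refine Finset.card_le_card fun j hj => ?_
    simp only [Finset.mem_filter, Finset.mem_univ, true_and] at hj ⊢
    omega
  refine L.assign (keyRank key (a * 2 ^ ν + i) - keyRank key (a * 2 ^ ν)) (by decide) rfl
    (by decide) m₁ (by simp [e54, m₂, hle]) (by simp [e54, m₂]; omega) (by simp)

/-! ### The program for small alphabets -/

/-- The number of fields up to the value of `z` among the first ones of variable `41`, as many as
variable `33` says. -/
def narrowCountEx (z : Ex) : Ex :=
  ((((z * ♯9 + ♯10 - ♯41) &&& ♯10) >>> ♯5) % (♭1 <<< (♯6 * ♯33)) * ♯14 &&& ♯15) % ♯11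

/-- The number before the superblock, the number before the block in the superblock, and the number
in the block. -/
def smallCode (κ : ℕ) : Cmd :=
  .seq (assign 32 (♯1 / ♯7)) <|
  .seq (assign 33 (♯1 % ♯7)) <|
  .seq (assign 34 (♯1 / ♯13)) <|
  .seq (.ite (.lt 63 34) (assign 35 (wideEx κ (♯19 + ((♯34 - ♭1) * ♯16 + ♯0)))) (assign 35 ♭0)) <|
  .seq (assign 36 (readEx κ (♯21 + ♯12 * (♯32 * ♯16 + ♯0)) ♯12)) <|
  .seq (assign 41 (readEx κ (♯22 + ♯6 * (♯32 * ♯7)) (♯6 * ♯7))) <|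
  .seq (assign 37 (narrowCountEx ♯0)) <|
  .seq (assign 38 (narrowCountEx (♯0 - ♭1))) <|
  assign 0 (♯35 + ♯36 + (♯37 - ♯38))

/-- The constants of the program for small alphabets: symbols of `u` bits, blocks of `r` symbols,
superblocks of `r₂` symbols, counters of `c` bits. -/
structure SmallConsts (κ w : ℕ) (V T : List ℕ) (C : List ℕ) (u r r₂ c : ℕ) (ρ : ℕ → ℕ) : Prop where
  c2 : ρ 2 = w
  c3 : ρ 3 = κ * w
  c5 : ρ 5 = u
  c6 : ρ 6 = u + 1
  c7 : ρ 7 = r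
  c9 : ρ 9 = pack (u + 1) (List.replicate r 1)
  c10 : ρ 10 = 2 ^ u * pack (u + 1) (List.replicate r 1)
  c11 : ρ 11 = 2 ^ ((u + 1) * r + (u + 1)) - 1
  c12 : ρ 12 = c
  c13 : ρ 13 = r₂
  c14 : ρ 14 = pack ((u + 1) * r) (List.replicate r 1)
  c15 : ρ 15 = pack ((u + 1) * r) ((List.range r).map fun i => 2 ^ ((u + 1) * i))
  c16 : ρ 16 = 2 ^ u
  c19 : SubtableAt V (ρ 19) T
  c21 : ρ 21 = w + κ * w * V.length
  c22 : ρ 22 = w + κ * w * V.length + c * C.length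
  c63 : ρ 63 = 0

theorem Loaded.small {T C S : List ℕ} {u r r₂ c a i : ℕ}
    (L : Loaded κ w V (pack c C + 2 ^ (c * C.length) * pack (u + 1) S) mem) (hρ : Bdd κ w ρ)
    (hc : SmallConsts κ w V T C u r r₂ c ρ) (hC : ∀ x ∈ C, x < 2 ^ c) (hS : ∀ x ∈ S, x < 2 ^ u)
    (hr : 0 < r) (hur : (u + 1) * r < κ * w) (hcw : c < κ * w)
    (h0 : ρ 0 = a) (h1 : ρ 1 = i) (ha : 0 < a) (hau : a < 2 ^ u) (hi : i ≤ S.length)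
    (hq : i / r * 2 ^ u + a < C.length) (hsb : 0 < i / r₂ → (i / r₂ - 1) * 2 ^ u + a < T.length) :
    Runs mem (8 * κ * w) (smallCode κ) ρ fun ρ' => ρ' 0 =
      (if 0 < i / r₂ then T.getD ((i / r₂ - 1) * 2 ^ u + a) 0 else 0) +
      C.getD (i / r * 2 ^ u + a) 0 + ((((S.drop (i / r * r)).take (i % r)).countP (· ≤ a)) -
        (((S.drop (i / r * r)).take (i % r)).countP (· ≤ a - 1))) := by
  have hβ : 32 < 2 ^ (κ * w) := L.machine.thirtytwo_lt
  have hVlt := getD_lt_of_forall (by omega) L.lt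
  have hiβ : i < 2 ^ (κ * w) := h1 ▸ hρ 1
  have hq' : i / r < 2 ^ (κ * w) := (Nat.div_le_self _ _).trans_lt hiβ
  have hv' : i % r < 2 ^ (κ * w) := (Nat.mod_le _ _).trans_lt hiβ
  have hs' : i / r₂ < 2 ^ (κ * w) := (Nat.div_le_self _ _).trans_lt hiβ
  have b₁ := hρ.update (x := 32) hq'
  have b₂ := b₁.update (x := 33) hv'
  have b₃ := b₂.update (x := 34) hs'
  refine Runs.seq (L.assign (i / r) (by decide) rfl (by decide) hρ (by simp)
    (by simp [h1, hc.c7]) rfl) ?_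
  rintro _ rfl
  refine Runs.seq (L.assign (i % r) (by decide) rfl (by decide) b₁ (by simp)
    (by simp [h1, hc.c7]) rfl) ?_
  rintro _ rfl
  refine Runs.seq (L.assign (i / r₂) (by decide) rfl (by decide) b₂ (by simp)
    (by simp [h1, hc.c13]) rfl) ?_
  rintro _ rfl
  obtain ⟨abs, habs⟩ : ∃ abs, abs = if 0 < i / r₂ then T.getD ((i / r₂ - 1) * 2 ^ u + a) 0 else 0 :=
    ⟨_, rfl⟩
  have habsβ : abs < 2 ^ (κ * w) := by
    rw [habs]
    split_ifs with h
    · rw [← hc.c19.getD (hsb h)]; exact hVlt _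
    · positivity
  rw [← habs]
  refine Runs.seq (R := fun ρ' => ρ' = Function.update (Function.update (Function.update
    (Function.update ρ 32 (i / r)) 33 (i % r)) 34 (i / r₂)) 35 abs)
    (Runs.ite ⟨by decide, by decide⟩ (fun ht => ?_) fun ht => ?_) ?_
  · have hpos : 0 < i / r₂ := by simpa [Test.On, hc.c63] using ht
    refine L.wide (ρ 19 + ((i / r₂ - 1) * 2 ^ u + a)) (by decide) rfl (by decide) b₃
      (by simp; omega) (by simp [hc.c2]) (by simp [hc.c3]) (by simp [hc.c16, h0])
      (hc.c19.lt (hsb hpos)) ?_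
    rw [hc.c19.getD (hsb hpos), habs, if_pos hpos]
  · have hpos : ¬ 0 < i / r₂ := by simpa [Test.On, hc.c63] using ht
    refine L.assign 0 (by decide) rfl (by decide) b₃ (by simp) (by simp) ?_
    rw [habs, if_neg hpos]
  rintro _ rfl
  have b₄ := b₃.update (x := 35) habsβ
  have hrel : bits (pack c C + 2 ^ (c * C.length) * pack (u + 1) S) (c * (i / r * 2 ^ u + a)) c =
      C.getD (i / r * 2 ^ u + a) 0 := by
    rw [bits_append_left, bits_pack_one hC]
    calc _ = c * (i / r * 2 ^ u + a + 1) := by ring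
      _ ≤ _ := Nat.mul_le_mul_left _ hq
  refine Runs.seq (L.narrow (c * (i / r * 2 ^ u + a)) (by decide) rfl (by decide) rfl (by decide) b₄
    (by simp) (by simp) (by simp [hc.c2]) (by simp [hc.c12, hcw.le])
    (by simp [hc.c21, hc.c12, hc.c16, h0]) rfl) ?_
  rintro _ rfl
  have e12 : (♯12).val 0 0 (Function.update (Function.update (Function.update
    (Function.update ρ 32 (i / r)) 33 (i % r)) 34 (i / r₂)) 35 abs) = c := by simp [hc.c12]
  rw [e12, hrel]
  obtain ⟨rel, hreldef⟩ : ∃ rel, rel = C.getD (i / r * 2 ^ u + a) 0 := ⟨_, rfl⟩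
  have hrelβ : rel < 2 ^ (κ * w) := hreldef ▸ (getD_lt_of_forall (by positivity) hC _).trans
    (Nat.pow_lt_pow_right (by norm_num) hcw)
  rw [← hreldef]
  have b₅ := b₄.update (x := 36) hrelβ
  have hS' : ∀ y ∈ S, y < 2 ^ (u + 1) := fun y hy => (hS y hy).trans
    (Nat.pow_lt_pow_right (by norm_num) (by omega))
  obtain ⟨Yl, hYl⟩ : ∃ Yl, Yl = (S.drop (i / r * r)).take r := ⟨_, rfl⟩
  have hY : bits (pack c C + 2 ^ (c * C.length) * pack (u + 1) S)
      (c * C.length + (u + 1) * (i / r * r)) ((u + 1) * r) = pack (u + 1) Yl := by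
    rw [bits_append_right (pack_lt hC), bits_pack hS', hYl]
  refine Runs.seq (L.narrow (c * C.length + (u + 1) * (i / r * r)) (by decide) rfl (by decide) rfl
    (by decide) b₅ (by simp) (by simp) (by simp [hc.c2]) (by simp [hc.c6, hc.c7, hur.le])
    (by simp [hc.c22, hc.c6, hc.c7, add_assoc]) rfl) ?_
  rintro _ rfl
  have hval : (♯6 * ♯7).val 0 0 (Function.update (Function.update (Function.update (Function.update
    (Function.update ρ 32 (i / r)) 33 (i % r)) 34 (i / r₂)) 35 abs) 36 rel) = (u + 1) * r := by
    simp [hc.c6, hc.c7]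
  rw [hval, hY]
  have hYb : pack (u + 1) Yl < 2 ^ (κ * w) := by
    rw [← hY]
    exact (bits_lt _ _ _).trans (Nat.pow_lt_pow_right (by norm_num) hur)
  have b₆ := b₅.update (x := 41) hYb
  have hvr : i % r < r := Nat.mod_lt _ hr
  have hYlt : ∀ y ∈ Yl, y < 2 ^ u := fun y hy => hS y (by
    rw [hYl] at hy; exact List.mem_of_mem_drop (List.mem_of_mem_take hy))
  have hYf : Yl.length ≤ r := by simp [hYl]
  have hYv : i % r ≤ Yl.length := by
    have := Nat.div_add_mod i r
    rw [mul_comm] at this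
    simp only [hYl, List.length_take, List.length_drop]
    omega
  have hb : r < 2 ^ ((u + 1) * r + (u + 1)) - 1 := by
    have h₁ : (u + 1) * r + (u + 1) < 2 ^ ((u + 1) * r + (u + 1)) := Nat.lt_two_pow_self
    have h₂ : r ≤ (u + 1) * r := Nat.le_mul_of_pos_left _ (by omega)
    omega
  have htake : Yl.take (i % r) = (S.drop (i / r * r)).take (i % r) := by
    rw [hYl, List.take_take, min_eq_left hvr.le]
  have hcount : ∀ z < 2 ^ u, _ := fun z hz => count_le_narrow_fields hYlt hz hYf hYv hb
  have hYle : ∀ z, pack (u + 1) Yl ≤ z * pack (u + 1) (List.replicate r 1) +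
      2 ^ u * pack (u + 1) (List.replicate r 1) := fun z => by
    have := pack_le_mul_replicate (b := u + 1) (fun y hy => (hYlt y hy).le) hYf
    omega
  have hshl : 2 ^ ((u + 1) * (i % r)) < 2 ^ (κ * w) := Nat.pow_lt_pow_right (by norm_num)
    ((Nat.mul_le_mul_left _ hvr.le).trans_lt hur)
  obtain ⟨c₁, hc₁⟩ : ∃ c₁, c₁ = (Yl.take (i % r)).countP (· ≤ a) := ⟨_, rfl⟩
  obtain ⟨c₂, hc₂⟩ : ∃ c₂, c₂ = (Yl.take (i % r)).countP (· ≤ a - 1) := ⟨_, rfl⟩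
  have hc₁β : c₁ < 2 ^ (κ * w) := by
    rw [hc₁]; exact List.countP_le_length.trans_lt (by simp; omega)
  have hc₂β : c₂ < 2 ^ (κ * w) := by
    rw [hc₂]; exact List.countP_le_length.trans_lt (by simp; omega)
  have hle : c₂ ≤ c₁ := by
    rw [hc₁, hc₂]
    refine List.countP_mono_left fun x _ hx => ?_
    simp only [decide_eq_true_eq] at hx ⊢
    omega
  refine Runs.seq (L.assign c₁ (by decide) rfl (by decide) b₆ ?_ ?_ rfl) ?_
  · simpa [narrowCountEx, h0, hc.c9, hc.c10, hc.c6] using ⟨hYle a, hshl⟩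
  · have := hcount a hau
    simpa [narrowCountEx, h0, hc.c9, hc.c10, hc.c6, hc.c5, hc.c14, hc.c15, hc.c11, hc₁] using this
  rintro _ rfl
  have b₇ := b₆.update (x := 37) hc₁β
  refine Runs.seq (L.assign c₂ (by decide) rfl (by decide) b₇ ?_ ?_ rfl) ?_
  · have h1a : 1 ≤ a := ha
    simpa [narrowCountEx, h0, hc.c9, hc.c10, hc.c6, h1a] using ⟨hYle (a - 1), hshl⟩
  · have := hcount (a - 1) (by omega)
    simpa [narrowCountEx, h0, hc.c9, hc.c10, hc.c6, hc.c5, hc.c14, hc.c15, hc.c11, hc₂] using this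
  rintro _ rfl
  have b₈ := b₇.update (x := 38) hc₂β
  refine L.assign (abs + rel + (c₁ - c₂)) (by decide) rfl (by decide) b₈ (by simpa using hle)
    (by simp) ?_
  rw [Function.update_self, hc₁, hc₂, htake]

end

/-! ### The program -/

/-- Load the first `m` wide words into the variables from `4` on. -/
def prologue (κ : ℕ) : ℕ → Cmd
  | 0 => .seq (assign 2 (.ld ♭0)) (assign 3 (♭κ * ♯2))
  | m + 1 => .seq (prologue κ m) (assign (4 + m) (wideEx κ ♭m))

/-- The program for rank queries: the first wide word tells which case applies. -/
def rankProgram (κ : ℕ) : Cmd :=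
  .seq (prologue κ 20) <|
  .ite (.eq 4 63) (assign 0 ♯1) <|
  .seq (assign 62 ♭1) <|
  .ite (.eq 4 62) (smallCode κ) (largeCode κ)

/-- The variables after the first `m` wide words have been loaded for a query with the arguments
`a` and `i`. -/
structure Started (κ w : ℕ) (V : List ℕ) (a i m : ℕ) (ρ : ℕ → ℕ) : Prop where
  bdd : Bdd κ w ρ
  v0 : ρ 0 = a
  v1 : ρ 1 = i
  v2 : ρ 2 = w
  v3 : ρ 3 = κ * w
  v63 : ρ 63 = 0
  header : ∀ j < m, ρ (4 + j) = V.getD j 0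

section
variable {κ w N : ℕ} {V : List ℕ} {mem : List (BitVec w)} {a i : ℕ} {Q : (ℕ → ℕ) → Prop}

theorem Loaded.prologue (L : Loaded κ w V N mem) (ha : a < 2 ^ (κ * w)) (hi : i < 2 ^ (κ * w))
    {m : ℕ} (hm : m ≤ 20) (hV : m ≤ V.length) :
    Runs mem (8 * κ * w) (prologue κ m) (fun x => if x = 0 then a else if x = 1 then i else 0)
      (Started κ w V a i m) := by
  have hβ := L.machine.thirtytwo_lt
  have hκ := L.machine.sixteen_le
  have hw := L.machine.two_le
  have hlt : κ * w < 2 ^ (κ * w) := Nat.lt_two_pow_self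
  induction m with
  | zero =>
    -- The program text does not know the cell length; it learns it from cell 0, where `w` fits
    -- because `w < 2 ^ w`.
    have hbits : bits (image κ w V N) 0 w = w := by
      rw [image, bits_append_left (by omega), bits, pow_zero, Nat.div_one,
        Nat.mod_eq_of_lt Nat.lt_two_pow_self]
    have hw' : w < 2 ^ (κ * w) := by nlinarith
    have hκ' : κ < 2 ^ (κ * w) := by nlinarith
    have hκW : ∀ x, x < 2 ^ (κ * w) → x < 2 ^ (8 * κ * w) := fun x hx =>
      hx.trans_le (Nat.pow_le_pow_right (by norm_num) (by nlinarith))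
    have hb : Bdd κ w (fun x => if x = 0 then a else if x = 1 then i else 0) := fun x => by
      dsimp only
      split_ifs <;> omega
    refine Runs.seq (R := fun ρ' => ρ' = Function.update
      (fun x => if x = 0 then a else if x = 1 then i else 0) 2 w) ?_ ?_
    · rw [Runs, time_assign]
      refine Reach.assign_exact L.machine.memIs L.machine.le_width (by decide) trivial
        (show 0 < 2 ^ _ by positivity) ?_
      simp [Ex.val, hbits]
    · rintro _ rfl
      rw [Runs, time_assign]
      refine Reach.assign_exact L.machine.memIs L.machine.le_width (by decide)
        ⟨trivial, show 2 < 64 by norm_num⟩ ⟨hκW _ hκ', trivial, ?_⟩ ?_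
      · simpa [Op.Exact] using hκW _ hlt
      · simp only [Ex.val_mul, Ex.val_lit, Ex.val_var, Function.update_self]
        exact ⟨(hb.update hw').update hlt, by simp, by simp, by simp, by simp, by simp,
          fun j hj => absurd hj (by omega)⟩
  | succ m ih =>
    refine Runs.seq (ih (by omega) (by omega)) fun ρ h => ?_
    refine L.wide m (show 4 + m < 64 by omega) (by simp [Ex.Small]; omega) (by simp [Ex.deg])
      h.bdd (by simp) h.v2 h.v3 (by simp) (by omega) ?_
    have hne : ∀ y, y < 4 + m ∨ 4 + m < y →
        Function.update ρ (4 + m) (V.getD m 0) y = ρ y := fun y hy =>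
      Function.update_of_ne (by omega) _ _
    refine ⟨h.bdd.update (getD_lt_of_forall (by positivity) L.lt _), ?_, ?_, ?_, ?_, ?_, ?_⟩
    · rw [hne _ (by omega), h.v0]
    · rw [hne _ (by omega), h.v1]
    · rw [hne _ (by omega), h.v2]
    · rw [hne _ (by omega), h.v3]
    · rw [hne _ (by omega), h.v63]
    · intro j hj
      rcases Nat.lt_succ_iff_lt_or_eq.1 hj with hj | rfl
      · rw [hne _ (by omega), h.header j hj]
      · rw [Function.update_self]

/-- The number of steps before the case distinction is complete. -/
def prologueTime (κ : ℕ) : ℕ := (prologue κ 20).time + (assign 62 ♭1).time + 2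

theorem Loaded.reach_trivial (L : Loaded κ w V N mem) (ha : a < 2 ^ (κ * w))
    (hi : i < 2 ^ (κ * w)) (hV : 20 ≤ V.length) (h : V.getD 0 0 = 0) :
    Reach mem (8 * κ * w) (rankProgram κ) (fun x => if x = 0 then a else if x = 1 then i else 0)
      (prologueTime κ + (RAM.assign 0 ♯1).time) fun ρ' => ρ' 0 = i := by
  refine Reach.mono (t₁ := (RAM.prologue κ 20).time + ((RAM.assign 0 ♯1).time + 1))
    (Reach.seq (L.prologue ha hi le_rfl hV) fun ρ hρ => ?_)
    (by simp only [prologueTime]; omega) fun _ h => h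
  have h4 : ρ 4 = 0 := (hρ.header 0 (by norm_num)).trans h
  refine Reach.ite ⟨by decide, by decide⟩ (fun _ => ?_) fun ht => absurd (by
    rw [Test.On, h4, hρ.v63]) ht
  exact L.assign i (by decide) rfl (by decide) hρ.bdd (by simp) (by simp [hρ.v1]) (by simp)

theorem Loaded.reach_small (L : Loaded κ w V N mem) (ha : a < 2 ^ (κ * w))
    (hi : i < 2 ^ (κ * w)) (hV : 20 ≤ V.length) (h : V.getD 0 0 = 1)
    (hQ : ∀ ρ, Started κ w V a i 20 ρ → Runs mem (8 * κ * w) (smallCode κ) ρ Q) :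
    Reach mem (8 * κ * w) (rankProgram κ) (fun x => if x = 0 then a else if x = 1 then i else 0)
      (prologueTime κ + (smallCode κ).time) Q := by
  refine Reach.mono (t₁ := (RAM.prologue κ 20).time +
    ((RAM.assign 62 ♭1).time + ((smallCode κ).time + 1) + 1))
    (Reach.seq (L.prologue ha hi le_rfl hV) fun ρ hρ => ?_)
    (by simp only [prologueTime]; omega) fun _ h => h
  have h4 : ρ 4 = 1 := (hρ.header 0 (by norm_num)).trans h
  refine Reach.ite ⟨by decide, by decide⟩ (fun ht => ?_) fun _ => ?_
  · rw [Test.On, h4, hρ.v63] at ht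
    omega
  refine Reach.seq (L.assign 1 (by decide) rfl (by decide) hρ.bdd (by simp) (by simp) rfl) ?_
  rintro _ rfl
  have hne : ∀ y, y ≠ 62 → Function.update ρ 62 1 y = ρ y := fun y hy =>
    Function.update_of_ne hy _ _
  refine Reach.ite ⟨by decide, by decide⟩ (fun _ => hQ _ ?_) fun ht => absurd (by
    rw [Test.On, Function.update_self, hne _ (by norm_num), h4]) ht
  have hβ := L.machine.thirtytwo_lt
  exact ⟨hρ.bdd.update (by omega), by rw [hne _ (by norm_num), hρ.v0],
    by rw [hne _ (by norm_num), hρ.v1], by rw [hne _ (by norm_num), hρ.v2],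
    by rw [hne _ (by norm_num), hρ.v3], by rw [hne _ (by norm_num), hρ.v63],
    fun j hj => by rw [hne _ (by omega), hρ.header j hj]⟩

theorem Loaded.reach_large (L : Loaded κ w V N mem) (ha : a < 2 ^ (κ * w))
    (hi : i < 2 ^ (κ * w)) (hV : 20 ≤ V.length) (h : V.getD 0 0 = 2) {t : ℕ}
    (hQ : ∀ ρ, Started κ w V a i 20 ρ → Reach mem (8 * κ * w) (largeCode κ) ρ t Q) :
    Reach mem (8 * κ * w) (rankProgram κ) (fun x => if x = 0 then a else if x = 1 then i else 0)
      (prologueTime κ + t) Q := by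
  refine Reach.mono (t₁ := (RAM.prologue κ 20).time + ((RAM.assign 62 ♭1).time + (t + 1) + 1))
    (Reach.seq (L.prologue ha hi le_rfl hV) fun ρ hρ => ?_)
    (by simp only [prologueTime]; omega) fun _ h => h
  have h4 : ρ 4 = 2 := (hρ.header 0 (by norm_num)).trans h
  refine Reach.ite ⟨by decide, by decide⟩ (fun ht => ?_) fun _ => ?_
  · rw [Test.On, h4, hρ.v63] at ht
    omega
  refine Reach.seq (L.assign 1 (by decide) rfl (by decide) hρ.bdd (by simp) (by simp) rfl) ?_
  rintro _ rfl
  have hne : ∀ y, y ≠ 62 → Function.update ρ 62 1 y = ρ y := fun y hy =>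
    Function.update_of_ne hy _ _
  refine Reach.ite ⟨by decide, by decide⟩ (fun ht => ?_) fun _ => hQ _ ?_
  · rw [Test.On, Function.update_self, hne _ (by norm_num), h4] at ht
    omega
  have hβ := L.machine.thirtytwo_lt
  exact ⟨hρ.bdd.update (by omega), by rw [hne _ (by norm_num), hρ.v0],
    by rw [hne _ (by norm_num), hρ.v1], by rw [hne _ (by norm_num), hρ.v2],
    by rw [hne _ (by norm_num), hρ.v3], by rw [hne _ (by norm_num), hρ.v63],
    fun j hj => by rw [hne _ (by omega), hρ.header j hj]⟩

end

/-! ### From programs on variables to executions in memory -/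

theorem agrees_init {W a i : ℕ} (ha : a < 2 ^ W) (hi : i < 2 ^ W) :
    Agrees (State.init W a i) fun x => if x = 0 then a else if x = 1 then i else 0 := fun x _ => by
  simp only [State.init]
  split_ifs
  · simpa using Nat.mod_eq_of_lt ha
  · simpa using Nat.mod_eq_of_lt hi
  · simp

theorem exec_of_reach {κ w a i t v : ℕ} {mem : List (BitVec w)} (ha : a < 2 ^ (κ * w))
    (hi : i < 2 ^ (κ * w))
    (h : Reach mem (8 * κ * w) (rankProgram κ) (fun x => if x = 0 then a else if x = 1 then i else 0)
      t fun ρ' => ρ' 0 = v) :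
    ∃ t' ≤ t, ∃ s, Exec mem (rankProgram κ) (State.init (8 * κ * w) a i) t' s ∧
      (s.reg 0).toNat = v := by
  have hβ : 2 ^ (κ * w) ≤ 2 ^ (8 * κ * w) := Nat.pow_le_pow_right (by norm_num) (by nlinarith)
  obtain ⟨t', ht, s, ρ', h₁, h₂, h₃⟩ := h _ (agrees_init (ha.trans_le hβ) (hi.trans_le hβ))
  exact ⟨t', ht, s, h₁, (h₂ 0 (by decide)).trans h₃⟩

/-- The cells that hold the wide words `V` and a bit string of length `len`. -/
theorem exists_loaded {κ w len N : ℕ} {V : List ℕ} (hw : 2 ≤ w) (hκ : 16 ≤ κ)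
    (hV : ∀ x ∈ V, x < 2 ^ (κ * w)) (hN : N < 2 ^ len) :
    ∃ mem : List (BitVec w), Loaded κ w V N mem ∧
      mem.length * w ≤ 2 * w + κ * w * V.length + len := by
  have hlt : image κ w V N < 2 ^ (w + κ * w * V.length + len) := by
    have h₁ : w < 2 ^ w := Nat.lt_two_pow_self
    have h₂ := pack_lt hV
    have h₃ : pack (κ * w) V + 2 ^ (κ * w * V.length) * N < 2 ^ (κ * w * V.length) * 2 ^ len := by
      nlinarith
    rw [image, add_assoc, pow_add, pow_add]
    nlinarith
  refine ⟨cells w (image κ w V N) ((w + κ * w * V.length + len) / w + 1),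
    ⟨⟨cells_memIs (hlt.trans_le (Nat.pow_le_pow_right (by norm_num) ?_)), hw, hκ⟩, hV⟩, ?_⟩
  · exact (Nat.lt_mul_div_succ _ (by omega)).le
  · have := Nat.div_mul_le_self (w + κ * w * V.length + len) w
    simp only [cells, List.length_map, List.length_range, Nat.add_mul, one_mul]
    omega

/-! ### The representation for small alphabets -/

section
variable {n : ℕ} {S : Fin n → ℕ}

theorem stringRank_eq_count (a i : ℕ) : stringRank S a i = ((List.ofFn S).take i).count a := by
  induction i with
  | zero => simp [stringRank]
  | succ i ih =>
    rcases lt_or_ge i n with hi | hi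
    · have h : (Finset.univ.filter fun j : Fin n => j.val < i + 1 ∧ S j = a) =
          (Finset.univ.filter fun j : Fin n => j.val < i ∧ S j = a) ∪
            (if S ⟨i, hi⟩ = a then {⟨i, hi⟩} else ∅) := by
        ext j
        split_ifs with ha <;> simp only [Finset.mem_union, Finset.mem_filter, Finset.mem_univ,
          true_and, Finset.mem_singleton, Finset.notMem_empty, or_false, Fin.ext_iff]
        · constructor
          · rintro ⟨h₁, h₂⟩
            omega
          · rintro (⟨h₁, h₂⟩ | h)
            · exact ⟨by omega, h₂⟩
            · exact ⟨by omega, by rw [← ha]; congr; exact Fin.ext h⟩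
        · constructor
          · rintro ⟨h₁, h₂⟩
            refine ⟨lt_of_le_of_ne (by omega) fun h => ha ?_, h₂⟩
            rw [← h₂]; congr; exact h.symm
          · rintro ⟨h₁, h₂⟩
            exact ⟨by omega, h₂⟩
      rw [stringRank, h, Finset.card_union_of_disjoint, List.take_add_one, List.count_append, ← ih]
      · rw [stringRank]
        congr 1
        rw [List.getElem?_ofFn, dif_pos hi]
        split_ifs with ha <;> simp [ha]
      · rw [Finset.disjoint_left]
        intro j hj
        simp only [Finset.mem_filter, Finset.mem_univ, true_and] at hj
        split_ifs
        · simp only [Finset.mem_singleton]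
          rintro rfl
          simp at hj
        · simp
    · rw [List.take_of_length_le (by simp; omega)]
      rw [List.take_of_length_le (by simp; omega)] at ih
      rw [← ih, stringRank, stringRank]
      congr 1
      ext j
      have := j.2
      simp only [Finset.mem_filter, Finset.mem_univ, true_and]
      omega

theorem stringRank_add (a x v : ℕ) : stringRank S a (x + v) =
    stringRank S a x + (((List.ofFn S).drop x).take v).count a := by
  rw [stringRank_eq_count, stringRank_eq_count, List.take_add, List.count_append]

theorem stringRank_le (a i : ℕ) : stringRank S a i ≤ n := by
  rw [stringRank_eq_count]
  exact List.count_le_length.trans (by simp)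

theorem stringRank_sub_le (a : ℕ) {x y : ℕ} (h : x ≤ y) :
    stringRank S a y - stringRank S a x ≤ y - x := by
  obtain ⟨v, rfl⟩ := Nat.exists_eq_add_of_le h
  rw [stringRank_add]
  have := (List.count_le_length (a := a) (l := ((List.ofFn S).drop x).take v)).trans
    (List.length_take_le _ _)
  omega

end

theorem countP_le_sub_countP_le {a : ℕ} (ha : 0 < a) (l : List ℕ) :
    l.countP (· ≤ a) - l.countP (· ≤ a - 1) = l.count a := by
  suffices h : l.countP (· ≤ a) = l.countP (· ≤ a - 1) + l.count a by omega
  induction l with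
  | nil => rfl
  | cons x l ih =>
    simp only [List.countP_cons, List.count_cons, ih, decide_eq_true_eq, beq_iff_eq]
    split_ifs <;> omega

theorem getD_map_range {F : ℕ → ℕ} {m x : ℕ} (hx : x < m) :
    ((List.range m).map F).getD x 0 = F x := by
  rw [List.getD_eq_getElem _ _ (by simpa)]
  simp

/-- The parameters for small alphabets: blocks of `2 ^ (l / 4)` symbols of `u` bits. -/
theorem small_parameters {w u l : ℕ} (hl : l = Nat.log 2 w) (hw : w ≠ 0) (hu : 16 * u ≤ l)
    (hu0 : 0 < u) :
    (u + 1) * 2 ^ (l / 4) * 2 ^ (l / 4) ≤ w ∧ 2 ^ u * w ≤ 2 ^ (2 * l) ∧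
      2 * l * 2 ^ u ≤ 32 * 2 ^ (l / 4) ∧ 2 ^ (l / 4) ≤ w ∧ l < w ∧ 16 ≤ 2 ^ (l / 4) := by
  have h₁ : 2 ^ l ≤ w := hl ▸ Nat.pow_log_le_self 2 hw
  have h₂ : w < 2 ^ (l + 1) := hl ▸ Nat.lt_pow_succ_log_self (by norm_num) w
  have hmono : ∀ {x y : ℕ}, x ≤ y → 2 ^ x ≤ 2 ^ y := fun h => Nat.pow_le_pow_right (by norm_num) h
  have hlw : l < w := (Nat.lt_two_pow_self).trans_le h₁
  have hu1 : u + 1 ≤ 2 ^ u := Nat.lt_two_pow_self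
  refine ⟨?_, ?_, ?_, (hmono (by omega)).trans h₁, hlw, hmono (x := 4) (by omega)⟩
  · calc (u + 1) * 2 ^ (l / 4) * 2 ^ (l / 4) ≤ 2 ^ u * 2 ^ (l / 4) * 2 ^ (l / 4) := by gcongr
      _ = 2 ^ (u + l / 4 + l / 4) := by rw [pow_add, pow_add]
      _ ≤ _ := (hmono (by omega)).trans h₁
  · calc 2 ^ u * w ≤ 2 ^ u * 2 ^ (l + 1) := by gcongr
      _ = 2 ^ (u + (l + 1)) := (pow_add _ _ _).symm
      _ ≤ _ := hmono (by omega)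
  -- The factors `l` and `2 ^ u` are each at most about `2 ^ (l / 16)`; together they stay below the
  -- block length.
  · have h₃ : l / 16 + 1 ≤ 2 ^ (l / 16) := Nat.lt_two_pow_self
    calc 2 * l * 2 ^ u ≤ 32 * 2 ^ (l / 16) * 2 ^ (l / 16) := by
          refine Nat.mul_le_mul (by omega) (hmono (by omega))
      _ = 32 * 2 ^ (l / 16 + l / 16) := by rw [pow_add]; ring
      _ ≤ _ := Nat.mul_le_mul_left _ (hmono (by omega))

/-- A superblock has at least `2 ^ u * w` symbols, so the absolute counts, `2 ^ u` wide words each,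
cost at most `κ * n` bits. A block has at least `2 * l * 2 ^ u / 32` symbols, so the relative counts
of `2 * l` bits cost `O(n + w)`. -/
theorem exists_small_representation {κ w n u : ℕ} (hw : 2 ≤ w) (hκ : 16 ≤ κ)
    (hu : 16 * u ≤ Nat.log 2 w) (hu0 : 0 < u) (hβ : 2 ^ 10 * κ * (n * u + w) < 2 ^ (κ * w))
    (S : Fin n → ℕ) (hS : ∀ j, S j < 2 ^ u) :
    ∃ mem : List (BitVec w), mem.length * w ≤ 2 ^ 10 * κ * (n * u + w) ∧
      ∀ a i, 0 < a → a < 2 ^ u → i ≤ n → ∃ t ≤ prologueTime κ + (smallCode κ).time,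
        ∃ s, Exec mem (rankProgram κ) (State.init (8 * κ * w) a i) t s ∧
          (s.reg 0).toNat = stringRank S a i := by
  obtain ⟨l, hl⟩ : ∃ l, l = Nat.log 2 w := ⟨_, rfl⟩
  rw [← hl] at hu
  obtain ⟨p₁, p₂, p₃, p₄, p₅, p₆⟩ := small_parameters hl (by omega) hu hu0
  obtain ⟨r, hr⟩ : ∃ r, r = 2 ^ (l / 4) := ⟨_, rfl⟩
  obtain ⟨r₂, hr₂⟩ : ∃ r₂, r₂ = 2 ^ (2 * l) := ⟨_, rfl⟩
  rw [← hr] at p₁ p₃ p₄ p₆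
  rw [← hr₂] at p₂
  -- Superblock boundaries are block boundaries, so the block that contains `i` begins in the
  -- superblock of `i`.
  have hrr : ∃ m, r₂ = r * m := ⟨2 ^ (2 * l - l / 4), by
    rw [hr, hr₂, ← pow_add]; congr 1; omega⟩
  have hr₂pos : 0 < r₂ := by rw [hr₂]; positivity
  -- The table starts with boundary 1. Boundary 0 has rank zero and is omitted, so a string shorter
  -- than one superblock pays nothing here.
  obtain ⟨T, hT⟩ : ∃ T, T = (List.range (n / r₂ * 2 ^ u)).map fun x =>
    stringRank S (x % 2 ^ u) ((x / 2 ^ u + 1) * r₂) := ⟨_, rfl⟩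
  obtain ⟨C, hC⟩ : ∃ C, C = (List.range ((n / r + 1) * 2 ^ u)).map fun x =>
    stringRank S (x % 2 ^ u) (x / 2 ^ u * r) -
      stringRank S (x % 2 ^ u) (x / 2 ^ u * r / r₂ * r₂) := ⟨_, rfl⟩
  have hTl : T.length = n / r₂ * 2 ^ u := by simp [hT]
  have hCl : C.length = (n / r + 1) * 2 ^ u := by simp [hC]
  have hSl : ∀ x ∈ List.ofFn S, x < 2 ^ u := fun x hx => by
    obtain ⟨j, rfl⟩ := List.mem_ofFn.1 hx
    exact hS j
  have hClt : ∀ x ∈ C, x < 2 ^ (2 * l) := fun x hx => by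
    rw [hC, List.mem_map] at hx
    obtain ⟨y, -, rfl⟩ := hx
    refine (stringRank_sub_le _ (Nat.div_mul_le_self _ _)).trans_lt ?_
    rw [← hr₂]
    have := Nat.div_add_mod' (y / 2 ^ u * r) r₂
    have := Nat.mod_lt (y / 2 ^ u * r) hr₂pos
    omega
  have hTspace : w * T.length ≤ n := by
    calc w * T.length = n / r₂ * (2 ^ u * w) := by rw [hTl]; ring
      _ ≤ n / r₂ * r₂ := Nat.mul_le_mul_left _ p₂
      _ ≤ n := Nat.div_mul_le_self _ _
  have hCspace : 2 * l * C.length ≤ 32 * n + 32 * w := by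
    calc 2 * l * C.length = (n / r + 1) * (2 * l * 2 ^ u) := by rw [hCl]; ring
      _ ≤ (n / r + 1) * (32 * r) := Nat.mul_le_mul_left _ p₃
      _ = 32 * (n / r * r) + 32 * r := by ring
      _ ≤ _ := by have := Nat.div_mul_le_self n r; omega
  obtain ⟨Z, hZ⟩ : ∃ Z, Z = 2 ^ 10 * κ * (n * u + w) := ⟨_, rfl⟩
  rw [← hZ] at hβ ⊢
  have hspace : 2 * w + κ * w * (20 + T.length) + (2 * l * C.length + (u + 1) * n) ≤ Z := by
    have h₁ : κ * (w * T.length) ≤ κ * n := Nat.mul_le_mul_left _ hTspace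
    have h₂ : n ≤ n * u := Nat.le_mul_of_pos_right _ hu0
    have h₃ : κ * n ≤ κ * (n * u) := Nat.mul_le_mul_left _ h₂
    have h₄ : 16 * (n * u) ≤ κ * (n * u) := Nat.mul_le_mul_right _ hκ
    have h₅ : 16 * w ≤ κ * w := Nat.mul_le_mul_right _ hκ
    rw [hZ]
    calc 2 * w + κ * w * (20 + T.length) + (2 * l * C.length + (u + 1) * n) =
          2 * w + 20 * (κ * w) + κ * (w * T.length) + 2 * l * C.length + n * u + n := by ring
      _ ≤ 1024 * (κ * (n * u)) + 1024 * (κ * w) := by omega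
      _ = _ := by ring
  have hwκ : 16 * w ≤ κ * w := Nat.mul_le_mul_right _ hκ
  have hZn : n ≤ Z := by
    have h₁ : n ≤ (u + 1) * n := Nat.le_mul_of_pos_left _ (by omega)
    omega
  have hpow : ∀ {x y : ℕ}, x < 2 ^ y → y ≤ w → x < 2 ^ (κ * w) := fun h h' =>
    h.trans_le (Nat.pow_le_pow_right (by norm_num) (by omega))
  have hwpow : w < 2 ^ (κ * w) := hpow Nat.lt_two_pow_self le_rfl
  have hur : (u + 1) * r * 16 ≤ w := (Nat.mul_le_mul_left _ p₆).trans p₁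
  have hur' : u + 1 ≤ (u + 1) * r := Nat.le_mul_of_pos_right _ (by omega)
  have hone : ∀ x ∈ List.replicate r 1, x < 2 ^ (u + 1) := fun x hx => by
    rw [List.eq_of_mem_replicate hx]
    exact Nat.one_lt_two_pow (by omega)
  have hrep : pack (u + 1) (List.replicate r 1) < 2 ^ ((u + 1) * r) := by
    simpa using pack_lt hone
  -- Entry `j` of the header is loaded into variable `4 + j`. The first entry selects the case, and
  -- zeros fill variables that this case does not use. The entry 20 is the index where `T` begins.
  obtain ⟨V, hV⟩ : ∃ V, V = [1, u, u + 1, r, 0, pack (u + 1) (List.replicate r 1),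
    2 ^ u * pack (u + 1) (List.replicate r 1), 2 ^ ((u + 1) * r + (u + 1)) - 1, 2 * l, r₂,
    pack ((u + 1) * r) (List.replicate r 1),
    pack ((u + 1) * r) ((List.range r).map fun i => 2 ^ ((u + 1) * i)), 2 ^ u, 0, 0, 20, 0,
    w + κ * w * (20 + T.length), w + κ * w * (20 + T.length) + 2 * l * C.length, 0] ++ T := ⟨_, rfl⟩
  have hVl : V.length = 20 + T.length := by rw [hV]; simp; omega
  have hVlt : ∀ x ∈ V, x < 2 ^ (κ * w) := by
    intro x hx
    rw [hV, List.mem_append] at hx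
    rcases hx with hx | hx
    · simp only [List.mem_cons, List.not_mem_nil, or_false] at hx
      rcases hx with rfl | rfl | rfl | rfl | rfl | rfl | rfl | rfl | rfl | rfl | rfl | rfl | rfl |
        rfl | rfl | rfl | rfl | rfl | rfl | rfl
      · omega
      · omega
      · omega
      · omega
      · positivity
      · exact hpow hrep (by omega)
      · refine hpow (y := u + (u + 1) * r) ?_ (by omega)
        rw [pow_add]
        exact Nat.mul_lt_mul_of_pos_left hrep (by positivity)
      · exact hpow (y := (u + 1) * r + (u + 1)) (Nat.sub_lt (by positivity) one_pos) (by omega)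
      · omega
      · rw [hr₂]
        exact Nat.pow_lt_pow_right (by norm_num) (by omega)
      · refine hpow (y := (u + 1) * r * r) ?_ p₁
        simpa using pack_lt (β := (u + 1) * r) (l := List.replicate r 1) fun x hx => by
          rw [List.eq_of_mem_replicate hx]
          exact Nat.one_lt_two_pow (by omega)
      · refine hpow (y := (u + 1) * r * r) ?_ p₁
        simpa using pack_lt (β := (u + 1) * r)
          (l := (List.range r).map fun i => 2 ^ ((u + 1) * i)) fun x hx => by
            rw [List.mem_map] at hx
            obtain ⟨y, hy, rfl⟩ := hx
            exact Nat.pow_lt_pow_right (by norm_num)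
              (Nat.mul_lt_mul_of_pos_left (List.mem_range.1 hy) (by omega))
      · exact Nat.pow_lt_pow_right (by norm_num) (by omega)
      all_goals omega
    · rw [hT, List.mem_map] at hx
      obtain ⟨y, -, rfl⟩ := hx
      exact (stringRank_le _ _).trans_lt (by omega)
  have hN : pack (2 * l) C + 2 ^ (2 * l * C.length) * pack (u + 1) (List.ofFn S) <
      2 ^ (2 * l * C.length + (u + 1) * n) := by
    have h₁ := pack_lt hClt
    have h₂ : pack (u + 1) (List.ofFn S) < 2 ^ ((u + 1) * n) := by
      simpa using pack_lt (β := u + 1) (l := List.ofFn S) fun x hx => (hSl x hx).trans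
        (Nat.pow_lt_pow_right (by norm_num) (by omega))
    rw [pow_add]
    nlinarith
  obtain ⟨mem, L, hmem⟩ := exists_loaded hw hκ hVlt hN
  refine ⟨mem, hmem.trans (by rw [hVl]; omega), fun a i ha hau hi => ?_⟩
  have haβ : a < 2 ^ (κ * w) := hau.trans (Nat.pow_lt_pow_right (by norm_num) (by omega))
  have hiβ : i < 2 ^ (κ * w) := by omega
  have hsame : i / r * r / r₂ = i / r₂ := by
    obtain ⟨m, rfl⟩ := hrr
    rw [mul_comm (i / r), Nat.mul_div_mul_left _ _ (by omega), Nat.div_div_eq_div_mul]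
  have hq : i / r * 2 ^ u + a < C.length := by
    have h₁ : i / r ≤ n / r := Nat.div_le_div_right hi
    rw [hCl, Nat.add_mul, one_mul]
    exact Nat.add_lt_add_of_le_of_lt (Nat.mul_le_mul_right _ h₁) hau
  have hsb : 0 < i / r₂ → (i / r₂ - 1) * 2 ^ u + a < T.length := fun h => by
    have h₁ : i / r₂ ≤ n / r₂ := Nat.div_le_div_right hi
    have h₂ : (i / r₂ - 1 + 1) * 2 ^ u ≤ n / r₂ * 2 ^ u := Nat.mul_le_mul_right _ (by omega)
    rw [hTl]
    rw [Nat.add_mul, one_mul] at h₂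
    omega
  have hdm : ∀ x, (x * 2 ^ u + a) / 2 ^ u = x ∧ (x * 2 ^ u + a) % 2 ^ u = a := fun x =>
    ⟨by rw [mul_comm, Nat.mul_add_div (by positivity), Nat.div_eq_of_lt hau, add_zero],
      by rw [mul_comm, Nat.mul_add_mod, Nat.mod_eq_of_lt hau]⟩
  refine exec_of_reach haβ hiβ (L.reach_small haβ hiβ (by omega) (by rw [hV]; rfl) fun ρ hρ => ?_)
  have hd : ∀ j < 20, ρ (4 + j) = V.getD j 0 := hρ.header
  rw [hV] at hd
  refine (L.small (T := T) (r := r) (r₂ := r₂) (c := 2 * l) (a := a) (i := i) hρ.bdd ?_ hClt hSl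
    (by omega) (by omega) (by omega) hρ.v0 hρ.v1 ha hau (by simpa using hi) hq hsb).mono ?_
  · refine ⟨hρ.v2, hρ.v3, hd 1 (by norm_num), hd 2 (by norm_num), hd 3 (by norm_num),
      hd 5 (by norm_num), hd 6 (by norm_num), hd 7 (by norm_num), hd 8 (by norm_num),
      hd 9 (by norm_num), hd 10 (by norm_num), hd 11 (by norm_num), hd 12 (by norm_num), ?_, ?_, ?_,
      hρ.v63⟩
    · rw [show ρ 19 = 20 from hd 15 (by norm_num), hV]
      exact ⟨_, [], by rw [List.append_nil], rfl⟩
    · rw [hVl]; exact hd 17 (by norm_num)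
    · rw [hVl]; exact hd 18 (by norm_num)
  · intro ρ' h
    rw [h, countP_le_sub_countP_le ha, hC, getD_map_range (hCl ▸ hq), (hdm _).1, (hdm _).2, hsame]
    have e₁ : stringRank S a i = stringRank S a (i / r * r) +
        (((List.ofFn S).drop (i / r * r)).take (i % r)).count a := by
      rw [← stringRank_add]
      congr 1
      rw [mul_comm, Nat.div_add_mod]
    have e₂ : (if 0 < i / r₂ then T.getD ((i / r₂ - 1) * 2 ^ u + a) 0 else 0) =
        stringRank S a (i / r₂ * r₂) := by
      split_ifs with hpos
      · rw [hT, getD_map_range (hTl ▸ hsb hpos), (hdm _).1, (hdm _).2, Nat.sub_add_cancel hpos]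
      · have h0 : i / r₂ = 0 := Nat.eq_zero_of_not_pos hpos
        simp [h0, stringRank]
    have e₃ : stringRank S a (i / r₂ * r₂) ≤ stringRank S a (i / r * r) := by
      have hle : i / r₂ * r₂ ≤ i / r * r := hsame ▸ Nat.div_mul_le_self _ _
      obtain ⟨v, hv⟩ := Nat.exists_eq_add_of_le hle
      rw [hv, stringRank_add]
      omega
    rw [e₁, e₂]
    omega

/-! ### The representation for large alphabets -/

/-- The dictionary of the trie of the samples of the buckets of `key`. -/
theorem exists_trieDict {n B X d D g θ : ℕ} {key : Fin n → ℕ} (hkey : Function.Injective key)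
    (hd : 0 < d) (hB : B = d * D) (hX : B ≤ X) (hg : 0 < g) (hθ : 3 * (X + 1) + 2 ≤ θ) :
    ∃ (A s : ℕ) (T : List ℕ),
      TrieDict T X d D θ A s (samples B g (bucketList B key) (2 ^ (X - B)))
        (fun z => (countAt B (bucketList B key) z + g - 1) / g) ∧
      A < 2 ^ θ ∧ s ≤ θ ∧
      T.length ≤ 34 * ((samples B g (bucketList B key) (2 ^ (X - B))).card * D * 2 ^ d) + 5 ∧
      ∀ e ∈ T, e < 2 ^ θ ∨ e ≤ T.length ∨ e ≤ n + 2 := by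
  have hl : Buckets B (bucketList B key) := buckets_bucketList
  have hXB : 2 ^ (X - B) * 2 ^ B = 2 ^ X := by rw [← pow_add, Nat.sub_add_cancel hX]
  obtain ⟨A, val, h₁, h₂, h₃, h₄, h₅⟩ := exists_trie_dictionary (X := X) (d := d) (D := D)
    (samples B g (bucketList B key) (2 ^ (X - B)))
    (fun z => (countAt B (bucketList B key) z + g - 1) / g) hd (hB ▸ hX)
    (fun q hq => hXB ▸ hl.samples_lt hq) (fun z => ceil_div_pos hg (hl.countAt_pos z))
    (fun z z' hzz hz' he hne => by
      rw [← hB] at he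
      refine hl.separated hg hzz ?_ he hne
      rw [Nat.div_lt_iff_lt_mul (by positivity), hXB]
      exact hz')
  obtain ⟨a, s, T, k₁, k₂, k₃, k₄, k₅⟩ := exists_dictionary A val h₂ hθ
  have hnode : ∀ j z, 0 < node X d D j z := fun j z => by
    have hle : d * (D - j) ≤ X := (Nat.mul_le_mul_left _ (Nat.sub_le _ _)).trans (hB ▸ hX)
    have hpow : 2 ^ (d * (D - j)) ≤ 2 ^ X := Nat.pow_le_pow_right (by norm_num) hle
    exact Nat.div_pos (by omega) (by positivity)
  refine ⟨a, s, T, ⟨fun x hx => ⟨(k₅ x hx).1, (k₅ x hx).2.1⟩, fun z hz j hj hjD => ?_,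
    fun z hz j hj hi hs => ?_⟩, k₁, k₂, k₃.trans (by omega), fun e he => ?_⟩
  · rw [(k₅ _ (hnode _ _)).2.2]
    exact h₄ z hz j hj hjD
  · rw [(k₅ _ (hnode _ _)).2.2]
    exact h₅ z hz j hj hi hs
  · rcases k₄ e he with h | h | ⟨x, hx, rfl⟩
    · exact .inl h
    · exact .inr (.inl h)
    · right; right
      rcases h₃ x hx with h | ⟨z, h⟩
      · omega
      · rw [h]
        have c₁ : countAt B (bucketList B key) z ≤ 1 + n :=
          (countAt_le z).trans (length_bucketList_le hkey _)
        have c₂ : (countAt B (bucketList B key) z + g - 1) / g ≤ countAt B (bucketList B key) z := by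
          have hpos := hl.countAt_pos z
          refine Nat.div_le_of_le_mul ?_
          obtain ⟨x, hx⟩ : ∃ x, countAt B (bucketList B key) z = x + 1 :=
            ⟨_, (Nat.sub_add_cancel hpos).symm⟩
          obtain ⟨y, rfl⟩ : ∃ y, g = y + 1 := ⟨_, (Nat.sub_add_cancel hg).symm⟩
          rw [hx]
          have : (y + 1) * (x + 1) = x * y + x + y + 1 := by ring
          omega
        omega

/-- The depth of the tries, for symbols of `u` bits and cells of `w` bits. -/
def trieDepth (w u : ℕ) : ℕ := u / Nat.log 2 w + 2

/-- The number of low bits of a key that the search trees distinguish. -/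
def lowBits (w u : ℕ) : ℕ := Nat.log 2 w * trieDepth w u

/-- The degree of the search trees. -/
def treeDegree (w u : ℕ) : ℕ := max 2 (w / (lowBits w u + 1))

/-- The depth of the search trees, for strings of length `n`. -/
def treeDepth (w u n : ℕ) : ℕ := Nat.clog (treeDegree w u) (min (w ^ 2) (n + 1))

section
variable {w u n : ℕ}

theorem log_pos (hw : 2 ≤ w) : 0 < Nat.log 2 w := Nat.log_pos (by norm_num) hw

/-- Since `B` exceeds `u + lg w`, rounded down, at most `ν - lg w - 1` bits remain for the bucket
number when `X = u + ν`: there are fewer buckets than `2 * n / w`, up to rounding. -/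
theorem le_lowBits (hw : 2 ≤ w) : u + Nat.log 2 w < lowBits w u := by
  have h₁ := Nat.div_add_mod u (Nat.log 2 w)
  have h₂ := Nat.mod_lt u (log_pos hw)
  rw [lowBits, trieDepth, mul_add]
  omega

theorem lowBits_le (w u : ℕ) : lowBits w u ≤ u + 2 * Nat.log 2 w := by
  have h₁ := Nat.div_mul_le_self u (Nat.log 2 w)
  rw [lowBits, trieDepth, mul_add, mul_comm _ (u / _)]
  omega

theorem treeDegree_le (hw : 2 ≤ w) : treeDegree w u ≤ w :=
  max_le hw (Nat.div_le_self _ _)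

/-- A count up to `f` must fit below the modulus of the remainder that adds the flags. -/
theorem treeDegree_lt (hw : 2 ≤ w) (hu : 2 ≤ u) : treeDegree w u < 2 ^ (lowBits w u + 1) - 1 := by
  have h₁ : w < 2 ^ (Nat.log 2 w + 1) := Nat.lt_pow_succ_log_self (by norm_num) w
  have h₂ : 2 ^ (Nat.log 2 w + 1) * 2 ≤ 2 ^ (lowBits w u + 1) := by
    rw [← pow_succ]
    refine Nat.pow_le_pow_right (by norm_num) ?_
    have := le_lowBits (u := u) hw
    omega
  have := treeDegree_le (u := u) hw
  omega

theorem mul_treeDegree_le (w u : ℕ) :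
    (lowBits w u + 1) * treeDegree w u ≤ 2 * (lowBits w u + 1) + w := by
  rcases max_choice 2 (w / (lowBits w u + 1)) with h | h <;> rw [treeDegree, h]
  · omega
  · have := Nat.mul_div_le w (lowBits w u + 1)
    omega

theorem two_le_treeDegree (w u : ℕ) : 2 ≤ treeDegree w u := le_max_left _ _

theorem le_pow_treeDepth (w u n : ℕ) : min (w ^ 2) (n + 1) ≤ treeDegree w u ^ treeDepth w u n :=
  Nat.le_pow_clog (two_le_treeDegree w u) _

theorem pow_treeDepth_le (hw : 2 ≤ w) : treeDegree w u ^ treeDepth w u n ≤ w ^ 3 := by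
  rcases Nat.eq_zero_or_pos (treeDepth w u n) with h | h
  · rw [h, pow_zero]
    exact Nat.one_le_pow _ _ (by omega)
  · have h2 : 1 < min (w ^ 2) (n + 1) := by
      by_contra hle
      rw [treeDepth, Nat.clog_of_right_le_one (by omega)] at h
      omega
    have := Nat.pow_pred_clog_lt_self (two_le_treeDegree w u) h2
    calc treeDegree w u ^ treeDepth w u n
        = treeDegree w u ^ (treeDepth w u n).pred * treeDegree w u := by
          rw [← pow_succ, ← Nat.succ_eq_add_one, Nat.succ_pred_eq_of_pos h]
      _ ≤ w ^ 2 * w := Nat.mul_le_mul (this.le.trans (min_le_left _ _)) (treeDegree_le hw)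
      _ = w ^ 3 := by ring

theorem treeDepth_le_of_le_pow {m : ℕ} (h : min (w ^ 2) (n + 1) ≤ treeDegree w u ^ m) :
    treeDepth w u n ≤ m := Nat.clog_le_of_le_pow h

theorem treeDepth_le_self : treeDepth w u n ≤ n :=
  treeDepth_le_of_le_pow (((min_le_right _ _).trans Nat.lt_two_pow_self).trans
    (Nat.pow_le_pow_left (le_max_left _ _) _))

theorem treeDepth_le_log : treeDepth w u n ≤ 2 * Nat.log 2 w + 2 := by
  refine treeDepth_le_of_le_pow ((min_le_left _ _).trans
    (le_trans ?_ (Nat.pow_le_pow_left (le_max_left 2 _) _)))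
  have h₁ : w < 2 ^ (Nat.log 2 w + 1) := Nat.lt_pow_succ_log_self (by norm_num) w
  calc w ^ 2 ≤ (2 ^ (Nat.log 2 w + 1)) ^ 2 := Nat.pow_le_pow_left h₁.le _
    _ = _ := by rw [← pow_mul]; congr 1; ring

end

/-- The space for the buckets. -/
theorem bucket_space {w u n ν X t : ℕ} (hw : 2 ≤ w) (hu : Nat.log 2 w < 16 * u) (hn : 0 < n)
    (hν : 2 ^ ν ≤ 2 * n) (hX : X = max (u + ν) (lowBits w u)) (ht : t = treeDepth w u n) :
    2 ^ (X - lowBits w u) * w ≤ w + 2 * n ∧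
      (lowBits w u + 1) * (2 * n + (2 + t) * 2 ^ (X - lowBits w u)) ≤ 272 * (n * u) := by
  have hb : lowBits w u + 1 ≤ 34 * u := by have := lowBits_le w u; omega
  have hlog : w < 2 ^ (Nat.log 2 w + 1) := Nat.lt_pow_succ_log_self (by norm_num) w
  have hlw : Nat.log 2 w < w := Nat.log_lt_self 2 (by omega)
  have hlow := le_lowBits (u := u) hw
  have hfin : ∀ y, y ≤ 6 * n → (lowBits w u + 1) * (2 * n + y) ≤ 272 * (n * u) := fun y hy => by
    calc _ ≤ 34 * u * (8 * n) := Nat.mul_le_mul hb (by omega)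
      _ = 272 * (n * u) := by ring
  -- Either all keys lie in one bucket, and the depth of its tree is at most `n`, or the keys are
  -- longer than `B` bits and the buckets number at most `2 * n / w`.
  rcases le_total (u + ν) (lowBits w u) with h | h
  · rw [max_eq_right h] at hX
    rw [hX, Nat.sub_self, pow_zero, one_mul, mul_one]
    refine ⟨by omega, hfin _ ?_⟩
    have := treeDepth_le_self (w := w) (u := u) (n := n)
    omega
  · rw [max_eq_left h] at hX
    have h₁ : 2 ^ (X - lowBits w u) * w ≤ 2 * n := by
      refine le_trans ?_ hν
      calc _ ≤ 2 ^ (X - lowBits w u) * 2 ^ (Nat.log 2 w + 1) := Nat.mul_le_mul_left _ hlog.le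
        _ = 2 ^ (X - lowBits w u + (Nat.log 2 w + 1)) := (pow_add _ _ _).symm
        _ ≤ _ := Nat.pow_le_pow_right (by norm_num) (by omega)
    refine ⟨by omega, hfin _ ?_⟩
    have h₂ := treeDepth_le_log (w := w) (u := u) (n := n)
    calc (2 + t) * 2 ^ (X - lowBits w u) ≤ 3 * w * 2 ^ (X - lowBits w u) :=
          Nat.mul_le_mul_right _ (by omega)
      _ = 3 * (2 ^ (X - lowBits w u) * w) := by ring
      _ ≤ _ := by omega

/-- The space for the dictionary. -/
theorem dictionary_space {w u n q : ℕ} (hw : 2 ≤ w) (hu : 2 ≤ u)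
    (hq : q * treeDegree w u ^ treeDepth w u n ≤ n) :
    w * (q * trieDepth w u * 2 ^ Nat.log 2 w) ≤ 2 * (n * u) := by
  have hD : trieDepth w u ≤ 2 * u := by
    have : u / Nat.log 2 w ≤ u := Nat.div_le_self _ _
    rw [trieDepth]
    omega
  have hlog : 2 ^ Nat.log 2 w ≤ w := Nat.pow_log_le_self 2 (by omega)
  have hle := le_pow_treeDepth w u n
  -- Either the sampling step is at least `w ^ 2`, or it exceeds `n` and there are no samples at
  -- all.
  have hqw : q * w ^ 2 ≤ n := by
    rcases min_choice (w ^ 2) (n + 1) with h | h <;> rw [h] at hle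
    · exact (Nat.mul_le_mul_left _ hle).trans hq
    · have : q = 0 := by
        by_contra h0
        have : 1 * (n + 1) ≤ q * treeDegree w u ^ treeDepth w u n :=
          Nat.mul_le_mul (by omega) hle
        omega
      simp [this]
  calc w * (q * trieDepth w u * 2 ^ Nat.log 2 w) ≤ w * (q * (2 * u) * w) := by gcongr
    _ = 2 * (q * w ^ 2 * u) := by ring
    _ ≤ _ := by gcongr

theorem exists_large_representation {k κ w n u : ℕ} (hw : 2 ≤ w) (hκ : 128 * (k + 1) ≤ κ)
    (hu : Nat.log 2 w < 16 * u) (hu2 : 2 ≤ u) (huk : u ≤ k * w + 1) (hn : 0 < n)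
    (hnk : n ≤ 2 ^ (k * w)) (hβ : 2 ^ 10 * κ * (n * u + w) < 2 ^ (κ * w))
    (S : Fin n → ℕ) :
    ∃ mem : List (BitVec w), mem.length * w ≤ 2 ^ 10 * κ * (n * u + w) ∧
      ∀ a i, a < 2 ^ u → i ≤ n → ∃ t ≤ prologueTime κ +
          largeTime κ (Nat.clog 2 (trieDepth w u)) (treeDepth w u n),
        ∃ s, Exec mem (rankProgram κ) (State.init (8 * κ * w) a i) t s ∧
          (s.reg 0).toNat = stringRank S a i := by
  obtain ⟨B, hB⟩ : ∃ B, B = lowBits w u := ⟨_, rfl⟩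
  obtain ⟨D, hD⟩ : ∃ D, D = trieDepth w u := ⟨_, rfl⟩
  obtain ⟨f, hf⟩ : ∃ f, f = treeDegree w u := ⟨_, rfl⟩
  obtain ⟨t, ht⟩ : ∃ t, t = treeDepth w u n := ⟨_, rfl⟩
  obtain ⟨l, hl⟩ : ∃ l, l = Nat.log 2 w := ⟨_, rfl⟩
  obtain ⟨ν, hν⟩ : ∃ ν, ν = Nat.log 2 n + 1 := ⟨_, rfl⟩
  -- Keys need `u + ν` bits; they are regarded as longer if necessary, so that at least `B` low bits
  -- exist.
  obtain ⟨X, hX⟩ : ∃ X, X = max (u + ν) B := ⟨_, rfl⟩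
  obtain ⟨g, hg⟩ : ∃ g, g = f ^ t := ⟨_, rfl⟩
  have hnν : n < 2 ^ ν := hν ▸ Nat.lt_pow_succ_log_self (by norm_num) n
  have hνn : 2 ^ ν ≤ 2 * n := by
    rw [hν, pow_succ, mul_comm]
    exact Nat.mul_le_mul_left _ (Nat.pow_log_le_self 2 (by omega))
  have hνk : ν ≤ k * w + 1 := by
    have : Nat.log 2 n ≤ k * w := (Nat.log_mono_right hnk).trans (by rw [Nat.log_pow (by norm_num)])
    omega
  have hlw : l < w := hl ▸ Nat.log_lt_self 2 (by omega)
  have hl0 : 0 < l := hl ▸ log_pos hw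
  have hBl : B = l * D := by rw [hB, lowBits, ← hl, ← hD]
  have hBle : B ≤ u + 2 * l := hB ▸ hl ▸ lowBits_le w u
  have hf2 : 2 ≤ f := hf ▸ le_max_left _ _
  have hfw : f ≤ w := hf ▸ treeDegree_le hw
  have hbf : (B + 1) * f ≤ 2 * (B + 1) + w := by rw [hB, hf]; exact mul_treeDegree_le w u
  obtain ⟨hNB, hkeys⟩ := bucket_space hw hu hn hνn (hB ▸ hX) ht
  rw [← hB] at hNB hkeys
  have hBX : B ≤ X := hX ▸ le_max_right _ _
  have hinj : Function.Injective (symbolKey ν S) := symbolKey_injective hnν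
  obtain ⟨key, hkey⟩ : ∃ key, key = symbolKey ν S := ⟨_, rfl⟩
  rw [← hkey] at hinj
  obtain ⟨θ, hθ⟩ : ∃ θ, θ = 3 * (X + 1) + 2 := ⟨_, rfl⟩
  have hg0 : 0 < g := by rw [hg]; positivity
  obtain ⟨A, s, T, hT, hA, hs, hTl, hTe⟩ := exists_trieDict (X := X) hinj hl0 hBl hBX hg0 hθ.ge
  have hTspace := dictionary_space (q := (samples B g (bucketList B key) (2 ^ (X - B))).card) hw hu2
    (by rw [← hf, ← ht, ← hg]; exact card_samples_mul_le.trans (sum_length_bucketList_le hinj _))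
  rw [← hD, ← hl] at hTspace
  obtain ⟨q, hq⟩ : ∃ q, q = (samples B g (bucketList B key) (2 ^ (X - B))).card * D * 2 ^ l :=
    ⟨_, rfl⟩
  rw [← hq] at hTspace hTl
  obtain ⟨m, hm⟩ : ∃ m, m = 2 ^ (X - B) := ⟨_, rfl⟩
  rw [← hm] at hNB hkeys
  obtain ⟨E, hE⟩ : ∃ E, E = bucketKeys f t (bucketList B key) m := ⟨_, rfl⟩
  have hEl : E.length ≤ 2 * n + (2 + t) * m := hE ▸ length_bucketKeys_le hf2 hinj
  obtain ⟨U, hU⟩ : ∃ U, U = bucketTable f t (keysBefore B key) (bucketList B key) m := ⟨_, rfl⟩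
  have hUl : U.length = 3 * m := by rw [hU, length_bucketTable]
  obtain ⟨Z, hZ⟩ : ∃ Z, Z = 2 ^ 10 * κ * (n * u + w) := ⟨_, rfl⟩
  rw [← hZ] at hβ ⊢
  have hκ' : 128 ≤ κ := by omega
  have hspace : 2 * w + κ * w * (20 + 3 * m + T.length) + (B + 1) * (2 * n + (2 + t) * m) ≤ Z := by
    have h₁ : κ * (w * T.length) ≤ 68 * (κ * (n * u)) + 5 * (κ * w) := by
      calc κ * (w * T.length) ≤ κ * (w * (34 * q + 5)) := by gcongr
        _ = κ * (34 * (w * q) + 5 * w) := by ring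
        _ ≤ κ * (34 * (2 * (n * u)) + 5 * w) := by gcongr
        _ = _ := by ring
    have h₂ : n ≤ n * u := Nat.le_mul_of_pos_right _ (by omega)
    have h₃ : κ * (m * w) ≤ κ * w + 2 * (κ * (n * u)) := by
      calc κ * (m * w) ≤ κ * (w + 2 * (n * u)) := Nat.mul_le_mul_left _ (by omega)
        _ = _ := by ring
    have h₄ : 16 * (n * u) ≤ κ * (n * u) := Nat.mul_le_mul_right _ (by omega)
    have h₅ : 16 * w ≤ κ * w := Nat.mul_le_mul_right _ (by omega)
    rw [hZ]
    calc 2 * w + κ * w * (20 + 3 * m + T.length) + (B + 1) * (2 * n + (2 + t) * m) =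
          2 * w + 20 * (κ * w) + 3 * (κ * (m * w)) + κ * (w * T.length) +
            (B + 1) * (2 * n + (2 + t) * m) := by ring
      _ ≤ 1024 * (κ * (n * u)) + 1024 * (κ * w) := by omega
      _ = _ := by ring
  have hwκ : 128 * (k * w + w) ≤ κ * w := by
    calc _ = 128 * (k + 1) * w := by ring
      _ ≤ _ := Nat.mul_le_mul_right _ hκ
  have hlenE : 2 * n + (2 + t) * m ≤ (B + 1) * (2 * n + (2 + t) * m) :=
    Nat.le_mul_of_pos_left _ (by omega)
  have hlenV : 20 + 3 * m + T.length ≤ κ * w * (20 + 3 * m + T.length) :=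
    Nat.le_mul_of_pos_left _ (by omega)
  have hpow : ∀ {x y : ℕ}, x < 2 ^ y → y ≤ κ * w → x < 2 ^ (κ * w) := fun h h' =>
    h.trans_le (Nat.pow_le_pow_right (by norm_num) h')
  have hκw : κ * w < 2 ^ (κ * w) := Nat.lt_two_pow_self
  have hXle : X ≤ 2 * (k * w) + 2 * w + 2 := by
    rw [hX]
    exact max_le (by omega) (by omega)
  have hrep : pack (B + 1) (List.replicate f 1) < 2 ^ ((B + 1) * f) := by
    simpa using pack_lt (β := B + 1) (l := List.replicate f 1) fun x hx => by
      rw [List.eq_of_mem_replicate hx]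
      exact Nat.one_lt_two_pow (by omega)
  -- The header goes to the variables from `4` on. The entries 20 and `20 + 3 * m` are the places of
  -- the bucket table and of the dictionary.
  obtain ⟨V, hV⟩ : ∃ V, V = [2, B, B + 1, f, f ^ t, pack (B + 1) (List.replicate f 1),
    2 ^ B * pack (B + 1) (List.replicate f 1), 2 ^ (B + 1) - 1, l, D, 2 ^ X, ν, 2 ^ θ, A, s, 20,
    20 + 3 * m, w + κ * w * (20 + 3 * m + T.length), 2 ^ B, 1] ++ (U ++ T) := ⟨_, rfl⟩
  have hVl : V.length = 20 + 3 * m + T.length := by rw [hV]; simp [hUl]; omega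
  have hDB : D ≤ B := hBl ▸ Nat.le_mul_of_pos_left _ hl0
  have hVlt : ∀ x ∈ V, x < 2 ^ (κ * w) := by
    intro x hx
    rw [hV, List.mem_append, List.mem_append] at hx
    rcases hx with hx | hx | hx
    · simp only [List.mem_cons, List.not_mem_nil, or_false] at hx
      rcases hx with rfl | rfl | rfl | rfl | rfl | rfl | rfl | rfl | rfl | rfl | rfl | rfl | rfl |
        rfl | rfl | rfl | rfl | rfl | rfl | rfl
      · omega
      · omega
      · omega
      · omega
      · refine (hf ▸ ht ▸ pow_treeDepth_le hw : f ^ t ≤ w ^ 3).trans_lt ?_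
        refine hpow (y := w * 3) ?_ (by omega)
        rw [pow_mul]
        exact Nat.pow_lt_pow_left Nat.lt_two_pow_self (by norm_num)
      · exact hpow hrep (by omega)
      · refine hpow (y := B + (B + 1) * f) ?_ (by omega)
        rw [pow_add]
        exact Nat.mul_lt_mul_of_pos_left hrep (by positivity)
      · exact hpow (y := B + 1) (Nat.sub_lt (by positivity) one_pos) (by omega)
      · omega
      · omega
      · exact Nat.pow_lt_pow_right (by norm_num) (by omega)
      · omega
      · exact Nat.pow_lt_pow_right (by norm_num) (by omega)
      · exact hpow hA (by omega)
      · omega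
      · omega
      · omega
      · omega
      · exact Nat.pow_lt_pow_right (by norm_num) (by omega)
      · omega
    · rw [hU, bucketTable] at hx
      obtain ⟨h, hh, hx⟩ := mem_flat hx
      simp only [List.mem_cons, List.not_mem_nil, or_false] at hx
      rcases hx with rfl | rfl | rfl
      · have := keysBefore_le (B := B) (key := key) h
        omega
      · have := length_bucketList_le (B := B) hinj h
        omega
      · have h₁ : (bucketKeys f t (bucketList B key) h).length ≤ E.length := by
          rw [hE]; exact length_flat_le _ (by omega)
        omega
    · rcases hTe x hx with h | h | h
      · exact hpow h (by omega)
      · omega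
      · omega
  have hElt : ∀ x ∈ E, x < 2 ^ (B + 1) := fun x hx =>
    ((buckets_bucketList (B := B) (key := key)).keys_lt x (hE ▸ hx)).trans
      (Nat.pow_lt_pow_right (by norm_num) (by omega))
  have hbE : (B + 1) * E.length ≤ (B + 1) * (2 * n + (2 + t) * m) := Nat.mul_le_mul_left _ hEl
  obtain ⟨mem, L, hmem⟩ := exists_loaded hw (by omega) hVlt (pack_lt hElt)
  refine ⟨mem, hmem.trans (by rw [hVl]; omega), fun a i hau hi => ?_⟩
  have haβ : a < 2 ^ (κ * w) := hpow hau (by omega)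
  have hiβ : i < 2 ^ (κ * w) := by omega
  have hz : a * 2 ^ ν + i < 2 ^ X := by
    calc a * 2 ^ ν + i < (a + 1) * 2 ^ ν := by rw [Nat.add_mul]; omega
      _ ≤ 2 ^ u * 2 ^ ν := Nat.mul_le_mul_right _ hau
      _ = 2 ^ (u + ν) := (pow_add _ _ _).symm
      _ ≤ _ := Nat.pow_le_pow_right (by norm_num) (hX ▸ le_max_left _ _)
  refine exec_of_reach haβ hiβ (L.reach_large haβ hiβ (by omega) (by rw [hV]; rfl) fun ρ hρ => ?_)
  have hd : ∀ j < 20, ρ (4 + j) = V.getD j 0 := hρ.header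
  rw [hV] at hd
  rw [hE, hm] at L
  rw [hg] at hT
  refine (L.large (T := T) (ν := ν) (a := a) (i := i) (n := Nat.clog 2 D) (f := f) (t := t)
    (by omega) hρ.bdd
    ⟨⟨hρ.v2, hρ.v3, hd 1 (by norm_num), hd 2 (by norm_num), hd 3 (by norm_num),
      hd 5 (by norm_num), hd 6 (by norm_num), hd 7 (by norm_num), ?_, hd 19 (by norm_num)⟩,
    ⟨hρ.v2, hρ.v3, hd 8 (by norm_num), hd 9 (by norm_num), hd 10 (by norm_num),
      hd 12 (by norm_num), hd 13 (by norm_num), hd 14 (by norm_num), ?_, hd 19 (by norm_num)⟩,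
    hd 4 (by norm_num), ?_, hd 18 (by norm_num)⟩ hinj hT hBl hBX
    (Nat.pow_le_pow_right (by norm_num) (by omega)) ?_ (Nat.le_pow_clog (by norm_num) _) hf2 ?_
    (by omega) ?_ (by omega) hρ.v0 hρ.v1 (hd 11 (by norm_num)) hz).mono ?_ ?_
  · rw [hVl]; exact hd 17 (by norm_num)
  · rw [show ρ 20 = 20 + 3 * m from hd 16 (by norm_num), hV]
    exact ⟨_ ++ U, [], by rw [List.append_nil, List.append_assoc], by simp [hUl]; omega⟩
  · rw [show ρ 19 = 20 from hd 15 (by norm_num), hV, hU, hm]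
    exact ⟨_, T, rfl, rfl⟩
  · rw [hD]; exact Nat.succ_pos _
  · rw [hf, hB]; exact treeDegree_lt hw hu2
  · rw [← hm, ← hE]; omega
  · rw [hD, ht]
  · intro ρ' h
    rw [h, hkey, keyRank_sub_keyRank hnν hi]

/-! ### Time and space -/

/-- The trie depth is about `u / l ≤ 4 * 2 ^ j`. For the search trees let `b` be the field length.
If `b ^ 2 ≤ w`, the degree is at least `w / b ≥ b` and the depth is at most 6. Otherwise `w < b ^ 2`
with `b = O(l * 2 ^ j)` forces `l = O(1 + j)`, and even binary trees of depth `2 * l + 2` suffice.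
-/
theorem large_depths {w u n j : ℕ} (hw : 2 ≤ w) (hu : Nat.log 2 w < 16 * u)
    (h : u ≤ 4 * Nat.log 2 w * 2 ^ j) :
    Nat.clog 2 (trieDepth w u) ≤ j + 3 ∧ treeDepth w u n ≤ 6 * j + 58 := by
  obtain ⟨l, hl⟩ : ∃ l, l = Nat.log 2 w := ⟨_, rfl⟩
  rw [← hl] at h hu
  have hl0 : 0 < l := hl ▸ log_pos hw
  have hj : 1 ≤ 2 ^ j := Nat.one_le_two_pow
  refine ⟨Nat.clog_le_of_le_pow ?_, ?_⟩
  · have h₁ : u / l ≤ 4 * 2 ^ j := Nat.div_le_of_le_mul (by linarith)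
    rw [trieDepth, ← hl, pow_add]
    omega
  obtain ⟨b, hb⟩ : ∃ b, b = lowBits w u + 1 := ⟨_, rfl⟩
  have hb0 : 0 < b := by omega
  rcases le_or_gt (b * b) w with hbw | hbw
  · have h₁ : b ≤ w / b := (Nat.le_div_iff_mul_le hb0).2 hbw
    have h₂ : w / b ≤ treeDegree w u := hb ▸ le_max_right _ _
    have h₃ := two_le_treeDegree w u
    obtain ⟨f, hf⟩ : ∃ f, f = treeDegree w u := ⟨_, rfl⟩
    rw [← hf] at h₂ h₃
    -- Both `b` and `w / b` are at most `f`, so `w < f * (f + 1)`, and this is at most `f ^ 3`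
    -- because `f ≥ 2`.
    have h₄ : w ≤ f ^ 3 := by
      have h₅ : w < b * (w / b + 1) := Nat.lt_mul_div_succ w hb0
      have h₆ : b * (w / b + 1) ≤ f * (f + 1) := Nat.mul_le_mul (by omega) (by omega)
      nlinarith
    have h₇ : treeDepth w u n ≤ 6 := by
      refine treeDepth_le_of_le_pow ((min_le_left _ _).trans ?_)
      calc w ^ 2 ≤ (f ^ 3) ^ 2 := Nat.pow_le_pow_left h₄ _
        _ = _ := by rw [← pow_mul, hf]
    omega
  · have h₁ : b ≤ 34 * u := by
      have := lowBits_le w u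
      omega
    -- The factor `l` in the bound for `u` is absorbed into a small power of `2 ^ l`, so that after
    -- squaring the exponent `l` still dominates `2 * (l / 8)`.
    have h₂ : l ≤ 8 * 2 ^ (l / 8) := by
      have : l / 8 + 1 ≤ 2 ^ (l / 8) := Nat.lt_two_pow_self
      omega
    have h₃ : 2 ^ l ≤ w := hl ▸ Nat.pow_log_le_self 2 (by omega)
    have h₄ : b ≤ 1088 * 2 ^ (l / 8) * 2 ^ j := by
      calc b ≤ 34 * (4 * (8 * 2 ^ (l / 8)) * 2 ^ j) := by
            refine h₁.trans (Nat.mul_le_mul_left _ (h.trans ?_))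
            gcongr
        _ = _ := by ring
    have h₅ : 2 ^ l < 2 ^ (21 + 2 * (l / 8) + 2 * j) := by
      calc 2 ^ l < b * b := by omega
        _ ≤ (1088 * 2 ^ (l / 8) * 2 ^ j) * (1088 * 2 ^ (l / 8) * 2 ^ j) := Nat.mul_le_mul h₄ h₄
        _ = 1183744 * (2 ^ (2 * (l / 8)) * 2 ^ (2 * j)) := by
          rw [two_mul (l / 8), two_mul j, pow_add, pow_add]; ring
        _ ≤ 2 ^ 21 * (2 ^ (2 * (l / 8)) * 2 ^ (2 * j)) := Nat.mul_le_mul_right _ (by norm_num)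
        _ = _ := by rw [pow_add, pow_add]; ring
    have h₆ := (Nat.pow_lt_pow_iff_right (by norm_num)).1 h₅
    have h₇ := treeDepth_le_log (w := w) (u := u) (n := n)
    omega

/-- The parameter of `large_depths` is bounded by the running time that is to be shown. -/
theorem exists_depth {w σ : ℕ} (hw : 2 ≤ w) (hσ : 2 ≤ σ) :
    ∃ j : ℕ, Nat.log 2 σ + 1 ≤ 4 * Nat.log 2 w * 2 ^ j ∧
      (j : ℝ) ≤ 2 * max 1 (Real.logb 2 (Real.logb 2 σ / Real.logb 2 w)) := by
  obtain ⟨T, hT⟩ : ∃ T, T = max 1 (Real.logb 2 (Real.logb 2 σ / Real.logb 2 w)) := ⟨_, rfl⟩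
  have hT1 : 1 ≤ T := hT ▸ le_max_left _ _
  rw [← hT]
  -- Rounding up at most doubles `T`, as `T ≥ 1`.
  refine ⟨⌈T⌉₊, ?_, by have := Nat.ceil_lt_add_one (zero_le_one.trans hT1); linarith⟩
  have hw' : (1 : ℝ) ≤ Nat.log 2 w := by exact_mod_cast log_pos hw
  have hσ' : (1 : ℝ) ≤ Nat.log 2 σ := by exact_mod_cast log_pos hσ
  have h₁ : (Nat.log 2 w : ℝ) ≤ Real.logb 2 w := by exact_mod_cast Real.natLog_le_logb w 2
  have h₂ : (Nat.log 2 σ : ℝ) ≤ Real.logb 2 σ := by exact_mod_cast Real.natLog_le_logb σ 2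
  have h₃ : Real.logb 2 w ≤ Nat.log 2 w + 1 := by
    rw [Real.logb_le_iff_le_rpow (by norm_num) (by positivity)]
    have := (Nat.lt_pow_succ_log_self (b := 2) (by norm_num) w).le
    exact_mod_cast this
  have hx : 0 < Real.logb 2 σ / Real.logb 2 w := div_pos (by linarith) (by linarith)
  have h₄ : Real.logb 2 σ / Real.logb 2 w ≤ 2 ^ ⌈T⌉₊ := by
    have : Real.logb 2 (Real.logb 2 σ / Real.logb 2 w) ≤ (⌈T⌉₊ : ℝ) :=
      (hT ▸ le_max_right _ _ : _ ≤ T).trans (Nat.le_ceil T)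
    rw [Real.logb_le_iff_le_rpow (by norm_num) hx] at this
    exact_mod_cast this
  rw [div_le_iff₀ (by linarith)] at h₄
  have h₅ : (0 : ℝ) < 2 ^ ⌈T⌉₊ := by positivity
  -- The factor 4 pays for two roundings: `Nat.log 2 σ + 1` is at most twice `lg σ`, and `lg w` at
  -- most twice `Nat.log 2 w`.
  have h₆ : ((Nat.log 2 σ + 1 : ℕ) : ℝ) ≤ (4 * Nat.log 2 w * 2 ^ ⌈T⌉₊ : ℕ) := by
    push_cast
    nlinarith
  exact_mod_cast h₆

theorem exists_largeTime_le (κ : ℕ) : ∃ c, ∀ m t, largeTime κ m t ≤ c * (1 + m + t) := by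
  refine ⟨largeTime κ 0 0 + 2 * ((trieBody κ).time + 1) + 2 * ((descentBody κ).time + 1),
    fun m t => ?_⟩
  have h : largeTime κ m t = largeTime κ 0 0 + 2 * (m * ((trieBody κ).time + 1)) +
      2 * (t * ((descentBody κ).time + 1)) := by
    simp only [largeTime, queryTime]
    ring
  rw [h]
  nlinarith [Nat.zero_le (largeTime κ 0 0 * (m + t)),
    Nat.zero_le (((trieBody κ).time + 1) * (1 + t)),
    Nat.zero_le (((descentBody κ).time + 1) * (1 + m))]

/-- The total number of bits, hence every address and every count, is a legal value of a variable.
This is what the choice of `κ` has to ensure. -/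
theorem space_lt {k w n u : ℕ} (hw : 2 ≤ w) (hn : n ≤ 2 ^ (k * w)) (hu : u ≤ k * w + 1) :
    2 ^ 10 * (128 * (k + 1)) * (n * u + w) < 2 ^ (128 * (k + 1) * w) := by
  obtain ⟨x, hx⟩ : ∃ x, x = 64 * (k * w) + 64 * w := ⟨_, rfl⟩
  have hxx : x < 2 ^ x := Nat.lt_two_pow_self
  have h₁ : n * u ≤ 2 ^ (2 * (k * w)) := by
    rw [two_mul, pow_add]
    exact Nat.mul_le_mul hn (hu.trans Nat.lt_two_pow_self)
  have h₂ : 1 ≤ 2 ^ (2 * (k * w)) := Nat.one_le_two_pow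
  calc 2 ^ 10 * (128 * (k + 1)) * (n * u + w) ≤ 2 ^ 10 * (128 * (k + 1)) * (w * (n * u + 1)) := by
        refine Nat.mul_le_mul_left _ ?_
        have : n * u ≤ w * (n * u) := Nat.le_mul_of_pos_left _ (by omega)
        linarith
    _ = 2 ^ 11 * x * (n * u + 1) := by rw [hx]; ring
    _ ≤ 2 ^ 11 * x * 2 ^ (2 * (k * w) + 1) := by
        refine Nat.mul_le_mul_left _ ?_
        rw [pow_succ]
        omega
    _ < 2 ^ 11 * 2 ^ x * 2 ^ (2 * (k * w) + 1) := by gcongr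
    _ = 2 ^ (11 + x + (2 * (k * w) + 1)) := by rw [← pow_add, ← pow_add]
    _ ≤ 2 ^ (x + x) := Nat.pow_le_pow_right (by norm_num) (by omega)
    _ = _ := by rw [hx]; congr 1; ring

theorem exists_trivial_representation {κ w n : ℕ} (hw : 2 ≤ w) (hκ : 16 ≤ κ)
    (hn : n < 2 ^ (κ * w)) : ∃ mem : List (BitVec w), mem.length * w ≤ 2 ^ 10 * κ * w ∧
      ∀ a i, a < 2 ^ (κ * w) → i ≤ n → ∃ t ≤ prologueTime κ + (assign 0 (.var 1)).time,
        ∃ s, Exec mem (rankProgram κ) (State.init (8 * κ * w) a i) t s ∧ (s.reg 0).toNat = i := by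
  obtain ⟨mem, L, hmem⟩ := exists_loaded (V := List.replicate 20 0) (N := 0) (len := 0) hw hκ
    (fun x hx => by rw [List.eq_of_mem_replicate hx]; positivity) (by norm_num)
  refine ⟨mem, hmem.trans ?_, fun a i ha hi => ?_⟩
  · have : 16 * w ≤ κ * w := Nat.mul_le_mul_right _ hκ
    rw [List.length_replicate]
    linarith
  · exact exec_of_reach ha (by omega) (L.reach_trivial ha (by omega) (by simp) rfl)

end RAM

/-! ### Assembly of the three cases -/

theorem stringRank_of_forall_eq {n : ℕ} {S : Fin n → ℕ} {a i : ℕ} (hS : ∀ j, S j = a) (hi : i ≤ n) :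
    stringRank S a i = i := by
  rw [RAM.stringRank_eq_count, List.count_eq_length.2, List.length_take, List.length_ofFn,
    min_eq_left hi]
  intro b hb
  obtain ⟨j, rfl⟩ := List.mem_ofFn.1 (List.mem_of_mem_take hb)
  exact (hS j).symm

theorem theorem4 (k : ℕ) :
    ∃ (K : ℕ) (C : ℝ) (P : RAM.Cmd),
      ∀ (w n σ : ℕ), 2 ≤ w → n ≤ 2 ^ (k * w) → σ ≤ 2 ^ (k * w) →
      ∀ S : Fin n → ℕ, (∀ j, 1 ≤ S j ∧ S j ≤ σ) →
      ∃ mem : List (BitVec w),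
        ((mem.length * w : ℕ) : ℝ) ≤ C * (n * Real.logb 2 σ + w) ∧
        ∀ a i : ℕ, 1 ≤ a → a ≤ σ → i ≤ n →
          ∃ (t : ℕ) (s : RAM.State (K * w)),
            RAM.Exec mem P (RAM.State.init (K * w) a i) t s ∧
            (s.reg 0).toNat = stringRank S a i ∧
            (t : ℝ) ≤ C * max 1 (Real.logb 2 (Real.logb 2 σ / Real.logb 2 w)) := by
  obtain ⟨κ, hκ⟩ : ∃ κ, κ = 128 * (k + 1) := ⟨_, rfl⟩
  obtain ⟨c, hc⟩ := RAM.exists_largeTime_le κ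
  -- The first summand pays for space, with a factor 2 for replacing `u` by `lg σ`; the others pay
  -- for the time of the three cases. The number 76 is `62 + 7 * 2`: the depths add up to at most
  -- `62 + 7 * j`, and `j ≤ 2 * T`.
  obtain ⟨C, hC⟩ : ∃ C, C = 2 ^ 11 * κ + (RAM.prologueTime κ + (RAM.assign 0 (.var 1)).time +
    (RAM.smallCode κ).time + 76 * c) := ⟨_, rfl⟩
  refine ⟨8 * κ, (C : ℝ), RAM.rankProgram κ, fun w n σ hw hn hσ S hS => ?_⟩
  obtain ⟨T, hT⟩ : ∃ T, T = max 1 (Real.logb 2 (Real.logb 2 σ / Real.logb 2 w)) := ⟨_, rfl⟩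
  have hT1 : 1 ≤ T := hT ▸ le_max_left _ _
  rw [← hT]
  have htime : ∀ t : ℕ, t ≤ C → (t : ℝ) ≤ C * T := fun t ht => by
    have h₁ : (t : ℝ) ≤ C := by exact_mod_cast ht
    nlinarith [Nat.cast_nonneg (α := ℝ) C]
  have hpow : ∀ x, x ≤ 2 ^ (k * w) → x < 2 ^ (κ * w) := fun x hx => hx.trans_lt
    (Nat.pow_lt_pow_right (by norm_num) (by rw [hκ]; nlinarith))
  -- Here `lg σ` may vanish, so only `O(w)` bits are allowed. No string needs to be stored: all its
  -- symbols equal the queried one, or it is empty.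
  by_cases htriv : n = 0 ∨ σ ≤ 1
  · obtain ⟨mem, hmem, hrun⟩ := RAM.exists_trivial_representation hw (by omega) (hpow n hn)
    refine ⟨mem, ?_, fun a i ha haσ hi => ?_⟩
    · have h₁ : 0 ≤ Real.logb 2 σ := by
        rcases Nat.eq_zero_or_pos σ with rfl | h
        · simp
        · exact Real.logb_nonneg (by norm_num) (by exact_mod_cast h)
      have h₂ : ((mem.length * w : ℕ) : ℝ) ≤ (C * w : ℕ) := by
        refine Nat.cast_le.2 (hmem.trans (Nat.mul_le_mul_right _ ?_))
        omega
      have h₃ : 0 ≤ (C : ℝ) * (n * Real.logb 2 σ) := by positivity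
      push_cast at h₂ ⊢
      linarith
    · obtain ⟨t, ht, s, h₁, h₂⟩ := hrun a i (hpow a (haσ.trans hσ)) hi
      refine ⟨t, s, h₁, ?_, htime t (by omega)⟩
      rw [h₂]
      rcases htriv with rfl | h
      · obtain rfl : i = 0 := by omega
        simp [stringRank]
      · refine (stringRank_of_forall_eq (fun j => ?_) hi).symm
        have := hS j
        omega
  push Not at htriv
  obtain ⟨hn0, hσ2⟩ := htriv
  obtain ⟨u, hu⟩ : ∃ u, u = Nat.log 2 σ + 1 := ⟨_, rfl⟩
  have hlogσ : 0 < Nat.log 2 σ := RAM.log_pos hσ2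
  have hσu : σ < 2 ^ u := hu ▸ Nat.lt_pow_succ_log_self (by norm_num) σ
  have huk : u ≤ k * w + 1 := by
    have : Nat.log 2 σ ≤ k * w := (Nat.log_mono_right hσ).trans (by rw [Nat.log_pow (by norm_num)])
    omega
  have hβ : 2 ^ 10 * κ * (n * u + w) < 2 ^ (κ * w) := hκ ▸ RAM.space_lt hw hn huk
  have hspace : ∀ x : ℕ, x ≤ 2 ^ 10 * κ * (n * u + w) → (x : ℝ) ≤ C * (n * Real.logb 2 σ + w) := by
    intro x hx
    have h₁ : (u : ℝ) ≤ 2 * Real.logb 2 σ := by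
      have h₂ : (Nat.log 2 σ : ℝ) ≤ Real.logb 2 σ := by exact_mod_cast Real.natLog_le_logb σ 2
      have h₃ : (u : ℝ) ≤ (2 * Nat.log 2 σ : ℕ) := Nat.cast_le.2 (by omega)
      push_cast at h₃
      linarith
    have h₄ : (x : ℝ) ≤ (2 ^ 10 * κ * (n * u + w) : ℕ) := Nat.cast_le.2 hx
    have h₅ : ((2 ^ 11 * κ : ℕ) : ℝ) ≤ C := Nat.cast_le.2 (by omega)
    push_cast at h₄ h₅
    have h₆ : (0 : ℝ) ≤ Real.logb 2 σ := by
      have := Nat.cast_nonneg (α := ℝ) u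
      linarith
    calc (x : ℝ) ≤ 1024 * κ * (n * u + w) := h₄
      _ ≤ 1024 * κ * (n * (2 * Real.logb 2 σ) + 2 * w) := by
        gcongr
        linarith [Nat.cast_nonneg (α := ℝ) w]
      _ = 2048 * κ * (n * Real.logb 2 σ + w) := by ring
      _ ≤ _ := by gcongr
  rcases le_or_gt (16 * u) (Nat.log 2 w) with hsmall | hlarge
  · obtain ⟨mem, hmem, hrun⟩ := RAM.exists_small_representation hw (by omega) hsmall (by omega) hβ S
      fun j => (hS j).2.trans_lt hσu
    refine ⟨mem, hspace _ hmem, fun a i ha haσ hi => ?_⟩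
    obtain ⟨t, ht, s, h₁, h₂⟩ := hrun a i ha (haσ.trans_lt hσu) hi
    exact ⟨t, s, h₁, h₂, htime t (by omega)⟩
  · obtain ⟨mem, hmem, hrun⟩ := RAM.exists_large_representation hw hκ.ge hlarge (by omega) huk
      (by omega) hn hβ S
    refine ⟨mem, hspace _ hmem, fun a i ha haσ hi => ?_⟩
    obtain ⟨t, ht, s, h₁, h₂⟩ := hrun a i (haσ.trans_lt hσu) hi
    refine ⟨t, s, h₁, h₂, ?_⟩
    obtain ⟨j, hj, hjT⟩ := RAM.exists_depth hw hσ2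
    rw [← hu] at hj
    rw [← hT] at hjT
    obtain ⟨d₁, d₂⟩ := RAM.large_depths (n := n) hw hlarge hj
    obtain ⟨p, hp⟩ : ∃ p, p = RAM.prologueTime κ := ⟨_, rfl⟩
    rw [← hp] at ht hC
    have h₃ : t ≤ p + c * (62 + 7 * j) :=
      ht.trans (Nat.add_le_add_left ((hc _ _).trans (Nat.mul_le_mul_left _ (by omega))) _)
    have h₄ : (t : ℝ) ≤ (p + c * (62 + 7 * j) : ℕ) := Nat.cast_le.2 h₃
    have h₅ : ((p + 76 * c : ℕ) : ℝ) ≤ C := Nat.cast_le.2 (by omega)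
    push_cast at h₄ h₅
    calc (t : ℝ) ≤ p + c * (62 + 7 * j) := h₄
      _ ≤ p * T + c * (62 * T + 7 * (2 * T)) := by
        have : (p : ℝ) ≤ p * T := le_mul_of_one_le_right (by positivity) hT1
        gcongr
        linarith
      _ = (p + 76 * c) * T := by ring
      _ ≤ _ := mul_le_mul_of_nonneg_right h₅ (zero_le_one.trans hT1)
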